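/- \textbf{Setting.} Let $m,d,l\ge 0$ be integers, $\Theta\subset\mathbb R^d$, let $P_0$ be a probability measure on $\mathbb R^m$, let $X_1,X_2,\dots$ be i.i.d. with law $P_0$ (and $X$ a generic variable with this law), and let $g=(g_1,\dots,g_l)^\top:\mathbb R^m\times\Theta\to\mathbb R^l$ be Borel measurable. Let $\varphi:\mathbb R\to[0,+\infty]$ be a closed (i.e. lower semicontinuous) convex function with $\varphi(1)=0$, whose domain $\{\varphi<\infty\}$ is an interval with endpoints $a<1<b$ ($-\infty\le a$, $b\le+\infty$), strictly convex on its domain, twice continuously differentiable on $]a,b[$, with $\varphi''(1)=1$, and essentially smooth: $\varphi'(x)\to-\infty$ as $x\downarrow a$ if $a$ is finite, and $\varphi'(x)\to+\infty$ as $x\uparrow b$ if $b$ is finite. Let $\psi(s)=\sup_{x\in\mathbb R}\{sx-\varphi(x)\}$ be its convex conjugate and let $a^*<0<b^*$ be the endpoints of the interval $\{\psi<\infty\}$. For $t=(t_0,\dots,t_l)\in\mathbb R^{1+l}$ put $t^\top\overline g(x,\theta)=t_0+\sum_{j=1}^l t_jg_j(x,\theta)$, and let $\Lambda^{(n)}_\theta=\{t\in\mathbb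 R^{1+l}: a^*<t^\top\overline g(X_i,\theta)<b^*,\ i=1,\dots,n\}$. Define, with values in $[0,+\infty]$ for $n\ge1$, $$\widehat D_\varphi(\mathcal M_\theta,P_0)=\sup_{t\in\Lambda^{(n)}_\theta}\frac1n\sum_{i=1}^n\bigl(t_0-\psi(t^\top\overline g(X_i,\theta))\bigr),\qquad \widehat D_\varphi(\mathcal M,P_0)=\inf_{\theta\in\Theta}\widehat D_\varphi(\mathcal M_\theta,P_0),$$ and let $\widehat\theta_\varphi$ be a random vector which, with probability tending to one as $n\to\infty$, belongs to $\Theta$ and attains this infimum. \textbf{Assumption 1.} a) $\theta_0\in\Theta$ is the unique solution in $\Theta$ of $\mathbb E[g(X,\theta)]=0$; b) $\Theta$ is compact; c) at each $\theta\in\Theta$, $g(X,\cdot)$ is continuous at $\theta$ with probability one; d) $\mathbb E[\sup_{\theta\in\Theta}\|g(X,\theta)\|^\alpha]<\infty$ for some $\alpha>2$; e) the matrix $\Omega=\mathbb E[g(X,\theta_0)g(X,\theta_0)^\top]$ is nonsingular. \textbf{Assumption 2.} a) $\theta_0\in\mathrm{int}(\Theta)$; b) there is an open neighborhood $N\subset\Theta$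 of $\theta_0$ such that with probability one $g(X,\cdot)$ is continuously differentiable on $N$, and $\mathbb E[\sup_{\theta\in N}\|\partial g(X,\theta)/\partial\theta\|]<\infty$; c) the $d\times l$ matrix $G=\mathbb E[\partial g(X,\theta_0)/\partial\theta]$ with entries $\mathbb E[\partial g_j(X,\theta_0)/\partial\theta_i]$ has rank $d$. \textbf{Theorem.} Under Assumptions 1 and 2: \begin{enumerate} \item[1)] $\sqrt n\,(\widehat\theta_\varphi-\theta_0)$ converges in distribution to a centered normal vector with covariance matrix $V=[G\,\Omega^{-1}G^\top]^{-1}$. \item[2)] If $l>d$, then $2n\,\widehat D_\varphi(\mathcal M,P_0)$ converges in distribution to a $\chi^2$ random variable with $l-d$ degrees of freedom. \end{enumerate} -/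

import Mathlib

open MeasureTheory ProbabilityTheory Filter Topology Set
open scoped ENNReal Matrix

namespace MinDiv

noncomputable section

/-! ### The divergence function and its convex conjugate -/

/-- The effective domain `{x | φ x < ∞}`. -/
def dom (φ : ℝ → ℝ≥0∞) : Set ℝ := {x | φ x < ∞}

/-- The real-valued version of `φ`, meaningful on `dom φ`. -/
def realVal (φ : ℝ → ℝ≥0∞) (x : ℝ) : ℝ := (φ x).toReal

/-- The class of functions `φ : ℝ → [0, ∞]` which generate the divergences: closed functions with
`φ 1 = 0`, whose domain is an interval with endpoints `a < 1 < b`, strictly convex on the domain,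
twice continuously differentiable in its interior, essentially smooth, and normalized by
`φ'' 1 = 1`.  (Convexity of the domain is a part of `StrictConvexOn`.) -/
structure IsDivergenceFunction (φ : ℝ → ℝ≥0∞) : Prop where
  map_one : φ 1 = 0
  one_mem : (1 : ℝ) ∈ interior (dom φ)
  strictConvex : StrictConvexOn ℝ (dom φ) (realVal φ)
  closed : LowerSemicontinuous φ
  smooth : ContDiffOn ℝ 2 (realVal φ) (interior (dom φ))
  essentiallySmooth_left : BddBelow (dom φ) →
    Tendsto (deriv (realVal φ)) (𝓝[>] (sInf (dom φ))) atBot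
  essentiallySmooth_right : BddAbove (dom φ) →
    Tendsto (deriv (realVal φ)) (𝓝[<] (sSup (dom φ))) atTop
  normalized : deriv (deriv (realVal φ)) 1 = 1

/-- The Fenchel-Legendre transform `ψ s = sup_x (s x - φ x)`. -/
def conjugate (φ : ℝ → ℝ≥0∞) (s : ℝ) : EReal := ⨆ x : ℝ, ((s * x : ℝ) : EReal) - (φ x : EReal)

/-- The left endpoint `a*` of the domain of `ψ`. -/
def conjLeft (φ : ℝ → ℝ≥0∞) : EReal := sInf ((fun s : ℝ => (s : EReal)) '' {s | conjugate φ s < ⊤})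

/-- The right endpoint `b*` of the domain of `ψ`. -/
def conjRight (φ : ℝ → ℝ≥0∞) : EReal :=
  sSup ((fun s : ℝ => (s : EReal)) '' {s | conjugate φ s < ⊤})

/-! ### The minimum divergence criterion -/

variable {m d l : ℕ}

/-- `tᵀ ḡ(x, θ) = t₀ + ∑ j, t_j g_j(x, θ)` for `t = (t₀, t₁, …, t_l)`. -/
def lin (g : (Fin m → ℝ) → (Fin d → ℝ) → Fin l → ℝ) (x : Fin m → ℝ) (θ : Fin d → ℝ)
    (t : Fin (l + 1) → ℝ) : ℝ :=
  t 0 + ∑ j : Fin l, t j.succ * g x θ j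

/-- `m(x, θ, t) = t₀ - ψ(tᵀ ḡ(x, θ))`, meaningful where `ψ` is finite. -/
def crit (φ : ℝ → ℝ≥0∞) (g : (Fin m → ℝ) → (Fin d → ℝ) → Fin l → ℝ) (x : Fin m → ℝ)
    (θ : Fin d → ℝ) (t : Fin (l + 1) → ℝ) : ℝ :=
  t 0 - (conjugate φ (lin g x θ t)).toReal

/-- The set of all `t` such that `a* < tᵀ ḡ(x_i, θ) < b*` for all points of the sample. -/
def dualSet (φ : ℝ → ℝ≥0∞) (g : (Fin m → ℝ) → (Fin d → ℝ) → Fin l → ℝ) {n : ℕ}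
    (x : Fin n → Fin m → ℝ) (θ : Fin d → ℝ) : Set (Fin (l + 1) → ℝ) :=
  {t | ∀ i, conjLeft φ < (lin g (x i) θ t : EReal) ∧ (lin g (x i) θ t : EReal) < conjRight φ}

/-- The estimate of the divergence between the submodel with parameter `θ` and the law of the
sample; it can be `+∞`. -/
def divAt (φ : ℝ → ℝ≥0∞) (g : (Fin m → ℝ) → (Fin d → ℝ) → Fin l → ℝ) {n : ℕ}
    (x : Fin n → Fin m → ℝ) (θ : Fin d → ℝ) : EReal :=
  ⨆ t ∈ dualSet φ g x θ, (((n : ℝ)⁻¹ * ∑ i, crit φ g (x i) θ t : ℝ) : EReal)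

/-- The estimate of the divergence between the whole model and the law of the sample. -/
def divModel (φ : ℝ → ℝ≥0∞) (g : (Fin m → ℝ) → (Fin d → ℝ) → Fin l → ℝ) (Θ : Set (Fin d → ℝ))
    {n : ℕ} (x : Fin n → Fin m → ℝ) : EReal :=
  ⨅ θ ∈ Θ, divAt φ g x θ

/-- `θ` is a value of the minimum divergence estimate: it belongs to `Θ` and attains the infimum
over `Θ` of the estimated divergence. -/
def IsMinDivEstimate (φ : ℝ → ℝ≥0∞) (g : (Fin m → ℝ) → (Fin d → ℝ) → Fin l → ℝ)
    (Θ : Set (Fin d → ℝ)) {n : ℕ} (x : Fin n → Fin m → ℝ) (θ : Fin d → ℝ) : Prop :=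
  θ ∈ Θ ∧ divAt φ g x θ = divModel φ g Θ x

/-! ### The assumptions on the model -/

/-- `Ω = E[g(X, θ) g(X, θ)ᵀ]`, an `l × l` matrix. -/
def momentMatrix (g : (Fin m → ℝ) → (Fin d → ℝ) → Fin l → ℝ) (P₀ : Measure (Fin m → ℝ))
    (θ : Fin d → ℝ) : Matrix (Fin l) (Fin l) ℝ :=
  Matrix.of fun i j => ∫ x, g x θ i * g x θ j ∂P₀

/-- `G = E[∂g(X, θ)/∂θ]`, the `d × l` matrix with entries `E[∂g_j(X, θ)/∂θ_i]`. -/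
def gradMatrix (g : (Fin m → ℝ) → (Fin d → ℝ) → Fin l → ℝ) (P₀ : Measure (Fin m → ℝ))
    (θ : Fin d → ℝ) : Matrix (Fin d) (Fin l) ℝ :=
  Matrix.of fun i j => ∫ x, fderiv ℝ (g x) θ (Pi.single i 1) j ∂P₀

/-- Identification and moment conditions.  Here `P₀` is a probability measure, so that
`∫ g(x, θ₀) dP₀ = 0` says that `P₀` belongs to the model. -/
structure IsIdentified (g : (Fin m → ℝ) → (Fin d → ℝ) → Fin l → ℝ) (Θ : Set (Fin d → ℝ))
    (P₀ : Measure (Fin m → ℝ)) (θ₀ : Fin d → ℝ) : Prop where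
  measurable : Measurable fun p : (Fin m → ℝ) × Θ => g p.1 p.2
  mem : θ₀ ∈ Θ
  moment_eq_zero : ∫ x, g x θ₀ ∂P₀ = 0
  unique : ∀ θ ∈ Θ, ∫ x, g x θ ∂P₀ = 0 → θ = θ₀
  compact : IsCompact Θ
  continuous : ∀ θ ∈ Θ, ∀ᵐ x ∂P₀, ContinuousWithinAt (g x) Θ θ
  moment_bound : ∃ α : ℝ, 2 < α ∧ ∫⁻ x, ⨆ θ ∈ Θ, ‖g x θ‖ₑ ^ α ∂P₀ < ∞
  nonsingular : IsUnit (momentMatrix g P₀ θ₀)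

/-- Smoothness and rank conditions at `θ₀`. -/
structure IsSmooth (g : (Fin m → ℝ) → (Fin d → ℝ) → Fin l → ℝ) (Θ : Set (Fin d → ℝ))
    (P₀ : Measure (Fin m → ℝ)) (θ₀ : Fin d → ℝ) : Prop where
  mem_interior : θ₀ ∈ interior Θ
  differentiable : ∃ N : Set (Fin d → ℝ), IsOpen N ∧ θ₀ ∈ N ∧ N ⊆ Θ ∧
    (∀ᵐ x ∂P₀, ContDiffOn ℝ 1 (g x) N) ∧ ∫⁻ x, ⨆ θ ∈ N, ‖fderiv ℝ (g x) θ‖ₑ ∂P₀ < ∞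
  rank_eq : (gradMatrix g P₀ θ₀).rank = d

/-! ### Limit laws -/

/-- The chi-square law with `k` degrees of freedom: the law of the sum of the squares of `k`
independent standard normal variables. -/
def chiSquare (k : ℕ) : Measure ℝ :=
  (Measure.pi fun _ : Fin k => gaussianReal 0 1).map fun z => ∑ i, z i ^ 2

/-- Convergence in distribution of extended real valued statistics to a law on `ℝ`: convergence
of the distribution functions at every continuity point of the limit. -/
def TendstoInLaw {S : Type*} [MeasurableSpace S] (μ : Measure S) (T : ℕ → S → EReal)
    (ν : Measure ℝ) : Prop :=
  ∀ c : ℝ, ν {c} = 0 → Tendsto (fun n => μ {ω | T n ω ≤ (c : EReal)}) atTop (𝓝 (ν (Iic c)))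

end

end MinDiv

/-!
# Asymptotics of minimum divergence estimates in moment condition models

The criterion is a saddle point: `divAt` is a supremum over a dual vector `t = (t₀, τ)`, and
`divModel` its infimum over the parameter `θ`. The proof replaces both by explicit quadratic
problems, with errors which vanish in probability.

* The conjugate `ψ` satisfies `ψ(s) = s + s² / 2 + o(s²)` at the origin
  (`IsDivergenceFunction.conjugate_expansion`), and it is convex with `ψ(0) = 0`. Hence the dual
  criterion is concave along rays and vanishes at the origin: once it is nonpositive on a small
  sphere, its supremum over the dual set, whatever the size of this set, is governed by the ball
  bounded by that sphere (`divAt_le`). No minimax theorem and no uniqueness of the dual optimum are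
  needed.
* Because a moment of order larger than two is finite, `max ‖g(Xᵢ, θ)‖ = o(√n)` uniformly in `θ`, so
  that dual vectors of order `1 / √n` keep all arguments of `ψ` small. Where
  `w = √n ĝ(θ)` is bounded and the sample second moments are close to `Ω`, the criterion at `t` is,
  up to the factor `1 / n`, the quadratic function `-b·w - (a² + b·Ωb) / 2` of `(a, b) = √n t`, and
  `2 n divAt` is close to `w·Ω⁻¹w` (`divAt_sandwich`).
* The test vectors `± eⱼ / √n` show that `√n ‖ĝ(θ)‖` is bounded wherever `2 n divAt` is bounded
  (`sqrt_mul_abs_sampleMoment_sub_le`). With the uniform law of large numbers over the compact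
  parameter set and the rank condition, such parameters are at a distance of order `1 / √n` from
  `θ₀` (`exists_eventually_norm_le`); this gives consistency and rate at once.
* Near `θ₀` the sample moments are uniformly differentiable with gradient `Gᵀ`
  (`exists_eventually_sampleMoment_sub`), so that `2 n divAt` at `θ₀ + u / √n` is close to the
  quadratic form `Ω⁻¹` at `z + Gᵀ u`, where `z = √n ĝ(θ₀)` is the score. Its minimizer is
  `u = -(G Ω⁻¹ Gᵀ)⁻¹ G Ω⁻¹ z`, and by Pythagoras' theorem for `Ω⁻¹` the estimate must be close to it
  (`eventually_expansion`).
* By the central limit theorem `z` is asymptotically `N(0, Ω)` (`tendstoInDistribution_score`). The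
  minimizer is then asymptotically normal with covariance matrix `(G Ω⁻¹ Gᵀ)⁻¹`, and the minimum is
  a sum of squares of `l - d` uncorrelated standard linear forms of `z`
  (`exists_quad_residual_eq_sum_sq`), hence asymptotically chi-square.

Events defined by `divModel`, and suprema over `θ`, need not be Borel measurable. "With probability tending to one" is therefore expressed through outer measure,
by the filter `whp`, and the suprema to which laws of large numbers are applied are almost
everywhere measurable because analytic sets are universally measurable (`aemeasurable_iSup_mem`).
-/

namespace MinDiv

/-! ### The conjugate function near the origin -/

section Conjugate

variable {φ : ℝ → ℝ≥0∞}

lemma IsDivergenceFunction.mem_dom_one (hφ : IsDivergenceFunction φ) : (1 : ℝ) ∈ dom φ :=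
  interior_subset hφ.one_mem

lemma IsDivergenceFunction.realVal_one (hφ : IsDivergenceFunction φ) : realVal φ 1 = 0 := by
  simp [realVal, hφ.map_one]

lemma realVal_nonneg (x : ℝ) : 0 ≤ realVal φ x := ENNReal.toReal_nonneg

lemma coe_eq_coe_realVal {x : ℝ} (hx : x ∈ dom φ) : (φ x : EReal) = (realVal φ x : EReal) := by
  rw [realVal]
  exact (EReal.coe_ennreal_toReal (ne_of_lt hx)).symm

/-- A second order expansion of `φ` at its minimum point `1`. -/
lemma IsDivergenceFunction.realVal_expansion (hφ : IsDivergenceFunction φ) {ε : ℝ} (hε : 0 < ε) :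
    ∃ δ > 0, ∀ y : ℝ, |y| ≤ δ → 1 + y ∈ dom φ ∧ |realVal φ (1 + y) - y ^ 2 / 2| ≤ ε * y ^ 2 := by
  set f := realVal φ with hf
  have hopen : IsOpen (interior (dom φ)) := isOpen_interior
  have hmin : IsLocalMin f 1 := Filter.Eventually.of_forall fun x => by
    rw [hf, hφ.realVal_one]; exact realVal_nonneg x
  have hd1 : deriv f 1 = 0 := hmin.deriv_eq_zero
  have hdiff : ∀ x ∈ interior (dom φ), DifferentiableAt ℝ f x := fun x hx =>
    (hφ.smooth.differentiableOn (by norm_num)).differentiableAt (hopen.mem_nhds hx)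
  have hdd : HasDerivAt (deriv f) 1 1 := by
    have h1 : ContDiffOn ℝ 1 (deriv f) (interior (dom φ)) :=
      hφ.smooth.deriv_of_isOpen hopen (by norm_num)
    have h2 : DifferentiableAt ℝ (deriv f) 1 :=
      (h1.differentiableOn (by norm_num)).differentiableAt (hopen.mem_nhds hφ.one_mem)
    have h3 := h2.hasDerivAt
    rwa [hφ.normalized] at h3
  have hlo := (hasDerivAt_iff_isLittleO_nhds_zero.1 hdd).def hε
  have hin : ∀ᶠ y : ℝ in 𝓝 0, 1 + y ∈ interior (dom φ) := by
    have : Tendsto (fun y : ℝ => 1 + y) (𝓝 0) (𝓝 1) := by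
      have h : Continuous fun y : ℝ => 1 + y := by fun_prop
      simpa using h.tendsto 0
    exact this.eventually (hopen.mem_nhds hφ.one_mem)
  obtain ⟨δ, hδ, H⟩ := Metric.eventually_nhds_iff.1 (hlo.and hin)
  refine ⟨δ / 2, by positivity, fun y hy => ?_⟩
  have H' : ∀ v ∈ Icc (-|y|) |y|, 1 + v ∈ interior (dom φ) ∧ |deriv f (1 + v) - v| ≤ ε * |y| := by
    intro v hv
    have hv' : |v| ≤ |y| := abs_le.2 hv
    have h := @H v (by simp only [dist_zero_right, Real.norm_eq_abs]; linarith)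
    refine ⟨h.2, ?_⟩
    have h1 := h.1
    simp only [hd1, smul_eq_mul, mul_one, sub_zero, Real.norm_eq_abs] at h1
    exact h1.trans (by gcongr)
  have hymem : y ∈ Icc (-|y|) |y| := ⟨neg_abs_le y, le_abs_self y⟩
  refine ⟨interior_subset (H' y hymem).1, ?_⟩
  have key := (convex_Icc (-|y|) |y|).norm_image_sub_le_of_norm_hasDerivWithin_le
    (f := fun v => f (1 + v) - v ^ 2 / 2) (f' := fun v => deriv f (1 + v) - v) (C := ε * |y|)
    (x := 0) (y := y) ?_ (fun v hv => (H' v hv).2)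
    ⟨by simp, by simp⟩ hymem
  · simp only [Real.norm_eq_abs, add_zero, hφ.realVal_one, hf] at key
    have : ε * |y| * |y| = ε * y ^ 2 := by rw [mul_assoc, abs_mul_abs_self, sq]
    simpa [this] using key
  · intro v hv
    have h1 : HasDerivAt (fun v => f (1 + v)) (deriv f (1 + v)) v := by
      have := (hdiff _ (H' v hv).1).hasDerivAt
      exact HasDerivAt.comp_const_add 1 v this
    have h2 : HasDerivAt (fun v : ℝ => v ^ 2 / 2) v v := by
      have := (hasDerivAt_pow 2 v).div_const 2
      simpa using this
    exact (h1.sub h2).hasDerivWithinAt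

lemma conjugate_le_coe_iff {s c : ℝ} :
    conjugate φ s ≤ c ↔ ∀ x ∈ dom φ, s * x - realVal φ x ≤ c := by
  refine ⟨fun h x hx => ?_, fun h => iSup_le fun x => ?_⟩
  · have := (le_iSup (fun x : ℝ => ((s * x : ℝ) : EReal) - (φ x : EReal)) x).trans h
    simp only [coe_eq_coe_realVal hx] at this
    exact_mod_cast this
  · by_cases hx : x ∈ dom φ
    · rw [coe_eq_coe_realVal hx]
      exact_mod_cast h x hx
    · have : φ x = ∞ := by simpa [dom] using hx
      rw [this]
      simp [EReal.sub_top]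

lemma IsDivergenceFunction.coe_le_conjugate (hφ : IsDivergenceFunction φ) (s : ℝ) :
    (s : EReal) ≤ conjugate φ s := by
  have := le_iSup (fun x : ℝ => ((s * x : ℝ) : EReal) - (φ x : EReal)) 1
  simp only [hφ.map_one, mul_one, EReal.coe_ennreal_zero, sub_zero] at this
  exact this

/-- The conjugate takes finite values only, except for `∞`. -/
lemma IsDivergenceFunction.coe_toReal_conjugate (hφ : IsDivergenceFunction φ) {s : ℝ}
    (hs : conjugate φ s < ⊤) : ((conjugate φ s).toReal : EReal) = conjugate φ s :=
  EReal.coe_toReal hs.ne (ne_of_gt ((EReal.bot_lt_coe s).trans_le (hφ.coe_le_conjugate s)))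

lemma IsDivergenceFunction.toReal_conjugate_le_iff (hφ : IsDivergenceFunction φ) {s c : ℝ}
    (hs : conjugate φ s < ⊤) :
    (conjugate φ s).toReal ≤ c ↔ ∀ x ∈ dom φ, s * x - realVal φ x ≤ c := by
  rw [← conjugate_le_coe_iff, ← hφ.coe_toReal_conjugate hs]
  simp

/-- Convexity of the conjugate along rays from the origin, where it vanishes. -/
lemma IsDivergenceFunction.conjugate_mul_le (hφ : IsDivergenceFunction φ) {s r : ℝ}
    (hr0 : 0 ≤ r) (hr1 : r ≤ 1) (hs : conjugate φ s < ⊤) :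
    conjugate φ (r * s) < ⊤ ∧ (conjugate φ (r * s)).toReal ≤ r * (conjugate φ s).toReal := by
  have h : conjugate φ (r * s) ≤ ((r * (conjugate φ s).toReal : ℝ) : EReal) := by
    refine conjugate_le_coe_iff.2 fun x hx => ?_
    have h1 := (hφ.toReal_conjugate_le_iff hs).1 le_rfl x hx
    nlinarith [mul_le_mul_of_nonneg_left h1 hr0, realVal_nonneg (φ := φ) x]
  have hlt := h.trans_lt (EReal.coe_lt_top _)
  refine ⟨hlt, ?_⟩
  rw [← hφ.coe_toReal_conjugate hlt] at h
  exact_mod_cast h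

lemma IsDivergenceFunction.conjugate_lt_top (hφ : IsDivergenceFunction φ) {s : ℝ}
    (hl : conjLeft φ < s) (hr : s < conjRight φ) : conjugate φ s < ⊤ := by
  rcases le_total 0 s with h0 | h0
  · obtain ⟨_, ⟨v, hv, rfl⟩, hsv⟩ := lt_sSup_iff.1 hr
    have hsv' : s < v := EReal.coe_lt_coe_iff.1 hsv
    have hv0 : 0 < v := h0.trans_lt hsv'
    have := (hφ.conjugate_mul_le (r := s / v) (by positivity)
      (by rw [div_le_one hv0]; exact hsv'.le) hv).1
    rwa [div_mul_cancel₀ _ hv0.ne'] at this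
  · obtain ⟨_, ⟨v, hv, rfl⟩, hsv⟩ := sInf_lt_iff.1 hl
    have hsv' : v < s := EReal.coe_lt_coe_iff.1 hsv
    have hv0 : v < 0 := hsv'.trans_le h0
    have := (hφ.conjugate_mul_le (r := s / v) (div_nonneg_of_nonpos h0 hv0.le)
      (by rw [div_le_one_of_neg hv0]; exact hsv'.le) hv).1
    rwa [div_mul_cancel₀ _ hv0.ne] at this

/-- Away from `1` a divergence function grows at least linearly; this makes its conjugate finite
near the origin. -/
lemma IsDivergenceFunction.mul_abs_le_realVal (hφ : IsDivergenceFunction φ) {δ c : ℝ} (hδ : 0 < δ)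
    (hc : ∀ y : ℝ, |y| = δ → 1 + y ∈ dom φ ∧ c * δ ≤ realVal φ (1 + y)) {x : ℝ} (hx : x ∈ dom φ)
    (hxδ : δ ≤ |x - 1|) : c * |x - 1| ≤ realVal φ x := by
  have hpos : 0 < |x - 1| := hδ.trans_le hxδ
  set r := δ / |x - 1| with hr
  have hr0 : 0 < r := by positivity
  have hr1 : r ≤ 1 := by rw [hr, div_le_one hpos]; exact hxδ
  have habs : |r * (x - 1)| = δ := by
    rw [abs_mul, abs_of_pos hr0, hr, div_mul_cancel₀ _ hpos.ne']
  have h1 := (hc _ habs).2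
  have h2 := hφ.strictConvex.convexOn.2 hφ.mem_dom_one hx (sub_nonneg.2 hr1) hr0.le (by ring)
  simp only [smul_eq_mul, hφ.realVal_one, mul_zero, zero_add] at h2
  have h3 : (1 - r) * 1 + r * x = 1 + r * (x - 1) := by ring
  rw [h3] at h2
  have h4 : c * (r * |x - 1|) ≤ r * realVal φ x := by
    have : r * |x - 1| = δ := by rw [hr, div_mul_cancel₀ _ hpos.ne']
    rw [this]; exact h1.trans h2
  nlinarith [mul_pos hr0 hr0]

/-- The second order expansion of the conjugate at the origin. -/
lemma IsDivergenceFunction.conjugate_expansion (hφ : IsDivergenceFunction φ) {ε : ℝ} (hε : 0 < ε) :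
    ∃ δ > 0, ∀ s : ℝ, |s| ≤ δ → conjLeft φ < s ∧ s < conjRight φ ∧
      |(conjugate φ s).toReal - s - s ^ 2 / 2| ≤ ε * s ^ 2 := by
  wlog hε1 : ε ≤ 1 / 4 generalizing ε
  · obtain ⟨δ, hδ, H⟩ := this (ε := 1 / 4) (by norm_num) le_rfl
    refine ⟨δ, hδ, fun s hs => ⟨(H s hs).1, (H s hs).2.1, (H s hs).2.2.trans ?_⟩⟩
    gcongr
    exact le_of_not_ge hε1
  obtain ⟨δ, hδ, H⟩ := hφ.realVal_expansion (ε := ε / 4) (by positivity)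
  have hup : ∀ s : ℝ, |s| ≤ δ / 4 → conjugate φ s ≤ ((s + s ^ 2 / 2 + ε * s ^ 2 : ℝ) : EReal) := by
    intro s hs
    refine conjugate_le_coe_iff.2 fun x hx => ?_
    rcases le_total (|x - 1|) δ with h | h
    · have h1 := abs_le.1 (H (x - 1) h).2
      have h2 : 1 + (x - 1) = x := by ring
      rw [h2] at h1
      -- the maximum over `y` of `s * y - (1 - ε / 2) * y ^ 2 / 2` is attained at a multiple of `s`
      nlinarith [h1.1, sq_nonneg (s - (1 - ε / 2) * (x - 1)), sq_nonneg s, sq_nonneg (x - 1),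
        mul_nonneg hε.le (sq_nonneg s), mul_nonneg (mul_nonneg hε.le hε.le) (sq_nonneg s)]
    · have h1 := hφ.mul_abs_le_realVal (c := δ / 4) hδ (fun y hy => ?_) hx h
      · have h3 : s * (x - 1) ≤ δ / 4 * |x - 1| := by
          calc s * (x - 1) ≤ |s * (x - 1)| := le_abs_self _
            _ = |s| * |x - 1| := abs_mul _ _
            _ ≤ _ := by gcongr
        nlinarith [sq_nonneg s, mul_nonneg hε.le (sq_nonneg s)]
      · have h4 := H y hy.le
        refine ⟨h4.1, ?_⟩
        have h5 := (abs_le.1 h4.2).1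
        rw [← sq_abs y, hy] at h5
        nlinarith [sq_nonneg δ]
  have hfin : ∀ s : ℝ, |s| ≤ δ / 4 → conjugate φ s < ⊤ := fun s hs =>
    (hup s hs).trans_lt (EReal.coe_lt_top _)
  refine ⟨δ / 8, by positivity, fun s hs => ⟨?_, ?_, abs_le.2 ⟨?_, ?_⟩⟩⟩
  · refine lt_of_le_of_lt (sInf_le ⟨-(δ / 4), hfin _ ?_, rfl⟩) ?_
    · rw [abs_neg, abs_of_pos (by positivity)]
    · have := (abs_le.1 hs).1
      exact EReal.coe_lt_coe_iff.2 (by linarith)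
  · refine lt_of_lt_of_le ?_ (le_sSup ⟨δ / 4, hfin _ ?_, rfl⟩)
    · have := (abs_le.1 hs).2
      exact EReal.coe_lt_coe_iff.2 (by linarith)
    · rw [abs_of_pos (by positivity)]
  · have h1 := H s (by linarith)
    have h2 := (hφ.toReal_conjugate_le_iff (hfin s (by linarith))).1 le_rfl _ h1.1
    have h3 := (abs_le.1 h1.2).2
    nlinarith [sq_nonneg s, mul_nonneg hε.le (sq_nonneg s)]
  · have h1 := hup s (by linarith)
    rw [← hφ.coe_toReal_conjugate (hfin s (by linarith))] at h1
    have h2 : (conjugate φ s).toReal ≤ s + s ^ 2 / 2 + ε * s ^ 2 := by exact_mod_cast h1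
    linarith

end Conjugate

/-! ### Bounds for the dual criterion -/

section Dual

/-- The arithmetic mean of a finite family of numbers. -/
noncomputable def avg {n : ℕ} (f : Fin n → ℝ) : ℝ := (n : ℝ)⁻¹ * ∑ i, f i

section Avg

variable {n : ℕ}

lemma avg_add (f g : Fin n → ℝ) : avg (fun i => f i + g i) = avg f + avg g := by
  simp [avg, Finset.sum_add_distrib, mul_add]

lemma avg_sub (f g : Fin n → ℝ) : avg (fun i => f i - g i) = avg f - avg g := by
  simp [avg, Finset.sum_sub_distrib, mul_sub]

lemma avg_const_mul (c : ℝ) (f : Fin n → ℝ) : avg (fun i => c * f i) = c * avg f := by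
  simp only [avg, ← Finset.mul_sum]; ring

lemma avg_const (hn : n ≠ 0) (c : ℝ) : avg (fun _ : Fin n => c) = c := by
  have : (n : ℝ) ≠ 0 := by exact_mod_cast hn
  simp [avg, this]

lemma avg_mono {f g : Fin n → ℝ} (h : ∀ i, f i ≤ g i) : avg f ≤ avg g :=
  mul_le_mul_of_nonneg_left (Finset.sum_le_sum fun i _ => h i) (by positivity)

lemma abs_avg_le (f : Fin n → ℝ) : |avg f| ≤ avg fun i => |f i| := by
  rw [avg, avg, abs_mul, abs_of_nonneg (by positivity : (0 : ℝ) ≤ (n : ℝ)⁻¹)]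
  exact mul_le_mul_of_nonneg_left (Finset.abs_sum_le_sum_abs _ _) (by positivity)

lemma avg_sum {ι : Type*} (s : Finset ι) (f : ι → Fin n → ℝ) :
    avg (fun i => ∑ j ∈ s, f j i) = ∑ j ∈ s, avg (f j) := by
  simp only [avg, ← Finset.mul_sum]
  rw [Finset.sum_comm]

end Avg

variable {m d l n : ℕ} {φ : ℝ → ℝ≥0∞} {g : (Fin m → ℝ) → (Fin d → ℝ) → Fin l → ℝ}

/-- The sample mean of the moment function `g` at `θ`. -/
noncomputable def sampleMoment (g : (Fin m → ℝ) → (Fin d → ℝ) → Fin l → ℝ) (x : Fin n → Fin m → ℝ)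
    (θ : Fin d → ℝ) : Fin l → ℝ := fun j => avg fun i => g (x i) θ j

/-- The sample second moment of `g` at `θ` in the direction `τ`. -/
noncomputable def sampleSq (g : (Fin m → ℝ) → (Fin d → ℝ) → Fin l → ℝ) (x : Fin n → Fin m → ℝ)
    (θ : Fin d → ℝ) (τ : Fin l → ℝ) : ℝ := avg fun i => (τ ⬝ᵥ g (x i) θ) ^ 2

lemma lin_eq (x : Fin m → ℝ) (θ : Fin d → ℝ) (t : Fin (l + 1) → ℝ) :
    lin g x θ t = t 0 + Fin.tail t ⬝ᵥ g x θ := rfl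

lemma lin_smul (x : Fin m → ℝ) (θ : Fin d → ℝ) (r : ℝ) (t : Fin (l + 1) → ℝ) :
    lin g x θ (r • t) = r * lin g x θ t := by
  simp only [lin, Pi.smul_apply, smul_eq_mul, mul_add, Finset.mul_sum, mul_assoc]

lemma abs_dotProduct_le (u v : Fin l → ℝ) : |u ⬝ᵥ v| ≤ l * ‖u‖ * ‖v‖ := by
  calc |u ⬝ᵥ v| ≤ ∑ i, |u i * v i| := Finset.abs_sum_le_sum_abs _ _
    _ ≤ ∑ _i : Fin l, ‖u‖ * ‖v‖ := Finset.sum_le_sum fun i _ => by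
        rw [abs_mul]
        exact mul_le_mul (norm_le_pi_norm u i) (norm_le_pi_norm v i) (abs_nonneg _) (norm_nonneg _)
    _ = l * ‖u‖ * ‖v‖ := by simp [mul_assoc]

lemma avg_dotProduct (x : Fin n → Fin m → ℝ) (θ : Fin d → ℝ) (τ : Fin l → ℝ) :
    avg (fun i => τ ⬝ᵥ g (x i) θ) = τ ⬝ᵥ sampleMoment g x θ := by
  simp only [dotProduct, avg_sum, avg_const_mul, sampleMoment]

lemma sampleSq_smul (x : Fin n → Fin m → ℝ) (θ : Fin d → ℝ) (r : ℝ) (τ : Fin l → ℝ) :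
    sampleSq g x θ (r • τ) = r ^ 2 * sampleSq g x θ τ := by
  simp only [sampleSq, smul_dotProduct, smul_eq_mul, mul_pow, avg_const_mul]

lemma avg_lin_sq (hn : n ≠ 0) (x : Fin n → Fin m → ℝ) (θ : Fin d → ℝ) (t : Fin (l + 1) → ℝ) :
    avg (fun i => lin g (x i) θ t ^ 2) =
      t 0 ^ 2 + 2 * t 0 * (Fin.tail t ⬝ᵥ sampleMoment g x θ) + sampleSq g x θ (Fin.tail t) := by
  simp only [lin_eq, add_sq, avg_add, avg_const hn, avg_const_mul, avg_dotProduct, sampleSq]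

/-- The second order expansion of the dual criterion at the origin; the linear term in `t 0`
cancels. -/
lemma abs_avg_crit_sub_le (hn : n ≠ 0) {ε δ : ℝ}
    (hψ : ∀ s : ℝ, |s| ≤ δ → |(conjugate φ s).toReal - s - s ^ 2 / 2| ≤ ε * s ^ 2)
    (x : Fin n → Fin m → ℝ) (θ : Fin d → ℝ) (t : Fin (l + 1) → ℝ)
    (ht : ∀ i, |lin g (x i) θ t| ≤ δ) :
    |avg (fun i => crit φ g (x i) θ t) - (-(Fin.tail t ⬝ᵥ sampleMoment g x θ) -
      avg (fun i => lin g (x i) θ t ^ 2) / 2)| ≤ ε * avg fun i => lin g (x i) θ t ^ 2 := by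
  have h1 : avg (fun i => lin g (x i) θ t) = t 0 + Fin.tail t ⬝ᵥ sampleMoment g x θ := by
    simp only [lin_eq, avg_add, avg_const hn, avg_dotProduct]
  have h2 : avg (fun i => lin g (x i) θ t ^ 2) / 2 = avg fun i => 2⁻¹ * lin g (x i) θ t ^ 2 := by
    rw [avg_const_mul]; ring
  have h3 : -(Fin.tail t ⬝ᵥ sampleMoment g x θ) = avg fun i => t 0 - lin g (x i) θ t := by
    rw [avg_sub, avg_const hn, h1]; ring
  rw [h2, h3, ← avg_sub, ← avg_sub, ← avg_const_mul]
  refine (abs_avg_le _).trans (avg_mono fun i => ?_)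
  have h4 := hψ _ (ht i)
  rw [abs_sub_comm] at h4
  refine le_trans (le_of_eq ?_) ((abs_sub_comm _ _).trans_le h4)
  rw [abs_sub_comm, crit]
  congr 1
  ring

lemma avg_crit_le_divAt {x : Fin n → Fin m → ℝ} {θ : Fin d → ℝ} {t : Fin (l + 1) → ℝ}
    (ht : t ∈ dualSet φ g x θ) : ((avg fun i => crit φ g (x i) θ t : ℝ) : EReal) ≤ divAt φ g x θ :=
  le_iSup₂ (f := fun t (_ : t ∈ dualSet φ g x θ) =>
    (((n : ℝ)⁻¹ * ∑ i, crit φ g (x i) θ t : ℝ) : EReal)) t ht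

/-- Testing the dual criterion at a small vector `(0, τ)`. -/
lemma le_divAt (hn : n ≠ 0) {ε δ : ℝ}
    (hψ : ∀ s : ℝ, |s| ≤ δ → conjLeft φ < s ∧ s < conjRight φ ∧
      |(conjugate φ s).toReal - s - s ^ 2 / 2| ≤ ε * s ^ 2)
    (x : Fin n → Fin m → ℝ) (θ : Fin d → ℝ) (τ : Fin l → ℝ) (hτ : ∀ i, |τ ⬝ᵥ g (x i) θ| ≤ δ) :
    ((-(τ ⬝ᵥ sampleMoment g x θ) - (1 / 2 + ε) * sampleSq g x θ τ : ℝ) : EReal) ≤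
      divAt φ g x θ := by
  have hlin : ∀ i, lin g (x i) θ (Fin.cons 0 τ : Fin (l + 1) → ℝ) = τ ⬝ᵥ g (x i) θ := fun i => by
    simp [lin_eq]
  have hsmall : ∀ i, |lin g (x i) θ (Fin.cons 0 τ : Fin (l + 1) → ℝ)| ≤ δ := fun i => by
    rw [hlin]; exact hτ i
  refine le_trans ?_ (avg_crit_le_divAt (t := Fin.cons 0 τ)
    fun i => ⟨(hψ _ (hsmall i)).1, (hψ _ (hsmall i)).2.1⟩)
  have h := (abs_le.1 (abs_avg_crit_sub_le hn (fun s hs => (hψ s hs).2.2) x θ _ hsmall)).1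
  simp only [hlin, Fin.tail_cons] at h
  refine EReal.coe_le_coe_iff.2 ?_
  simp only [sampleSq]
  linarith

/-- Since the criterion is concave along rays and vanishes at the origin, its behaviour on a small
ball controls its supremum over the whole dual set. -/
lemma divAt_le (hφ : IsDivergenceFunction φ) (hn : n ≠ 0) {ε δ r C : ℝ}
    (hψ : ∀ s : ℝ, |s| ≤ δ → |(conjugate φ s).toReal - s - s ^ 2 / 2| ≤ ε * s ^ 2)
    (x : Fin n → Fin m → ℝ) (θ : Fin d → ℝ) (hr : 0 < r)
    (hsmall : ∀ t : Fin (l + 1) → ℝ, ‖t‖ ≤ r → ∀ i, |lin g (x i) θ t| ≤ δ)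
    (hsphere : ∀ t : Fin (l + 1) → ℝ, ‖t‖ = r → -(Fin.tail t ⬝ᵥ sampleMoment g x θ) -
      (1 / 2 - ε) * avg (fun i => lin g (x i) θ t ^ 2) ≤ 0)
    (hball : ∀ t : Fin (l + 1) → ℝ, ‖t‖ ≤ r → -(Fin.tail t ⬝ᵥ sampleMoment g x θ) -
      (1 / 2 - ε) * avg (fun i => lin g (x i) θ t ^ 2) ≤ C) (hC : 0 ≤ C) :
    divAt φ g x θ ≤ C := by
  have hup : ∀ t : Fin (l + 1) → ℝ, ‖t‖ ≤ r → avg (fun i => crit φ g (x i) θ t) ≤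
      -(Fin.tail t ⬝ᵥ sampleMoment g x θ) -
        (1 / 2 - ε) * avg (fun i => lin g (x i) θ t ^ 2) := fun t ht => by
    have h := (abs_le.1 (abs_avg_crit_sub_le hn hψ x θ t (hsmall t ht))).2
    linarith
  refine iSup₂_le fun t ht => EReal.coe_le_coe_iff.2 ?_
  change avg (fun i => crit φ g (x i) θ t) ≤ C
  rcases le_or_gt ‖t‖ r with h | h
  · exact (hup t h).trans (hball t h)
  · have ht0 : 0 < ‖t‖ := hr.trans h
    set c := r / ‖t‖ with hc
    have hc0 : 0 < c := by positivity
    have hc1 : c ≤ 1 := by rw [hc, div_le_one ht0]; exact h.le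
    have hnorm : ‖c • t‖ = r := by
      rw [norm_smul, Real.norm_of_nonneg hc0.le, hc, div_mul_cancel₀ _ ht0.ne']
    have h1 : c * avg (fun i => crit φ g (x i) θ t) ≤ avg fun i => crit φ g (x i) θ (c • t) := by
      rw [← avg_const_mul]
      refine avg_mono fun i => ?_
      have h2 := (hφ.conjugate_mul_le hc0.le hc1 (hφ.conjugate_lt_top (ht i).1 (ht i).2)).2
      simp only [crit, lin_smul, Pi.smul_apply, smul_eq_mul]
      linarith
    have h3 := h1.trans ((hup _ hnorm.le).trans (hsphere _ hnorm))
    have h4 : avg (fun i => crit φ g (x i) θ t) ≤ 0 := by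
      by_contra hcon
      push Not at hcon
      exact absurd h3 (not_le.2 (mul_pos hc0 hcon))
    exact h4.trans hC

end Dual

/-! ### Quadratic forms -/

section Quadratic

variable {l : ℕ} {Ω : Matrix (Fin l) (Fin l) ℝ}

lemma exists_dotProduct_mulVec_le (A : Matrix (Fin l) (Fin l) ℝ) :
    ∃ C : ℝ, 0 ≤ C ∧ ∀ v, v ⬝ᵥ A *ᵥ v ≤ C * ‖v‖ ^ 2 := by
  let f := A.mulVecLin.toContinuousLinearMap
  refine ⟨l * ‖f‖, by positivity, fun v => ?_⟩
  have h1 : ‖A *ᵥ v‖ ≤ ‖f‖ * ‖v‖ := f.le_opNorm v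
  calc v ⬝ᵥ A *ᵥ v ≤ |v ⬝ᵥ A *ᵥ v| := le_abs_self _
    _ ≤ l * ‖v‖ * ‖A *ᵥ v‖ := abs_dotProduct_le _ _
    _ ≤ l * ‖v‖ * (‖f‖ * ‖v‖) := by gcongr
    _ = _ := by ring

lemma exists_norm_mulVec_le {k : ℕ} (A : Matrix (Fin k) (Fin l) ℝ) :
    ∃ C : ℝ, 0 ≤ C ∧ ∀ v, ‖A *ᵥ v‖ ≤ C * ‖v‖ :=
  ⟨‖A.mulVecLin.toContinuousLinearMap‖, norm_nonneg _,
    fun v => A.mulVecLin.toContinuousLinearMap.le_opNorm v⟩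

/-- A positive definite quadratic form is bounded below by a multiple of the squared norm. -/
lemma exists_le_dotProduct_mulVec (hΩ : Ω.PosDef) :
    ∃ c : ℝ, 0 < c ∧ ∀ v, c * ‖v‖ ^ 2 ≤ v ⬝ᵥ Ω *ᵥ v := by
  have hcont : Continuous fun v : Fin l → ℝ => v ⬝ᵥ Ω *ᵥ v := by
    simp only [dotProduct, Matrix.mulVec]; fun_prop
  rcases (Metric.sphere (0 : Fin l → ℝ) 1).eq_empty_or_nonempty with h | h
  · refine ⟨1, one_pos, fun v => ?_⟩
    by_cases hv : v = 0
    · simp [hv]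
    · exfalso
      have : (‖v‖⁻¹ • v) ∈ Metric.sphere (0 : Fin l → ℝ) 1 := by
        simp [norm_smul, norm_ne_zero_iff.2 hv]
      simp [h] at this
  · obtain ⟨v₀, hv₀, hmin⟩ := (isCompact_sphere (0 : Fin l → ℝ) 1).exists_isMinOn h
      hcont.continuousOn
    have hv₀' : v₀ ≠ 0 := by
      rintro rfl; simp at hv₀
    refine ⟨v₀ ⬝ᵥ Ω *ᵥ v₀, by simpa using hΩ.dotProduct_mulVec_pos hv₀', fun v => ?_⟩
    by_cases hv : v = 0
    · simp [hv]
    · have hn := norm_ne_zero_iff.2 hv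
      have h1 := hmin (show (‖v‖⁻¹ • v) ∈ Metric.sphere (0 : Fin l → ℝ) 1 by simp [norm_smul, hn])
      simp only [mem_ofPred_eq, Matrix.mulVec_smul, smul_dotProduct, dotProduct_smul,
        smul_eq_mul] at h1
      calc _ ≤ (‖v‖⁻¹ * (‖v‖⁻¹ * (v ⬝ᵥ Ω *ᵥ v))) * ‖v‖ ^ 2 := by gcongr
        _ = _ := by field_simp

/-- Completing the square. -/
lemma neg_dotProduct_sub_le (hΩ : Ω.PosDef) (b w : Fin l → ℝ) :
    -(b ⬝ᵥ w) - (b ⬝ᵥ Ω *ᵥ b) / 2 ≤ (w ⬝ᵥ Ω⁻¹ *ᵥ w) / 2 := by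
  have hu : IsUnit Ω.det := (Matrix.isUnit_iff_isUnit_det _).1 hΩ.isUnit
  have h := hΩ.posSemidef.dotProduct_mulVec_nonneg (b + Ω⁻¹ *ᵥ w)
  have h1 : Ω *ᵥ (Ω⁻¹ *ᵥ w) = w := by
    rw [Matrix.mulVec_mulVec, Matrix.mul_nonsing_inv _ hu, Matrix.one_mulVec]
  have h2 : Ωᵀ = Ω := by simpa using hΩ.isHermitian.eq
  have h3 : (Ω⁻¹ *ᵥ w) ⬝ᵥ Ω *ᵥ b = b ⬝ᵥ w := by
    rw [Matrix.dotProduct_mulVec, ← Matrix.mulVec_transpose, h2, h1, dotProduct_comm]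
  simp only [star_trivial, Matrix.mulVec_add, dotProduct_add, add_dotProduct, h1, h3] at h
  rw [dotProduct_comm (Ω⁻¹ *ᵥ w) w] at h
  linarith

end Quadratic

/-! ### The estimated divergence in terms of the sample moments -/

section Sandwich

variable {m d l : ℕ} {φ : ℝ → ℝ≥0∞}

lemma natCast_mul_le_mul {n : ℕ} {a : ℝ} {D : EReal} (h : (a : EReal) ≤ D) :
    ((2 * n * a : ℝ) : EReal) ≤ ((2 * n : ℝ) : EReal) * D := by
  rw [EReal.coe_mul]
  exact mul_le_mul_of_nonneg_left h (EReal.coe_nonneg.2 (by positivity))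

lemma natCast_mul_mul_le {n : ℕ} {a : ℝ} {D : EReal} (h : D ≤ (a : EReal)) :
    ((2 * n : ℝ) : EReal) * D ≤ ((2 * n * a : ℝ) : EReal) := by
  rw [EReal.coe_mul]
  exact mul_le_mul_of_nonneg_left h (EReal.coe_nonneg.2 (by positivity))

lemma norm_tail_le (t : Fin (l + 1) → ℝ) : ‖Fin.tail t‖ ≤ ‖t‖ :=
  (pi_norm_le_iff_of_nonneg (norm_nonneg _)).2 fun i => norm_le_pi_norm t i.succ

lemma tail_smul (r : ℝ) (t : Fin (l + 1) → ℝ) : Fin.tail (r • t) = r • Fin.tail t := rfl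

/-- Every sample moment is small where the estimated divergence is small: this is what the dual
criterion gives at the vectors `± eⱼ / √n`. -/
theorem sqrt_mul_abs_sampleMoment_sub_le (hφ : IsDivergenceFunction φ) :
    ∃ ε > 0, ∀ (g : (Fin m → ℝ) → (Fin d → ℝ) → Fin l → ℝ) (n : ℕ) (x : Fin n → Fin m → ℝ)
      (θ : Fin d → ℝ) (B : ℝ), n ≠ 0 → (∀ i, ‖g (x i) θ‖ ≤ ε * √n) →
      ∀ j, (avg fun i => g (x i) θ j ^ 2) ≤ B →
        ((2 * (√n * |sampleMoment g x θ j| - B) : ℝ) : EReal) ≤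
          ((2 * n : ℝ) : EReal) * divAt φ g x θ := by
  obtain ⟨δ, hδ, hψ⟩ := hφ.conjugate_expansion (ε := 1 / 2) (by norm_num)
  refine ⟨δ, hδ, fun g n x θ B hn hg j hB => ?_⟩
  have hnpos : (0 : ℝ) < n := by positivity
  set s := √(n : ℝ) with hs
  have hs0 : 0 < s := Real.sqrt_pos.2 hnpos
  have hsq : s ^ 2 = n := Real.sq_sqrt hnpos.le
  clear_value s
  have key : ∀ σ : ℝ, |σ| = 1 → ((2 * (s * (-σ * sampleMoment g x θ j) - B) : ℝ) : EReal) ≤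
      ((2 * n : ℝ) : EReal) * divAt φ g x θ := by
    intro σ hσ
    have hdot : ∀ v : Fin l → ℝ, (Pi.single j (σ / s) : Fin l → ℝ) ⬝ᵥ v = σ / s * v j := fun v => by
      simp
    have hσ2 : σ ^ 2 = 1 := by rw [← sq_abs, hσ, one_pow]
    have h := le_divAt (g := g) hn hψ x θ (Pi.single j (σ / s)) fun i => by
      rw [hdot, abs_mul, abs_div, hσ, abs_of_pos hs0, one_div, inv_mul_le_iff₀ hs0]
      exact (norm_le_pi_norm (g (x i) θ) j).trans ((hg i).trans_eq (mul_comm _ _))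
    refine le_trans (EReal.coe_le_coe_iff.2 ?_) (natCast_mul_le_mul (n := n) h)
    have h1 : sampleSq g x θ (Pi.single j (σ / s)) = (s ^ 2)⁻¹ * avg fun i => g (x i) θ j ^ 2 := by
      simp only [sampleSq, hdot, mul_pow, avg_const_mul, div_pow, hσ2, one_div]
    rw [hdot, h1, ← hsq]
    have h2 : 2 * s ^ 2 * (-(σ / s * sampleMoment g x θ j) -
        (1 / 2 + 1 / 2) * ((s ^ 2)⁻¹ * avg fun i => g (x i) θ j ^ 2)) =
        2 * (s * (-σ * sampleMoment g x θ j) - avg fun i => g (x i) θ j ^ 2) := by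
      field_simp; ring
    rw [h2]
    linarith
  rcases le_total 0 (sampleMoment g x θ j) with h0 | h0
  · have := key (-1) (by simp)
    rwa [neg_neg, one_mul, ← abs_of_nonneg h0] at this
  · have := key 1 (by simp)
    rwa [neg_one_mul, ← abs_of_nonpos h0] at this

variable {Ω : Matrix (Fin l) (Fin l) ℝ}

set_option maxHeartbeats 1000000 in
/-- Where the sample moment is of order `1 / √n` and the sample second moments are close to `Ω`,
the estimated divergence is close to the quadratic form `Ω⁻¹` of the sample moment. -/
theorem divAt_sandwich (hφ : IsDivergenceFunction φ) (hΩ : Ω.PosDef) {K η : ℝ} (hK : 0 ≤ K)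
    (hη : 0 < η) :
    ∃ ε > 0, ∀ (g : (Fin m → ℝ) → (Fin d → ℝ) → Fin l → ℝ) (n : ℕ) (x : Fin n → Fin m → ℝ)
      (θ : Fin d → ℝ) (w : Fin l → ℝ), n ≠ 0 → (√n)⁻¹ ≤ ε → (∀ i, ‖g (x i) θ‖ ≤ ε * √n) →
      √n • sampleMoment g x θ = w → ‖w‖ ≤ K →
      (∀ τ, |sampleSq g x θ τ - τ ⬝ᵥ Ω *ᵥ τ| ≤ ε * ‖τ‖ ^ 2) →
      ((w ⬝ᵥ Ω⁻¹ *ᵥ w - η : ℝ) : EReal) ≤ ((2 * n : ℝ) : EReal) * divAt φ g x θ ∧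
      ((2 * n : ℝ) : EReal) * divAt φ g x θ ≤ ((w ⬝ᵥ Ω⁻¹ *ᵥ w + η : ℝ) : EReal) := by
  have hu : IsUnit Ω.det := (Matrix.isUnit_iff_isUnit_det _).1 hΩ.isUnit
  obtain ⟨c', hc', hclow'⟩ := exists_le_dotProduct_mulVec hΩ
  obtain ⟨C₁, hC₁, hCup⟩ := exists_dotProduct_mulVec_le Ω
  obtain ⟨C₂, hC₂, hinv⟩ := exists_norm_mulVec_le Ω⁻¹
  set c := min 1 c' with hcdef
  have hc : 0 < c := lt_min one_pos hc'
  have hclow : ∀ v, c * ‖v‖ ^ 2 ≤ v ⬝ᵥ Ω *ᵥ v := fun v =>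
    (mul_le_mul_of_nonneg_right (min_le_right _ _) (by positivity)).trans (hclow' v)
  have hc1 : c ≤ 1 := min_le_left _ _
  -- the radius, in units of `1 / √n`, of a ball which contains the relevant dual vectors
  set r := 8 * l * K / c + C₂ * K + 1 with hr
  have hr0 : 0 < r := by positivity
  have hrK : l * r * K ≤ c * r ^ 2 / 8 := by
    have h1 : 8 * l * K / c ≤ r := by
      rw [hr]; nlinarith [mul_nonneg hC₂ hK]
    have h2 : 8 * l * K ≤ r * c := (div_le_iff₀ hc).1 h1
    nlinarith
  have hrC : C₂ * K ≤ r := by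
    have h1 : 0 ≤ 8 * l * K / c := by positivity
    linarith
  clear_value r c
  set e := min (1 / 4) (η / (8 * (C₁ * r ^ 2 + r ^ 2 + 1))) with he
  have he0 : 0 < e := by positivity
  have he4 : e ≤ 1 / 4 := min_le_left _ _
  have heη : e * (C₁ * r ^ 2 + r ^ 2) ≤ η / 8 := by
    have h1 : e ≤ η / (8 * (C₁ * r ^ 2 + r ^ 2 + 1)) := min_le_right _ _
    rw [le_div_iff₀ (by positivity)] at h1
    nlinarith
  clear_value e
  obtain ⟨δ, hδ, hψ⟩ := hφ.conjugate_expansion he0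
  set ε := min (c / (4 * (1 + 2 * l * K))) (min (η / (4 * (r ^ 2 * (1 + 2 * l * K))))
    (δ / (r * (1 + l)))) with hε
  have hε0 : 0 < ε := by positivity
  have hε1 : ε * (1 + 2 * l * K) ≤ c / 4 := by
    have h1 : ε ≤ c / (4 * (1 + 2 * l * K)) := min_le_left _ _
    rw [le_div_iff₀ (by positivity)] at h1
    linarith
  have hε2 : ε * (r ^ 2 * (1 + 2 * l * K)) ≤ η / 4 := by
    have h1 : ε ≤ η / (4 * (r ^ 2 * (1 + 2 * l * K))) := (min_le_right _ _).trans (min_le_left _ _)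
    rw [le_div_iff₀ (by positivity)] at h1
    linarith
  have hε3 : ε * (r * (1 + l)) ≤ δ := by
    have h1 : ε ≤ δ / (r * (1 + l)) := (min_le_right _ _).trans (min_le_right _ _)
    rwa [le_div_iff₀ (by positivity)] at h1
  clear_value ε
  refine ⟨ε, hε0, fun g n x θ w hn hsε hg hw hwK hM => ?_⟩
  have hnpos : (0 : ℝ) < n := by positivity
  set s := √(n : ℝ) with hs
  have hs0 : 0 < s := Real.sqrt_pos.2 hnpos
  have hsq : s ^ 2 = n := Real.sq_sqrt hnpos.le
  clear_value s
  have hmom : sampleMoment g x θ = s⁻¹ • w := by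
    rw [← hw, smul_smul, inv_mul_cancel₀ hs0.ne', one_smul]
  set q := w ⬝ᵥ Ω⁻¹ *ᵥ w with hq
  have hdot : ∀ b : Fin l → ℝ, ‖b‖ ≤ r → ∀ i, |(s⁻¹ • b) ⬝ᵥ g (x i) θ| ≤ l * r * ε := by
    intro b hb i
    rw [smul_dotProduct, smul_eq_mul, abs_mul, abs_of_pos (inv_pos.2 hs0), inv_mul_le_iff₀ hs0]
    calc |b ⬝ᵥ g (x i) θ| ≤ l * ‖b‖ * ‖g (x i) θ‖ := abs_dotProduct_le _ _
      _ ≤ l * r * (ε * s) := by gcongr; exact hg i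
      _ = _ := by ring
  constructor
  -- the maximizer `-Ω⁻¹ w` of the limiting criterion is a test vector for the lower bound
  · set b := -(Ω⁻¹ *ᵥ w) with hb
    have hbr : ‖b‖ ≤ r := by
      rw [hb, norm_neg]
      exact ((hinv w).trans (by gcongr)).trans hrC
    have hΩb : b ⬝ᵥ Ω *ᵥ b = q := by
      rw [hb, Matrix.mulVec_neg, Matrix.mulVec_mulVec, Matrix.mul_nonsing_inv _ hu,
        Matrix.one_mulVec, neg_dotProduct_neg, dotProduct_comm]
    have hbw : b ⬝ᵥ w = -q := by rw [hb, neg_dotProduct, dotProduct_comm]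
    have hrε := mul_pos hr0 hε0
    have h := le_divAt (g := g) hn hψ x θ (s⁻¹ • b) fun i => (hdot b hbr i).trans (by linarith)
    refine le_trans (EReal.coe_le_coe_iff.2 ?_) (natCast_mul_le_mul (n := n) h)
    rw [hmom, sampleSq_smul, smul_dotProduct, dotProduct_smul, hbw, ← hsq]
    have h2 : 2 * s ^ 2 * (-(s⁻¹ • s⁻¹ • -q) - (1 / 2 + e) * (s⁻¹ ^ 2 * sampleSq g x θ b)) =
        2 * q - (1 + 2 * e) * sampleSq g x θ b := by
      simp only [smul_eq_mul]; field_simp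
    rw [h2]
    have h3 : sampleSq g x θ b ≤ q + ε * r ^ 2 := by
      have h4 := (abs_le.1 (hM b)).2
      rw [hΩb] at h4
      have : ε * ‖b‖ ^ 2 ≤ ε * r ^ 2 := by gcongr
      linarith
    have h5 : q ≤ C₁ * r ^ 2 := by
      rw [← hΩb]; exact (hCup b).trans (by gcongr)
    have h6 : ε * r ^ 2 ≤ η / 4 := by
      refine le_trans ?_ hε2
      have : 0 ≤ ε * (r ^ 2 * (2 * l * K)) := by positivity
      linarith
    have h7 : e * q ≤ e * (C₁ * r ^ 2) := by gcongr
    have h8 : (1 + 2 * e) * sampleSq g x θ b ≤ (1 + 2 * e) * (q + ε * r ^ 2) := by gcongr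
    have h9 : e * (ε * r ^ 2) ≤ 1 / 4 * (η / 4) := by gcongr
    have h10 : 0 ≤ e * r ^ 2 := by positivity
    linarith
  · -- the rescaled criterion, to be evaluated at the rescaled vector `T = √n t`
    have hU : ∀ t : Fin (l + 1) → ℝ, ‖t‖ ≤ r / s → ∃ (a : ℝ) (b : Fin l → ℝ),
        a ^ 2 ≤ r ^ 2 ∧ ‖b‖ ≤ r ∧ max |a| ‖b‖ = s * ‖t‖ ∧
        n * (-(Fin.tail t ⬝ᵥ sampleMoment g x θ) -
          (1 / 2 - e) * avg (fun i => lin g (x i) θ t ^ 2)) ≤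
        -(b ⬝ᵥ w) - (1 / 2 - e) * (a ^ 2 + b ⬝ᵥ Ω *ᵥ b) + ε * (r ^ 2 * (1 + 2 * l * K)) / 2 := by
      intro t ht
      set T := s • t with hT
      have htT : t = s⁻¹ • T := by rw [hT, smul_smul, inv_mul_cancel₀ hs0.ne', one_smul]
      have hTn : ‖T‖ = s * ‖t‖ := by rw [hT, norm_smul, Real.norm_of_nonneg hs0.le]
      have hTr : ‖T‖ ≤ r := by
        rw [hTn]; rwa [le_div_iff₀ hs0, mul_comm] at ht
      have ha : |T 0| ≤ r := (norm_le_pi_norm T 0).trans hTr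
      have hb : ‖Fin.tail T‖ ≤ r := (norm_tail_le T).trans hTr
      refine ⟨T 0, Fin.tail T, sq_le_sq.2 (by rwa [abs_of_pos hr0]), hb, ?_, ?_⟩
      · rw [← hTn]
        refine le_antisymm (max_le (norm_le_pi_norm T 0) (norm_tail_le T)) ?_
        refine (pi_norm_le_iff_of_nonneg (le_max_of_le_left (abs_nonneg _))).2 fun i => ?_
        refine Fin.cases (le_max_left _ _) (fun j => ?_) i
        exact (norm_le_pi_norm (Fin.tail T) j).trans (le_max_right _ _)
      · rw [avg_lin_sq hn, hmom, htT, tail_smul, sampleSq_smul, ← hsq]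
        simp only [Pi.smul_apply, smul_eq_mul, smul_dotProduct, dotProduct_smul]
        set a := T 0
        set b := Fin.tail T
        clear_value a b
        have h2 : s ^ 2 * (-(s⁻¹ * (s⁻¹ * (b ⬝ᵥ w))) - (1 / 2 - e) * ((s⁻¹ * a) ^ 2 +
            2 * (s⁻¹ * a) * (s⁻¹ * (s⁻¹ * (b ⬝ᵥ w))) + s⁻¹ ^ 2 * sampleSq g x θ b)) =
            -(b ⬝ᵥ w) - (1 / 2 - e) * (a ^ 2 + 2 * (a * (b ⬝ᵥ w)) * s⁻¹ + sampleSq g x θ b) := by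
          field_simp
        have h3 : b ⬝ᵥ Ω *ᵥ b - ε * r ^ 2 ≤ sampleSq g x θ b := by
          have h4 := (abs_le.1 (hM b)).1
          have : ε * ‖b‖ ^ 2 ≤ ε * r ^ 2 := by gcongr
          linarith
        have h4 : |a * (b ⬝ᵥ w) * s⁻¹| ≤ r * (l * r * K) * ε := by
          rw [abs_mul, abs_mul, abs_of_pos (inv_pos.2 hs0)]
          gcongr
          exact (abs_dotProduct_le _ _).trans (by gcongr)
        have h5 := (abs_le.1 h4).1
        have h7 : (1 / 2 - e) * (a ^ 2 + b ⬝ᵥ Ω *ᵥ b - ε * (r ^ 2 * (1 + 2 * l * K))) ≤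
            (1 / 2 - e) * (a ^ 2 + 2 * (a * (b ⬝ᵥ w)) * s⁻¹ + sampleSq g x θ b) := by
          refine mul_le_mul_of_nonneg_left ?_ (by linarith)
          linarith
        have h8 : 0 ≤ e * (ε * (r ^ 2 * (1 + 2 * l * K))) := by positivity
        rw [h2]
        linarith
    have hq0 : 0 ≤ q := by
      have := hΩ.inv.posSemidef.dotProduct_mulVec_nonneg w
      simpa [hq] using this
    have hmain : divAt φ g x θ ≤ (((q + η) / (2 * n) : ℝ) : EReal) := by
      refine divAt_le hφ hn (ε := e) (δ := δ) (r := r / s) (fun v hv => (hψ v hv).2.2) x θ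
        (by positivity) (fun t ht i => ?_) (fun t ht => ?_) (fun t ht => ?_) (by positivity)
      · have h1 : |t 0| ≤ r / s := (norm_le_pi_norm t 0).trans ht
        have h2 := hdot (s • Fin.tail t) (by
          rw [norm_smul, Real.norm_of_nonneg hs0.le]
          have := (norm_tail_le t).trans ht
          rwa [le_div_iff₀ hs0, mul_comm] at this) i
        rw [smul_smul, inv_mul_cancel₀ hs0.ne', one_smul] at h2
        have h3 : r / s ≤ r * ε := by rw [div_eq_mul_inv]; gcongr
        rw [lin_eq]
        calc |t 0 + Fin.tail t ⬝ᵥ g (x i) θ| ≤ |t 0| + |Fin.tail t ⬝ᵥ g (x i) θ| := abs_add_le _ _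
          _ ≤ r * ε + l * r * ε := add_le_add (h1.trans h3) h2
          _ ≤ δ := by linarith
      · obtain ⟨a, b, ha, hb, hmax, h⟩ := hU t ht.le
        rw [ht, mul_div_cancel₀ _ hs0.ne'] at hmax
        refine nonpos_of_mul_nonpos_right (h.trans ?_) hnpos
        have h1 : -(b ⬝ᵥ w) ≤ l * r * K := by
          refine (neg_le_abs _).trans ((abs_dotProduct_le _ _).trans ?_)
          gcongr
        have h2 : c * r ^ 2 ≤ a ^ 2 + b ⬝ᵥ Ω *ᵥ b := by
          have h3 := hclow b
          rcases max_choice |a| ‖b‖ with h4 | h4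
          · have : a ^ 2 = r ^ 2 := by rw [← hmax, h4, sq_abs]
            have h5 : 0 ≤ c * ‖b‖ ^ 2 := by positivity
            have h6 : c * r ^ 2 ≤ 1 * r ^ 2 := by gcongr
            linarith
          · have : ‖b‖ = r := by rw [← h4, hmax]
            rw [this] at h3
            linarith [sq_nonneg a]
        have h5 : (1 / 4) * (c * r ^ 2) ≤ (1 / 2 - e) * (a ^ 2 + b ⬝ᵥ Ω *ᵥ b) :=
          mul_le_mul (by linarith) h2 (by positivity) (by linarith)
        have h6 : ε * (1 + 2 * l * K) * r ^ 2 ≤ c / 4 * r ^ 2 := by gcongr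
        linarith
      · obtain ⟨a, b, ha, hb, -, h⟩ := hU t ht
        rw [le_div_iff₀ (by positivity)]
        have h1 := neg_dotProduct_sub_le hΩ b w
        have h2 : e * (b ⬝ᵥ Ω *ᵥ b) ≤ e * (C₁ * r ^ 2) := by
          gcongr; exact (hCup b).trans (by gcongr)
        have h3 : e * a ^ 2 ≤ e * r ^ 2 := by gcongr
        have h4 := sq_nonneg a
        linarith
    refine (natCast_mul_mul_le (n := n) hmain).trans_eq ?_
    rw [mul_div_cancel₀ _ (by positivity)]

end Sandwich

/-! ### Analytic sets and measurability of suprema -/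

section Analytic

lemma isCompact_setOf_le (N : ℕ → ℕ) : IsCompact {x : ℕ → ℕ | ∀ i, x i ≤ N i} := by
  have : {x : ℕ → ℕ | ∀ i, x i ≤ N i} = Set.pi univ fun i => Iic (N i) := by
    ext x; simp [Pi.le_def]
  rw [this]
  exact isCompact_univ_pi fun i => (finite_Iic (N i)).isCompact

/-- If an open set contains all sequences bounded by `N`, then it contains, for some `k`,
all sequences whose first `k` terms are bounded by `N`. -/
lemma exists_prefix_subset_of_isOpen {V : Set (ℕ → ℕ)} (hV : IsOpen V) (N : ℕ → ℕ)
    (hNV : {x : ℕ → ℕ | ∀ i, x i ≤ N i} ⊆ V) : ∃ k, {x : ℕ → ℕ | ∀ i < k, x i ≤ N i} ⊆ V := by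
  have hK := isCompact_setOf_le N
  have hcyl : ∀ x ∈ {x : ℕ → ℕ | ∀ i, x i ≤ N i}, ∃ k, PiNat.cylinder x k ⊆ V := by
    intro x hx
    obtain ⟨_, ⟨y, k, rfl⟩, hxy, hsub⟩ :=
      (PiNat.isTopologicalBasis_cylinders (fun _ : ℕ => ℕ)).exists_subset_of_mem_open (hNV hx) hV
    exact ⟨k, by rwa [PiNat.mem_cylinder_iff_eq.1 hxy]⟩
  choose! k hk using hcyl
  obtain ⟨s, hs, hcover⟩ := hK.elim_nhds_subcover (fun x => PiNat.cylinder x (k x))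
    fun x _ => (PiNat.isOpen_cylinder _ x _).mem_nhds (PiNat.self_mem_cylinder x _)
  refine ⟨s.sup k, fun y hy => ?_⟩
  have hmin : (fun i => min (y i) (N i)) ∈ {x : ℕ → ℕ | ∀ i, x i ≤ N i} := fun i => min_le_right _ _
  obtain ⟨x, hxs, hx⟩ := mem_iUnion₂.1 (hcover hmin)
  refine hk x (hs x hxs) (PiNat.mem_cylinder_iff.2 fun i hi => ?_)
  rw [← PiNat.mem_cylinder_iff.1 hx i hi]
  exact (min_eq_left (hy i (hi.trans_le (Finset.le_sup hxs)))).symm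

variable {α : Type*} [TopologicalSpace α] [MeasurableSpace α]
  (μ : Measure α) [μ.OuterRegular]

/-- Capacitability: an analytic set is approximated in measure by compact subsets. -/
lemma _root_.MeasureTheory.AnalyticSet.exists_isCompact_le {s : Set α} (hs : AnalyticSet s)
    {c : ℝ≥0∞} (hc : c < μ s) : ∃ K ⊆ s, IsCompact K ∧ c ≤ μ K := by
  rw [AnalyticSet] at hs
  rcases hs with rfl | ⟨f, hf, rfl⟩
  · simp at hc
  -- choose bounds for the terms of the sequences one after the other, keeping the measure above `c`
  have step : ∀ (k : ℕ) (A : Set (ℕ → ℕ)), c < μ (f '' A) →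
      ∃ N : ℕ, c < μ (f '' (A ∩ {x | x k ≤ N})) := by
    intro k A hA
    have hU : f '' A = ⋃ N : ℕ, f '' (A ∩ {x | x k ≤ N}) := by
      rw [← image_iUnion, ← inter_iUnion]
      congr 1
      refine (inter_eq_left.2 fun x _ => ?_).symm
      exact mem_iUnion.2 ⟨x k, le_refl (x k)⟩
    have hmono : Monotone fun N : ℕ => f '' (A ∩ {x | x k ≤ N}) := fun a b hab =>
      image_mono (inter_subset_inter_right _ fun x (hx : x k ≤ a) => hx.trans hab)
    rw [hU, hmono.measure_iUnion] at hA
    exact lt_iSup_iff.1 hA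
  choose! N hN using step
  let A : ℕ → Set (ℕ → ℕ) := fun k => Nat.rec univ (fun k A => A ∩ {x | x k ≤ N k A}) k
  have hA : ∀ k, c < μ (f '' A k) := by
    intro k
    induction k with
    | zero => simpa [A, image_univ] using hc
    | succ k ih => exact hN k _ ih
  have hAeq : ∀ k, A k = {x | ∀ i < k, x i ≤ N i (A i)} := by
    intro k
    induction k with
    | zero => simp [A]
    | succ k ih =>
      have : A (k + 1) = A k ∩ {x | x k ≤ N k (A k)} := rfl
      rw [this]
      nth_rewrite 1 [ih]
      ext x
      simp only [mem_inter_iff, mem_ofPred_eq, Nat.lt_succ_iff_lt_or_eq, or_imp, forall_and,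
        forall_eq]
  have hK := isCompact_setOf_le fun i => N i (A i)
  refine ⟨f '' {x | ∀ i, x i ≤ N i (A i)}, image_subset_range _ _, hK.image hf, ?_⟩
  refine le_of_forall_gt_imp_ge_of_dense fun b hb => ?_
  obtain ⟨U, hsub, hUo, hUb⟩ := Set.exists_isOpen_lt_of_lt _ b hb
  obtain ⟨k, hk⟩ := exists_prefix_subset_of_isOpen (hUo.preimage hf) (fun i => N i (A i))
    (image_subset_iff.1 hsub)
  rw [← hAeq] at hk
  exact (hA k).le.trans ((measure_mono (image_subset_iff.2 hk)).trans hUb.le)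

/-- Analytic sets are universally measurable. -/
lemma _root_.MeasureTheory.AnalyticSet.nullMeasurableSet [T2Space α] [BorelSpace α]
    [IsFiniteMeasure μ] {s : Set α} (hs : AnalyticSet s) : NullMeasurableSet s μ := by
  rcases eq_or_ne (μ s) 0 with h0 | h0
  · exact NullMeasurableSet.of_null h0
  obtain ⟨u, -, hu, hlim⟩ := exists_seq_strictMono_tendsto' (pos_iff_ne_zero.2 h0)
  choose K hKs hKc hK using fun k => hs.exists_isCompact_le μ (hu k).2
  have hmeas : MeasurableSet (⋃ k, K k) := .iUnion fun k => (hKc k).measurableSet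
  have hsub : (⋃ k, K k) ⊆ s := iUnion_subset hKs
  have hle : μ s ≤ μ (⋃ k, K k) := le_of_tendsto' hlim fun k =>
    (hK k).trans (measure_mono (subset_iUnion K k))
  refine NullMeasurableSet.congr hmeas.nullMeasurableSet ?_
  exact ae_eq_of_subset_of_measure_ge hsub hle hmeas.nullMeasurableSet (measure_ne_top _ _)

end Analytic

/-- The supremum of a measurable function over a measurable set of parameters is almost everywhere
measurable, because its superlevel sets are projections of Borel sets. -/
lemma aemeasurable_iSup_mem {α T : Type*} [TopologicalSpace α] [PolishSpace α] [MeasurableSpace α]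
    [BorelSpace α] [MeasurableSpace T] [StandardBorelSpace T] (μ : Measure α) [IsFiniteMeasure μ]
    {f : α → T → ℝ≥0∞} (hf : Measurable (Function.uncurry f)) {U : Set T} (hU : MeasurableSet U) :
    AEMeasurable (fun x => ⨆ t ∈ U, f x t) μ := by
  let := TopologicalSpace.upgradeIsCompletelyMetrizable α
  have key : ∀ c, NullMeasurableSet ((fun x => ⨆ t ∈ U, f x t) ⁻¹' Ioi c) μ := fun c => by
    have : (fun x => ⨆ t ∈ U, f x t) ⁻¹' Ioi c =
        Prod.fst '' ({p : α × T | c < Function.uncurry f p} ∩ Prod.snd ⁻¹' U) := by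
      ext x
      simp [lt_iSup_iff, and_comm]
    rw [this]
    exact AnalyticSet.nullMeasurableSet μ
      (((measurableSet_lt measurable_const hf).inter (measurable_snd hU)).analyticSet_image
        measurable_fst)
  exact NullMeasurable.aemeasurable (measurable_of_Ioi (δ := NullMeasurableSpace α μ) key)

/-! ### Events of probability tending to one -/

section Whp

variable {S : Type*} [MeasurableSpace S]

/-- The filter on `ℕ × S` of the events (families of sets indexed by the sample size) whose
complements have outer measure tending to zero.  Thus `∀ᶠ p in whp μ, A p` says that `A (n, ω)`
holds with probability tending to one, without any measurability requirement on `A`. -/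
def whp (μ : Measure S) : Filter (ℕ × S) where
  sets := {A | Tendsto (fun n => μ {ω | (n, ω) ∉ A}) atTop (𝓝 0)}
  univ_sets := by simp
  sets_of_superset := by
    intro A B hA hAB
    exact tendsto_of_tendsto_of_tendsto_of_le_of_le tendsto_const_nhds hA (fun _ => zero_le)
      fun n => measure_mono fun ω hω h => hω (hAB h)
  inter_sets := by
    intro A B hA hB
    have h := Tendsto.add hA hB
    rw [add_zero] at h
    refine tendsto_of_tendsto_of_tendsto_of_le_of_le tendsto_const_nhds h (fun _ => zero_le)
      fun n => (measure_mono fun ω hω => ?_).trans (measure_union_le _ _)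
    by_cases h1 : (n, ω) ∈ A
    · exact Or.inr fun h2 => hω ⟨h1, h2⟩
    · exact Or.inl h1

variable {μ : Measure S}

lemma eventually_whp {P : ℕ × S → Prop} :
    (∀ᶠ p in whp μ, P p) ↔ Tendsto (fun n => μ {ω | ¬ P (n, ω)}) atTop (𝓝 0) := Iff.rfl

lemma eventually_whp_of_eventually {P : ℕ → Prop} (h : ∀ᶠ n in atTop, P n) :
    ∀ᶠ p in whp μ, P p.1 := by
  rw [eventually_whp]
  refine tendsto_const_nhds.congr' ?_
  filter_upwards [h] with n hn
  simp [hn]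

lemma eventually_whp_of_ae {P : ℕ × S → Prop} (h : ∀ᵐ ω ∂μ, ∀ n, P (n, ω)) :
    ∀ᶠ p in whp μ, P p := by
  rw [eventually_whp]
  refine tendsto_const_nhds.congr fun n => ?_
  exact (ae_iff.1 (h.mono fun ω hω => hω n)).symm

/-- If `z` is bounded in probability, then a statement which holds with probability tending to one
wherever `z ≤ K`, for every constant `K`, holds with probability tending to one. -/
lemma eventually_whp_of_tight {P : ℕ × S → Prop} {z : ℕ × S → ℝ}
    (htight : ∀ ε : ℝ≥0∞, 0 < ε → ∃ K : ℝ, ∀ᶠ n in atTop, μ {ω | K < z (n, ω)} ≤ ε)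
    (h : ∀ K : ℝ, ∀ᶠ p in whp μ, z p ≤ K → P p) : ∀ᶠ p in whp μ, P p := by
  rw [eventually_whp]
  refine ENNReal.tendsto_atTop_zero.2 fun ε hε => ?_
  obtain ⟨K, hK⟩ := htight (ε / 2) (ENNReal.half_pos hε.ne')
  have h1 := (ENNReal.tendsto_nhds_zero.1 (eventually_whp.1 (h K))) (ε / 2)
    (ENNReal.half_pos hε.ne')
  obtain ⟨N, hN⟩ := eventually_atTop.1 (hK.and h1)
  refine ⟨N, fun n hn => ?_⟩
  calc μ {ω | ¬ P (n, ω)} ≤ μ ({ω | K < z (n, ω)} ∪ {ω | ¬ (z (n, ω) ≤ K → P (n, ω))}) := by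
        refine measure_mono fun ω hω => ?_
        by_cases hz : z (n, ω) ≤ K
        · exact Or.inr fun h2 => hω (h2 hz)
        · exact Or.inl (not_le.1 hz)
    _ ≤ ε / 2 + ε / 2 := (measure_union_le _ _).trans (add_le_add (hN n hn).1 (hN n hn).2)
    _ = ε := ENNReal.add_halves ε

end Whp

/-! ### Laws of large numbers -/

section LLN

variable {S E : Type*} [MeasurableSpace S] [MeasurableSpace E] {μ : Measure S}
  {P₀ : Measure E} {X : ℕ → S → E}

/-- An almost sure property of the generic variable holds almost surely for the whole sample. -/
lemma ae_forall_sample (hlaw : ∀ i, HasLaw (X i) P₀ μ) {p : E → Prop} (hp : ∀ᵐ x ∂P₀, p x) :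
    ∀ᵐ ω ∂μ, ∀ i, p (X i ω) := by
  refine ae_all_iff.2 fun i => ?_
  have := hlaw i
  rw [← this.map_eq] at hp
  exact ae_of_ae_map this.aemeasurable hp

/-- The weak law of large numbers. -/
theorem eventually_whp_avg [IsProbabilityMeasure μ] (hindep : iIndepFun X μ)
    (hlaw : ∀ i, HasLaw (X i) P₀ μ) {f : E → ℝ} (hf : Integrable f P₀) {ε : ℝ} (hε : 0 < ε) :
    ∀ᶠ p in whp μ, |avg (fun i : Fin p.1 => f (X i p.2)) - ∫ x, f x ∂P₀| < ε := by
  have hmap : ∀ i, μ.map (X i) = P₀ := fun i => (hlaw i).map_eq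
  have hfm : ∀ i, AEMeasurable f (μ.map (X i)) := fun i => by
    rw [hmap]; exact hf.1.aemeasurable
  have hident : ∀ i, IdentDistrib (fun ω => f (X i ω)) (fun ω => f (X 0 ω)) μ μ := fun i =>
    IdentDistrib.comp_of_aemeasurable
      ⟨(hlaw i).aemeasurable, (hlaw 0).aemeasurable, by rw [hmap, hmap]⟩ (hfm i)
  have hint : Integrable (fun ω => f (X 0 ω)) μ := by
    have : Integrable f (μ.map (X 0)) := by rwa [hmap]
    exact this.comp_aemeasurable (hlaw 0).aemeasurable
  have hind : Pairwise (Function.onFun (IndepFun · · μ) fun i ω => f (X i ω)) := by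
    intro i j hij
    exact (hindep.comp₀ (fun _ => f) (fun i => (hlaw i).aemeasurable) hfm).indepFun hij
  have hE : ∫ ω, f (X 0 ω) ∂μ = ∫ x, f x ∂P₀ := by
    rw [← hmap 0, integral_map (hlaw 0).aemeasurable (by rw [hmap]; exact hf.1)]
  have hslln := strong_law_ae_real (fun i ω => f (X i ω)) hint hind hident
  have hmeas := tendstoInMeasure_of_tendsto_ae (μ := μ)
    (f := fun n ω => (∑ i ∈ Finset.range n, f (X i ω)) / n)
    (g := fun _ => ∫ ω, f (X 0 ω) ∂μ) (fun n => by
      refine AEMeasurable.aestronglyMeasurable (AEMeasurable.div_const ?_ _)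
      exact Finset.aemeasurable_fun_sum _ fun i _ => (hident i).aemeasurable_fst) hslln
  rw [eventually_whp]
  rw [tendstoInMeasure_iff_norm] at hmeas
  refine (hmeas ε hε).congr fun n => ?_
  congr 1
  ext ω
  simp only [mem_ofPred_eq, not_lt, Real.norm_eq_abs, hE, avg]
  rw [Finset.sum_range (fun i => f (X i ω)), div_eq_inv_mul]

/-- If a moment of order larger than two is finite, then the maximum of the sample is negligible
with respect to the square root of the sample size. -/
theorem eventually_whp_le_mul_sqrt (hlaw : ∀ i, HasLaw (X i) P₀ μ) {b : E → ℝ≥0∞}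
    (hb : AEMeasurable b P₀) {α : ℝ} (hα : 2 < α) (hfin : ∫⁻ x, b x ^ α ∂P₀ < ∞) {ε : ℝ}
    (hε : 0 < ε) :
    ∀ᶠ p in whp μ, ∀ i : Fin p.1, b (X i p.2) ≤ ENNReal.ofReal (ε * √p.1) := by
  set I := ∫⁻ x, b x ^ α ∂P₀ with hI
  have hα0 : 0 < α := by linarith
  have hbound : ∀ n : ℕ, n ≠ 0 → μ {ω | ¬ ∀ i : Fin n, b (X i ω) ≤ ENNReal.ofReal (ε * √n)} ≤
      ENNReal.ofReal (I.toReal / ε ^ α * (n : ℝ) ^ (-(α / 2 - 1))) := by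
    intro n hn
    have hnpos : (0 : ℝ) < n := by positivity
    set c := ENNReal.ofReal (ε * √n) with hc
    have hc0 : 0 < ε * √n := mul_pos hε (Real.sqrt_pos.2 hnpos)
    have hcα : c ^ α = ENNReal.ofReal ((ε * √n) ^ α) := by
      rw [hc, ENNReal.ofReal_rpow_of_pos hc0]
    have h1 : P₀ {x | c < b x} ≤ I / c ^ α := by
      refine le_trans (measure_mono fun x hx => ?_)
        (meas_ge_le_lintegral_div (hb.pow_const α) ?_ ?_)
      · exact ENNReal.rpow_le_rpow (le_of_lt hx) hα0.le
      · rw [hcα]; exact (ENNReal.ofReal_pos.2 (by positivity)).ne'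
      · rw [hcα]; exact ENNReal.ofReal_ne_top
    have h2 : ∀ i : Fin n, μ {ω | c < b (X i ω)} ≤ I / c ^ α := fun i => by
      refine le_trans ?_ h1
      rw [← (hlaw i).map_eq]
      exact Measure.le_map_apply (hlaw i).aemeasurable {x | c < b x}
    calc μ {ω | ¬ ∀ i : Fin n, b (X i ω) ≤ c} ≤ μ (⋃ i : Fin n, {ω | c < b (X i ω)}) := by
          refine measure_mono fun ω hω => ?_
          obtain ⟨i, hi⟩ := not_forall.1 hω
          exact mem_iUnion.2 ⟨i, not_le.1 hi⟩
      _ ≤ ∑ i : Fin n, μ {ω | c < b (X i ω)} := measure_iUnion_fintype_le _ _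
      _ ≤ ∑ _i : Fin n, I / c ^ α := Finset.sum_le_sum fun i _ => h2 i
      _ = n * (I / c ^ α) := by simp
      _ = ENNReal.ofReal (n * (I.toReal / (ε * √n) ^ α)) := by
          rw [ENNReal.ofReal_mul hnpos.le, ENNReal.ofReal_natCast,
            ENNReal.ofReal_div_of_pos (by positivity), ENNReal.ofReal_toReal hfin.ne, hcα]
      _ = _ := by
          congr 1
          rw [Real.mul_rpow hε.le (Real.sqrt_nonneg _), Real.sqrt_eq_rpow, ← Real.rpow_mul hnpos.le,
            neg_sub, Real.rpow_sub hnpos, Real.rpow_one]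
          have h3 : (1 / 2 * α : ℝ) = α / 2 := by ring
          rw [h3]
          field_simp
  rw [eventually_whp]
  have hlim : Tendsto (fun n : ℕ => ENNReal.ofReal (I.toReal / ε ^ α * (n : ℝ) ^ (-(α / 2 - 1))))
      atTop (𝓝 0) := by
    have h1 := (tendsto_rpow_neg_atTop (y := α / 2 - 1) (by linarith)).comp
      tendsto_natCast_atTop_atTop
    have h2 := ENNReal.tendsto_ofReal (h1.const_mul (I.toReal / ε ^ α))
    simpa using h2
  refine tendsto_of_tendsto_of_tendsto_of_le_of_le' tendsto_const_nhds hlim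
    (Eventually.of_forall fun _ => zero_le) ?_
  filter_upwards [eventually_ne_atTop 0] with n hn using hbound n hn

end LLN

/-- A local uniform law of large numbers: a dominated family of functions which is almost surely
continuous at a parameter has averages close to the mean in a neighborhood of this parameter. -/
theorem eventually_whp_avg_nhds {S E T : Type*} [MeasurableSpace S] {μ : Measure S}
    [IsProbabilityMeasure μ] [TopologicalSpace E] [PolishSpace E] [MeasurableSpace E] [BorelSpace E]
    {P₀ : Measure E} [IsProbabilityMeasure P₀] {X : ℕ → S → E} (hindep : iIndepFun X μ)
    (hlaw : ∀ i, HasLaw (X i) P₀ μ) [PseudoMetricSpace T] [MeasurableSpace T]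
    [OpensMeasurableSpace T] [StandardBorelSpace T] {F : E → T → ℝ}
    (hF : Measurable (Function.uncurry F)) {t₀ : T} (hcont : ∀ᵐ x ∂P₀, ContinuousAt (F x) t₀)
    (hdom : ∫⁻ x, ⨆ t, ‖F x t‖ₑ ∂P₀ < ∞) {ε : ℝ} (hε : 0 < ε) :
    ∃ δ > 0, ∀ᶠ p in whp μ, ∀ t, dist t t₀ < δ →
      |avg (fun i : Fin p.1 => F (X i p.2) t) - ∫ x, F x t₀ ∂P₀| < ε := by
  have hF₀ : Measurable fun x => F x t₀ := hF.comp (measurable_id.prodMk measurable_const)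
  have hint : Integrable (fun x => F x t₀) P₀ :=
    ⟨hF₀.aestronglyMeasurable, (lintegral_mono fun x => le_iSup (fun t => ‖F x t‖ₑ) t₀).trans_lt
      hdom⟩
  -- the oscillation around `t₀`
  set D : ℝ → E → ℝ≥0∞ := fun δ x => ⨆ t ∈ Metric.ball t₀ δ, ‖F x t - F x t₀‖ₑ with hD
  have hDm : ∀ δ, AEMeasurable (D δ) P₀ := fun δ => by
    refine aemeasurable_iSup_mem P₀ (f := fun x t => ‖F x t - F x t₀‖ₑ) ?_
      Metric.isOpen_ball.measurableSet
    exact (hF.sub (hF₀.comp measurable_fst)).enorm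
  have hDle : ∀ δ x, D δ x ≤ 2 * ⨆ t, ‖F x t‖ₑ := fun δ x => iSup₂_le fun t _ => by
    rw [two_mul]
    exact enorm_sub_le.trans (add_le_add (le_iSup (fun t => ‖F x t‖ₑ) t)
      (le_iSup (fun t => ‖F x t‖ₑ) t₀))
  have hfin2 : ∫⁻ x, 2 * ⨆ t, ‖F x t‖ₑ ∂P₀ ≠ ∞ := by
    rw [lintegral_const_mul' _ _ (by simp)]
    exact ENNReal.mul_ne_top (by simp) hdom.ne
  have hlim : Tendsto (fun k : ℕ => ∫⁻ x, D (1 / ((k : ℝ) + 1)) x ∂P₀) atTop (𝓝 0) := by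
    have := tendsto_lintegral_of_dominated_convergence' (μ := P₀)
      (F := fun k : ℕ => D (1 / ((k : ℝ) + 1))) (f := fun _ => 0) (fun x => 2 * ⨆ t, ‖F x t‖ₑ)
      (fun k => hDm _) (fun k => Eventually.of_forall fun x => hDle _ x) hfin2 ?_
    · simpa using this
    filter_upwards [hcont] with x hx
    refine ENNReal.tendsto_nhds_zero.2 fun η hη => ?_
    have h1 : ∀ᶠ t in 𝓝 t₀, edist (F x t) (F x t₀) ≤ η :=
      (hx.eventually (Metric.closedEBall_mem_nhds _ hη))
    obtain ⟨δ, hδ, h2⟩ := Metric.eventually_nhds_iff.1 h1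
    filter_upwards [(tendsto_one_div_add_atTop_nhds_zero_nat (𝕜 := ℝ)).eventually_lt_const hδ]
      with k hk
    refine iSup₂_le fun t ht => ?_
    rw [← edist_eq_enorm_sub]
    exact h2 ((Metric.mem_ball.1 ht).trans hk)
  obtain ⟨k, hk⟩ := ((ENNReal.tendsto_nhds_zero.1 hlim) (ENNReal.ofReal (ε / 3))
    (by positivity)).exists
  set δ : ℝ := 1 / ((k : ℝ) + 1) with hδ
  have hDfin : ∫⁻ x, D δ x ∂P₀ ≠ ∞ := ne_top_of_le_ne_top ENNReal.ofReal_ne_top hk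
  have hDint : Integrable (fun x => (D δ x).toReal) P₀ := integrable_toReal_of_lintegral_ne_top
    (hDm δ) hDfin
  have hDE : ∫ x, (D δ x).toReal ∂P₀ ≤ ε / 3 := by
    rw [integral_toReal (hDm δ) (ae_lt_top' (hDm δ) hDfin)]
    exact ENNReal.toReal_le_of_le_ofReal (by positivity) hk
  refine ⟨δ, by positivity, ?_⟩
  filter_upwards [eventually_whp_avg hindep hlaw hint (ε := ε / 3) (by positivity),
    eventually_whp_avg hindep hlaw hDint (ε := ε / 3) (by positivity),
    eventually_whp_of_ae (μ := μ) (P := fun p => ∀ i, D δ (X i p.2) < ∞)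
      ((ae_forall_sample hlaw (ae_lt_top' (hDm δ) hDfin)).mono fun ω hω _ => hω)]
    with p h1 h2 h3 t ht
  have h4 : |avg (fun i : Fin p.1 => F (X i p.2) t) - avg fun i : Fin p.1 => F (X i p.2) t₀| ≤
      avg fun i : Fin p.1 => (D δ (X i p.2)).toReal := by
    rw [← avg_sub]
    refine (abs_avg_le _).trans (avg_mono fun i => ?_)
    rw [← Real.norm_eq_abs, ← toReal_enorm]
    exact ENNReal.toReal_mono (h3 i).ne (le_iSup₂ (f := fun t (_ : t ∈ Metric.ball t₀ δ) =>
      ‖F (X i p.2) t - F (X i p.2) t₀‖ₑ) t ht)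
  rw [abs_lt] at h1 h2 ⊢
  rw [abs_le] at h4
  constructor <;> linarith [h1.1, h1.2, h2.2, h4.1, h4.2]

/-! ### Uniform behaviour of the sample moments -/

section Envelope

lemma rpow_le_one_add_rpow (a : ℝ≥0∞) {β α : ℝ} (hβ : 0 ≤ β) (hβα : β ≤ α) :
    a ^ β ≤ 1 + a ^ α := by
  rcases le_total a 1 with h | h
  · exact (ENNReal.rpow_le_one h hβ).trans le_self_add
  · exact (ENNReal.rpow_le_rpow_of_exponent_le h hβα).trans le_add_self

variable {m d l : ℕ} {g : (Fin m → ℝ) → (Fin d → ℝ) → Fin l → ℝ} {Θ : Set (Fin d → ℝ)}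
  {P₀ : Measure (Fin m → ℝ)} {θ₀ : Fin d → ℝ}

/-- The envelope `sup_θ ‖g(x, θ)‖` of the moment functions. -/
noncomputable def envelope (g : (Fin m → ℝ) → (Fin d → ℝ) → Fin l → ℝ) (Θ : Set (Fin d → ℝ))
    (x : Fin m → ℝ) : ℝ≥0∞ := ⨆ θ : Θ, ‖g x θ‖ₑ

lemma enorm_le_envelope (x : Fin m → ℝ) {θ : Fin d → ℝ} (hθ : θ ∈ Θ) :
    ‖g x θ‖ₑ ≤ envelope g Θ x := le_iSup (fun θ : Θ => ‖g x θ‖ₑ) ⟨θ, hθ⟩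

lemma envelope_rpow_le (x : Fin m → ℝ) {α : ℝ} (hα : 0 < α) :
    envelope g Θ x ^ α ≤ ⨆ θ ∈ Θ, ‖g x θ‖ₑ ^ α := by
  rw [← ENNReal.le_rpow_inv_iff hα]
  refine iSup_le fun θ => ?_
  rw [ENNReal.le_rpow_inv_iff hα]
  exact le_iSup₂ (f := fun (θ : Fin d → ℝ) (_ : θ ∈ Θ) => ‖g x θ‖ₑ ^ α) θ.1 θ.2

lemma IsIdentified.standardBorelSpace (h₁ : IsIdentified g Θ P₀ θ₀) : StandardBorelSpace Θ :=
  h₁.compact.measurableSet.standardBorel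

lemma IsIdentified.measurable_apply (h₁ : IsIdentified g Θ P₀ θ₀) (j : Fin l) :
    Measurable (Function.uncurry fun (x : Fin m → ℝ) (θ : Θ) => g x θ j) :=
  (measurable_pi_apply j).comp h₁.measurable

lemma IsIdentified.measurable_section (h₁ : IsIdentified g Θ P₀ θ₀) {θ : Fin d → ℝ} (hθ : θ ∈ Θ)
    (j : Fin l) : Measurable fun x => g x θ j :=
  (h₁.measurable_apply j).comp (measurable_id.prodMk (measurable_const (a := (⟨θ, hθ⟩ : Θ))))

lemma IsIdentified.continuousAt (h₁ : IsIdentified g Θ P₀ θ₀) (θ : Θ) (j : Fin l) :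
    ∀ᵐ x ∂P₀, ContinuousAt (fun θ : Θ => g x θ j) θ := by
  filter_upwards [h₁.continuous θ θ.2] with x hx
  have := continuousWithinAt_iff_continuousAt_domRestrict (g x) θ.2 |>.1 hx
  exact (continuous_apply j).continuousAt.comp this

lemma IsIdentified.exists_lintegral_envelope_rpow (h₁ : IsIdentified g Θ P₀ θ₀) :
    ∃ α : ℝ, 2 < α ∧ ∫⁻ x, envelope g Θ x ^ α ∂P₀ < ∞ := by
  obtain ⟨α, hα, h⟩ := h₁.moment_bound
  exact ⟨α, hα, (lintegral_mono fun x => envelope_rpow_le x (by linarith)).trans_lt h⟩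

variable [IsProbabilityMeasure P₀]

lemma IsIdentified.aemeasurable_envelope (h₁ : IsIdentified g Θ P₀ θ₀) :
    AEMeasurable (envelope g Θ) P₀ := by
  have := h₁.standardBorelSpace
  have h := aemeasurable_iSup_mem P₀ (f := fun (x : Fin m → ℝ) (θ : Θ) => ‖g x θ‖ₑ)
    h₁.measurable.enorm MeasurableSet.univ
  simp only [mem_univ, iSup_pos] at h
  exact h

lemma IsIdentified.lintegral_envelope_rpow_lt_top (h₁ : IsIdentified g Θ P₀ θ₀) {β : ℝ}
    (hβ : 0 ≤ β) (hβ2 : β ≤ 2) : ∫⁻ x, envelope g Θ x ^ β ∂P₀ < ∞ := by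
  obtain ⟨α, hα, h⟩ := h₁.exists_lintegral_envelope_rpow
  refine (lintegral_mono fun x => rpow_le_one_add_rpow _ hβ (hβ2.trans hα.le)).trans_lt ?_
  rw [lintegral_add_left measurable_const]
  simpa using h

lemma IsIdentified.lintegral_envelope_lt_top (h₁ : IsIdentified g Θ P₀ θ₀) :
    ∫⁻ x, envelope g Θ x ∂P₀ < ∞ := by
  simpa using h₁.lintegral_envelope_rpow_lt_top (β := 1) (by norm_num) (by norm_num)

lemma IsIdentified.lintegral_envelope_sq_lt_top (h₁ : IsIdentified g Θ P₀ θ₀) :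
    ∫⁻ x, envelope g Θ x ^ 2 ∂P₀ < ∞ := by
  simpa using h₁.lintegral_envelope_rpow_lt_top (β := 2) (by norm_num) le_rfl

lemma enorm_apply_le_envelope (x : Fin m → ℝ) (θ : Θ) (j : Fin l) :
    ‖g x θ j‖ₑ ≤ envelope g Θ x := by
  refine le_trans ?_ (enorm_le_envelope x θ.2)
  rw [enorm_le_iff_norm_le]
  exact norm_le_pi_norm (g x θ) j

lemma IsIdentified.integrable (h₁ : IsIdentified g Θ P₀ θ₀) {θ : Fin d → ℝ} (hθ : θ ∈ Θ)
    (j : Fin l) : Integrable (fun x => g x θ j) P₀ :=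
  ⟨(h₁.measurable_section hθ j).aestronglyMeasurable,
    (lintegral_mono fun x => enorm_apply_le_envelope x ⟨θ, hθ⟩ j).trans_lt
      h₁.lintegral_envelope_lt_top⟩

lemma IsIdentified.memLp_two (h₁ : IsIdentified g Θ P₀ θ₀) {θ : Fin d → ℝ} (hθ : θ ∈ Θ)
    (j : Fin l) : MemLp (fun x => g x θ j) 2 P₀ := by
  refine ⟨(h₁.measurable_section hθ j).aestronglyMeasurable, ?_⟩
  rw [eLpNorm_lt_top_iff_lintegral_rpow_enorm_lt_top (by simp) (by simp)]
  refine (lintegral_mono fun x => ?_).trans_lt h₁.lintegral_envelope_sq_lt_top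
  simpa using pow_le_pow_left' (enorm_apply_le_envelope x ⟨θ, hθ⟩ j) 2

lemma IsIdentified.integral_apply (h₁ : IsIdentified g Θ P₀ θ₀) {θ : Fin d → ℝ} (hθ : θ ∈ Θ)
    (j : Fin l) : (∫ x, g x θ ∂P₀) j = ∫ x, g x θ j ∂P₀ :=
  eval_integral (fun j => h₁.integrable hθ j) j

lemma IsIdentified.integral_apply_eq_zero (h₁ : IsIdentified g Θ P₀ θ₀) (j : Fin l) :
    ∫ x, g x θ₀ j ∂P₀ = 0 := by
  rw [← h₁.integral_apply h₁.mem, h₁.moment_eq_zero]; rfl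

lemma IsIdentified.dotProduct_momentMatrix (h₁ : IsIdentified g Θ P₀ θ₀) (τ : Fin l → ℝ) :
    τ ⬝ᵥ momentMatrix g P₀ θ₀ *ᵥ τ = ∫ x, (τ ⬝ᵥ g x θ₀) ^ 2 ∂P₀ := by
  have hint : ∀ j k, Integrable (fun x => g x θ₀ j * g x θ₀ k) P₀ := fun j k =>
    (h₁.memLp_two h₁.mem j).integrable_mul (h₁.memLp_two h₁.mem k)
  have h : ∀ x, (τ ⬝ᵥ g x θ₀) ^ 2 = ∑ j, ∑ k, τ j * τ k * (g x θ₀ j * g x θ₀ k) := fun x => by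
    rw [sq, dotProduct, Finset.sum_mul_sum]
    exact Finset.sum_congr rfl fun j _ => Finset.sum_congr rfl fun k _ => by ring
  simp_rw [h]
  rw [integral_finsetSum _ fun j _ => integrable_finsetSum _ fun k _ => (hint j k).const_mul _]
  refine Finset.sum_congr rfl fun j _ => ?_
  rw [integral_finsetSum _ fun k _ => (hint j k).const_mul _]
  simp only [Matrix.mulVec, dotProduct, Finset.mul_sum]
  refine Finset.sum_congr rfl fun k _ => ?_
  rw [integral_const_mul]
  simp only [momentMatrix, Matrix.of_apply]
  ring

lemma IsIdentified.posDef (h₁ : IsIdentified g Θ P₀ θ₀) : (momentMatrix g P₀ θ₀).PosDef := by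
  have hpsd : (momentMatrix g P₀ θ₀).PosSemidef := by
    refine Matrix.PosSemidef.of_dotProduct_mulVec_nonneg ?_ fun τ => ?_
    · ext j k
      simp [momentMatrix, mul_comm]
    · rw [star_trivial, h₁.dotProduct_momentMatrix]
      exact integral_nonneg fun x => sq_nonneg _
  exact hpsd.posDef_iff_isUnit.2 h₁.nonsingular

end Envelope

section SampleBounds

variable {m d l : ℕ} {g : (Fin m → ℝ) → (Fin d → ℝ) → Fin l → ℝ} {Θ : Set (Fin d → ℝ)}
  {P₀ : Measure (Fin m → ℝ)} [IsProbabilityMeasure P₀] {θ₀ : Fin d → ℝ}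
  {S : Type*} [MeasurableSpace S] {μ : Measure S} {X : ℕ → S → Fin m → ℝ}

/-- All moment functions at all points of the sample are negligible with respect to `√n`; this is
where a moment of order larger than two is needed. -/
theorem IsIdentified.eventually_norm_le (h₁ : IsIdentified g Θ P₀ θ₀)
    (hlaw : ∀ i, HasLaw (X i) P₀ μ) {ε : ℝ} (hε : 0 < ε) :
    ∀ᶠ p in whp μ, ∀ θ ∈ Θ, ∀ i : Fin p.1, ‖g (X i p.2) θ‖ ≤ ε * √p.1 := by
  obtain ⟨α, hα, h⟩ := h₁.exists_lintegral_envelope_rpow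
  filter_upwards [eventually_whp_le_mul_sqrt hlaw h₁.aemeasurable_envelope hα h hε] with p hp θ hθ i
  have := (enorm_le_envelope (X i p.2) hθ).trans (hp i)
  rwa [← ofReal_norm, ENNReal.ofReal_le_ofReal_iff (by positivity)] at this

variable [IsProbabilityMeasure μ]

/-- The sample second moments are bounded uniformly over the whole parameter set. -/
theorem IsIdentified.exists_eventually_avg_sq_le (h₁ : IsIdentified g Θ P₀ θ₀)
    (hindep : iIndepFun X μ) (hlaw : ∀ i, HasLaw (X i) P₀ μ) :
    ∃ B : ℝ, 0 ≤ B ∧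
      ∀ᶠ p in whp μ, ∀ θ ∈ Θ, ∀ j, (avg fun i : Fin p.1 => g (X i p.2) θ j ^ 2) ≤ B := by
  have hm : AEMeasurable (fun x => envelope g Θ x ^ 2) P₀ := h₁.aemeasurable_envelope.pow_const 2
  have hfin := h₁.lintegral_envelope_sq_lt_top
  have hint : Integrable (fun x => (envelope g Θ x ^ 2).toReal) P₀ :=
    integrable_toReal_of_lintegral_ne_top hm hfin.ne
  have h0 : 0 ≤ ∫ x, (envelope g Θ x ^ 2).toReal ∂P₀ := integral_nonneg fun x => by positivity
  refine ⟨(∫ x, (envelope g Θ x ^ 2).toReal ∂P₀) + 1, by positivity, ?_⟩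
  filter_upwards [eventually_whp_avg hindep hlaw hint one_pos,
    eventually_whp_of_ae (μ := μ) (P := fun p => ∀ i, envelope g Θ (X i p.2) ^ 2 < ∞)
      ((ae_forall_sample hlaw (ae_lt_top' hm hfin.ne)).mono fun ω hω _ => hω)] with p h1 h2 θ hθ j
  have h3 : (avg fun i : Fin p.1 => g (X i p.2) θ j ^ 2) ≤
      avg fun i : Fin p.1 => (envelope g Θ (X i p.2) ^ 2).toReal := avg_mono fun i => by
    have h4 := pow_le_pow_left' (enorm_apply_le_envelope (g := g) (X i p.2) ⟨θ, hθ⟩ j) 2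
    have h5 := ENNReal.toReal_mono (h2 i).ne h4
    simpa using h5
  have := (abs_lt.1 h1).2
  linarith

/-- Near any parameter the sample moments are close to the expectation at this parameter. -/
theorem IsIdentified.eventually_sampleMoment (h₁ : IsIdentified g Θ P₀ θ₀)
    (hindep : iIndepFun X μ) (hlaw : ∀ i, HasLaw (X i) P₀ μ) {θ₁ : Fin d → ℝ} (hθ₁ : θ₁ ∈ Θ)
    (j : Fin l) {ε : ℝ} (hε : 0 < ε) :
    ∃ δ > 0, ∀ᶠ p in whp μ, ∀ θ ∈ Θ, dist θ θ₁ < δ →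
      |sampleMoment g (fun i : Fin p.1 => X i p.2) θ j - ∫ x, g x θ₁ j ∂P₀| < ε := by
  have := h₁.standardBorelSpace
  have key : ∃ δ > 0, ∀ᶠ p in whp μ, ∀ θ : Θ, dist θ ⟨θ₁, hθ₁⟩ < δ →
      |avg (fun i : Fin p.1 => g (X i p.2) θ j) - ∫ x, g x θ₁ j ∂P₀| < ε := by
    refine eventually_whp_avg_nhds (P₀ := P₀) hindep hlaw (T := Θ) (F := fun x θ => g x θ j)
      ?_ (t₀ := ⟨θ₁, hθ₁⟩) ?_ ?_ hε
    · exact h₁.measurable_apply j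
    · exact h₁.continuousAt ⟨θ₁, hθ₁⟩ j
    exact (lintegral_mono fun x => iSup_le fun θ => enorm_apply_le_envelope x θ j).trans_lt
      h₁.lintegral_envelope_lt_top
  obtain ⟨δ, hδ, h⟩ := key
  exact ⟨δ, hδ, h.mono fun p hp θ hθ hd => hp ⟨θ, hθ⟩ hd⟩

/-- Away from the true parameter the sample moments stay away from zero. -/
theorem IsIdentified.exists_eventually_le_norm_sampleMoment (h₁ : IsIdentified g Θ P₀ θ₀)
    (hindep : iIndepFun X μ) (hlaw : ∀ i, HasLaw (X i) P₀ μ) {δ : ℝ} (hδ : 0 < δ) :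
    ∃ η > 0, ∀ᶠ p in whp μ, ∀ θ ∈ Θ, δ ≤ dist θ θ₀ →
      η ≤ ‖sampleMoment g (fun i : Fin p.1 => X i p.2) θ‖ := by
  have hK : IsCompact (Θ \ Metric.ball θ₀ δ) := h₁.compact.diff Metric.isOpen_ball
  have key : ∃ η > 0, ∀ᶠ p in whp μ, ∀ θ ∈ Θ \ Metric.ball θ₀ δ,
      η ≤ ‖sampleMoment g (fun i : Fin p.1 => X i p.2) θ‖ := by
    let Q : Set (Fin d → ℝ) → Prop := fun s => ∃ η > 0, ∀ᶠ p in whp μ, ∀ θ ∈ s,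
      η ≤ ‖sampleMoment g (fun i : Fin p.1 => X i p.2) θ‖
    change Q (Θ \ Metric.ball θ₀ δ)
    refine hK.induction_on (p := Q) ?_ ?_ ?_ ?_
    · exact ⟨1, one_pos, Eventually.of_forall fun p θ hθ => hθ.elim⟩
    · rintro s t hst ⟨η, hη, h⟩
      exact ⟨η, hη, h.mono fun p hp θ hθ => hp θ (hst hθ)⟩
    · rintro s t ⟨η, hη, h⟩ ⟨η', hη', h'⟩
      refine ⟨min η η', lt_min hη hη', ?_⟩
      filter_upwards [h, h'] with p hp hp' θ hθ
      rcases hθ with hθ | hθ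
      · exact (min_le_left _ _).trans (hp θ hθ)
      · exact (min_le_right _ _).trans (hp' θ hθ)
    · rintro θ₁ ⟨hθ₁, hne⟩
      have hne' : θ₁ ≠ θ₀ := by
        rintro rfl
        exact hne (Metric.mem_ball_self hδ)
      obtain ⟨j, hj⟩ : ∃ j, ∫ x, g x θ₁ j ∂P₀ ≠ 0 := by
        by_contra! hcon
        refine hne' (h₁.unique θ₁ hθ₁ (funext fun j => ?_))
        rw [h₁.integral_apply hθ₁, hcon]; rfl
      have hpos := abs_pos.2 hj
      obtain ⟨r, hr, h⟩ := h₁.eventually_sampleMoment hindep hlaw hθ₁ j (half_pos hpos)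
      refine ⟨(Θ \ Metric.ball θ₀ δ) ∩ Metric.ball θ₁ r,
        inter_mem_nhdsWithin _ (Metric.ball_mem_nhds _ hr), _, half_pos hpos, ?_⟩
      filter_upwards [h] with p hp θ hθ
      have h2 := hp θ hθ.1.1 hθ.2
      have h3 := norm_le_pi_norm (sampleMoment g (fun i : Fin p.1 => X i p.2) θ) j
      rw [Real.norm_eq_abs] at h3
      have h4 := abs_sub_abs_le_abs_sub (∫ x, g x θ₁ j ∂P₀)
        (sampleMoment g (fun i : Fin p.1 => X i p.2) θ j)
      rw [abs_sub_comm] at h4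
      linarith
  obtain ⟨η, hη, h⟩ := key
  exact ⟨η, hη, h.mono fun p hp θ hθ hd => hp θ ⟨hθ, fun hb => not_lt.2 hd hb⟩⟩

/-- Near the true parameter the sample second moments are close to those given by `Ω`, uniformly
over all directions. -/
theorem IsIdentified.exists_eventually_sampleSq (h₁ : IsIdentified g Θ P₀ θ₀)
    (hindep : iIndepFun X μ) (hlaw : ∀ i, HasLaw (X i) P₀ μ) {ε : ℝ} (hε : 0 < ε) :
    ∃ δ > 0, ∀ᶠ p in whp μ, ∀ θ ∈ Θ, dist θ θ₀ < δ → ∀ τ,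
      |sampleSq g (fun i : Fin p.1 => X i p.2) θ τ - τ ⬝ᵥ momentMatrix g P₀ θ₀ *ᵥ τ| ≤
        ε * ‖τ‖ ^ 2 := by
  have := h₁.standardBorelSpace
  set e := ε / ((l : ℝ) ^ 2 + 1) with he
  have he0 : 0 < e := by positivity
  have hjk : ∀ jk : Fin l × Fin l, ∃ δ > 0, ∀ᶠ p in whp μ, ∀ θ : Θ, dist θ ⟨θ₀, h₁.mem⟩ < δ →
      |avg (fun i : Fin p.1 => g (X i p.2) θ jk.1 * g (X i p.2) θ jk.2) -
        momentMatrix g P₀ θ₀ jk.1 jk.2| < e := fun jk => by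
    refine eventually_whp_avg_nhds (P₀ := P₀) hindep hlaw (T := Θ)
      (F := fun x θ => g x θ jk.1 * g x θ jk.2)
      ((h₁.measurable_apply jk.1).mul (h₁.measurable_apply jk.2)) (t₀ := ⟨θ₀, h₁.mem⟩) ?_ ?_ he0
    · filter_upwards [h₁.continuousAt ⟨θ₀, h₁.mem⟩ jk.1, h₁.continuousAt ⟨θ₀, h₁.mem⟩ jk.2]
        with x hx hx' using hx.mul hx'
    · refine (lintegral_mono fun x => iSup_le fun θ => ?_).trans_lt h₁.lintegral_envelope_sq_lt_top
      rw [enorm_mul, sq]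
      exact mul_le_mul' (enorm_apply_le_envelope x θ _) (enorm_apply_le_envelope x θ _)
  choose δ hδ hev using hjk
  obtain ⟨r, hr, hrδ⟩ : ∃ r > 0, ∀ jk, r ≤ δ jk := by
    rcases isEmpty_or_nonempty (Fin l × Fin l) with hemp | hne
    · exact ⟨1, one_pos, fun jk => (hemp.false jk).elim⟩
    · obtain ⟨jk₀, h⟩ := Finite.exists_min δ
      exact ⟨δ jk₀, hδ jk₀, h⟩
  refine ⟨r, hr, ?_⟩
  filter_upwards [eventually_all.2 hev] with p hp θ hθ hd τ
  have h1 : sampleSq g (fun i : Fin p.1 => X i p.2) θ τ =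
      ∑ j, ∑ k, τ j * τ k * avg fun i : Fin p.1 => g (X i p.2) θ j * g (X i p.2) θ k := by
    simp only [sampleSq, ← avg_const_mul, ← avg_sum]
    congr 1
    ext i
    rw [sq, dotProduct, Finset.sum_mul_sum]
    exact Finset.sum_congr rfl fun j _ => Finset.sum_congr rfl fun k _ => by ring
  have h2 : τ ⬝ᵥ momentMatrix g P₀ θ₀ *ᵥ τ =
      ∑ j, ∑ k, τ j * τ k * momentMatrix g P₀ θ₀ j k := by
    simp only [Matrix.mulVec, dotProduct, Finset.mul_sum]
    exact Finset.sum_congr rfl fun j _ => Finset.sum_congr rfl fun k _ => by ring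
  rw [h1, h2, ← Finset.sum_sub_distrib]
  simp_rw [← Finset.sum_sub_distrib, ← mul_sub]
  calc _ ≤ ∑ j : Fin l, ∑ k : Fin l, ‖τ‖ * ‖τ‖ * e := by
        refine (Finset.abs_sum_le_sum_abs _ _).trans (Finset.sum_le_sum fun j _ => ?_)
        refine (Finset.abs_sum_le_sum_abs _ _).trans (Finset.sum_le_sum fun k _ => ?_)
        rw [abs_mul, abs_mul]
        have h3 := (hp (j, k) ⟨θ, hθ⟩ (lt_of_lt_of_le hd (hrδ _))).le
        exact mul_le_mul (mul_le_mul (norm_le_pi_norm τ j) (norm_le_pi_norm τ k) (abs_nonneg _)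
          (norm_nonneg _)) h3 (abs_nonneg _) (by positivity)
    _ = (l : ℝ) ^ 2 * e * ‖τ‖ ^ 2 := by
        simp only [Finset.sum_const, Finset.card_univ, Fintype.card_fin, nsmul_eq_mul]; ring
    _ ≤ ε * ‖τ‖ ^ 2 := by
        gcongr
        rw [he, mul_div_assoc', div_le_iff₀ (by positivity)]
        nlinarith

end SampleBounds

/-! ### Differentiability of the sample moments -/

section Derivative

variable {m d l : ℕ} {g : (Fin m → ℝ) → (Fin d → ℝ) → Fin l → ℝ} {Θ : Set (Fin d → ℝ)}
  {P₀ : Measure (Fin m → ℝ)} {θ₀ : Fin d → ℝ}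

/-- The smoothness conditions on a ball around the true parameter. -/
lemma IsSmooth.exists_ball (h₂ : IsSmooth g Θ P₀ θ₀) : ∃ ρ > 0, Metric.ball θ₀ ρ ⊆ Θ ∧
    (∀ᵐ x ∂P₀, ∀ θ ∈ Metric.ball θ₀ ρ, DifferentiableAt ℝ (g x) θ) ∧
    ∫⁻ x, ⨆ θ ∈ Metric.ball θ₀ ρ, ‖fderiv ℝ (g x) θ‖ₑ ∂P₀ < ∞ := by
  obtain ⟨N, hN, hmem, hsub, hC1, hdom⟩ := h₂.differentiable
  obtain ⟨ρ, hρ, hball⟩ := Metric.isOpen_iff.1 hN θ₀ hmem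
  refine ⟨ρ, hρ, hball.trans hsub, ?_, (lintegral_mono fun x => ?_).trans_lt hdom⟩
  · filter_upwards [hC1] with x hx θ hθ
    exact (hx.differentiableOn (by norm_num)).differentiableAt (hN.mem_nhds (hball hθ))
  · exact biSup_mono hball

/-- The derivative in a fixed direction is measurable as an almost sure limit of difference
quotients along a sequence. -/
lemma aemeasurable_fderiv_apply (h₁ : IsIdentified g Θ P₀ θ₀) (h₂ : IsSmooth g Θ P₀ θ₀)
    (v : Fin d → ℝ) (j : Fin l) : AEMeasurable (fun x => fderiv ℝ (g x) θ₀ v j) P₀ := by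
  obtain ⟨ρ, hρ, hsub, hdiff, -⟩ := h₂.exists_ball
  set s := ρ / (2 * (‖v‖ + 1)) with hs
  have hs0 : 0 < s := by positivity
  let c : ℕ → ℝ := fun n => ((n : ℝ) + 1) / s
  have hc0 : ∀ n, 0 < c n := fun n => by positivity
  have hw : ∀ n, θ₀ + (c n)⁻¹ • v ∈ Metric.ball θ₀ ρ := fun n => by
    rw [Metric.mem_ball, dist_eq_norm, add_sub_cancel_left, norm_smul, Real.norm_of_nonneg
      (inv_nonneg.2 (hc0 n).le)]
    have h1 : (c n)⁻¹ ≤ s := by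
      rw [inv_div]
      exact div_le_self hs0.le (by linarith [n.cast_nonneg (α := ℝ)])
    have h2 : s * ‖v‖ < ρ := by
      rw [hs, div_mul_eq_mul_div, div_lt_iff₀ (by positivity)]
      nlinarith [norm_nonneg v]
    exact lt_of_le_of_lt (by gcongr) h2
  refine aemeasurable_of_tendsto_metrizable_ae atTop
    (f := fun n x => c n * (g x (θ₀ + (c n)⁻¹ • v) j - g x θ₀ j)) (fun n => ?_) ?_
  · exact (((h₁.measurable_section (hsub (hw n)) j).sub
      (h₁.measurable_section h₁.mem j)).const_mul _).aemeasurable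
  · filter_upwards [hdiff] with x hx
    have hd := (hx θ₀ (Metric.mem_ball_self hρ)).hasFDerivAt
    have hlim := hd.lim v (c := c) (l := atTop) <| tendsto_norm_atTop_atTop.comp <|
      Tendsto.atTop_div_const hs0 <|
        tendsto_atTop_add_const_right _ _ tendsto_natCast_atTop_atTop
    simpa using (tendsto_pi_nhds.1 hlim) j

lemma norm_fderiv_le_toReal_iSup {ρ : ℝ} {x : Fin m → ℝ}
    (hfin : ⨆ θ ∈ Metric.ball θ₀ ρ, ‖fderiv ℝ (g x) θ‖ₑ ≠ ∞) {θ : Fin d → ℝ}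
    (hθ : θ ∈ Metric.ball θ₀ ρ) :
    ‖fderiv ℝ (g x) θ‖ ≤ (⨆ θ ∈ Metric.ball θ₀ ρ, ‖fderiv ℝ (g x) θ‖ₑ).toReal := by
  rw [← toReal_enorm]
  exact ENNReal.toReal_mono hfin
    (le_iSup₂ (f := fun θ (_ : θ ∈ Metric.ball θ₀ ρ) => ‖fderiv ℝ (g x) θ‖ₑ) θ hθ)

lemma sum_mul_fderiv_single (x : Fin m → ℝ) (u : Fin d → ℝ) (j : Fin l) :
    ∑ i, fderiv ℝ (g x) θ₀ (Pi.single i 1) j * u i = fderiv ℝ (g x) θ₀ u j := by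
  have h : u = ∑ i, u i • (Pi.single i 1 : Fin d → ℝ) := pi_eq_sum_univ' u
  conv_rhs => rw [h]
  rw [map_sum, Finset.sum_apply]
  refine Finset.sum_congr rfl fun i _ => ?_
  rw [map_smul, Pi.smul_apply, smul_eq_mul, mul_comm]

lemma integrable_fderiv_single [IsProbabilityMeasure P₀] (h₁ : IsIdentified g Θ P₀ θ₀)
    (h₂ : IsSmooth g Θ P₀ θ₀) (i : Fin d) (j : Fin l) :
    Integrable (fun x => fderiv ℝ (g x) θ₀ (Pi.single i 1) j) P₀ := by
  obtain ⟨ρ, hρ, -, -, hdom⟩ := h₂.exists_ball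
  refine ⟨(aemeasurable_fderiv_apply h₁ h₂ _ j).aestronglyMeasurable,
    (lintegral_mono fun x => ?_).trans_lt hdom⟩
  refine le_trans ?_ (le_iSup₂ (f := fun θ (_ : θ ∈ Metric.ball θ₀ ρ) => ‖fderiv ℝ (g x) θ‖ₑ) θ₀
    (Metric.mem_ball_self hρ))
  rw [enorm_le_iff_norm_le]
  refine (norm_le_pi_norm _ j).trans (((fderiv ℝ (g x) θ₀).le_opNorm _).trans ?_)
  rw [Pi.norm_single, norm_one, mul_one]

variable {S : Type*} [MeasurableSpace S] {μ : Measure S} [IsProbabilityMeasure μ]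
  {X : ℕ → S → Fin m → ℝ} [IsProbabilityMeasure P₀]

/-- One coordinate of the uniform differentiability of the sample moments at the true parameter.
The local uniform law of large numbers is applied to the difference quotients. -/
theorem exists_eventually_sampleMoment_sub_apply (h₁ : IsIdentified g Θ P₀ θ₀)
    (h₂ : IsSmooth g Θ P₀ θ₀) (hindep : iIndepFun X μ) (hlaw : ∀ i, HasLaw (X i) P₀ μ)
    (j : Fin l) {ε : ℝ} (hε : 0 < ε) :
    ∃ δ > 0, ∀ᶠ p in whp μ, ∀ θ ∈ Θ, dist θ θ₀ < δ →
      |sampleMoment g (fun i : Fin p.1 => X i p.2) θ j -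
        sampleMoment g (fun i : Fin p.1 => X i p.2) θ₀ j -
        ((gradMatrix g P₀ θ₀)ᵀ *ᵥ (θ - θ₀)) j| ≤ ε * ‖θ - θ₀‖ := by
  have := h₁.standardBorelSpace
  obtain ⟨ρ, hρ, hsub, hdiff, hdom⟩ := h₂.exists_ball
  have ham := fun i => aemeasurable_fderiv_apply h₁ h₂ (Pi.single i 1) j
  -- a measurable version of the derivative at the true parameter
  set a : Fin d → (Fin m → ℝ) → ℝ := fun i => (ham i).mk _ with ha
  have hae : ∀ᵐ x ∂P₀, ∀ i, a i x = fderiv ℝ (g x) θ₀ (Pi.single i 1) j :=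
    ae_all_iff.2 fun i => (ham i).ae_eq_mk.symm
  have hsum : ∀ x, (∀ i, a i x = fderiv ℝ (g x) θ₀ (Pi.single i 1) j) → ∀ u : Fin d → ℝ,
      ∑ i, a i x * u i = fderiv ℝ (g x) θ₀ u j := fun x hx u => by
    simp only [hx, sum_mul_fderiv_single]
  classical
  let F : (Fin m → ℝ) → Θ → ℝ := fun x θ => if dist (θ : Fin d → ℝ) θ₀ < ρ then
    (g x θ j - g x θ₀ j - ∑ i, a i x * (θ.1 i - θ₀ i)) / ‖θ.1 - θ₀‖ else 0
  have hF : Measurable (Function.uncurry F) := by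
    refine Measurable.ite ?_ (Measurable.div ?_ ?_) measurable_const
    · exact measurableSet_lt (by fun_prop) measurable_const
    · refine Measurable.sub (Measurable.sub (h₁.measurable_apply j)
        ((h₁.measurable_section h₁.mem j).comp measurable_fst)) ?_
      refine Finset.measurable_fun_sum _ fun i _ => Measurable.mul ?_ ?_
      · exact ((ham i).measurable_mk).comp measurable_fst
      · exact ((measurable_pi_apply i).comp
          (measurable_subtype_coe.comp measurable_snd)).sub_const _
    · exact ((measurable_subtype_coe.comp measurable_snd).sub_const _).norm
  have hF0 : ∀ x, F x ⟨θ₀, h₁.mem⟩ = 0 := fun x => by simp [F]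
  have hFeq : ∀ x, (∀ i, a i x = fderiv ℝ (g x) θ₀ (Pi.single i 1) j) → ∀ θ : Θ,
      dist (θ : Fin d → ℝ) θ₀ < ρ →
      F x θ = (g x θ - g x θ₀ - fderiv ℝ (g x) θ₀ (θ - θ₀)) j / ‖θ.1 - θ₀‖ := by
    intro x hx θ hd
    have := hsum x hx (θ.1 - θ₀)
    simp only [Pi.sub_apply] at this
    simp only [F, if_pos hd, this, Pi.sub_apply]
  have hcont : ∀ᵐ x ∂P₀, ContinuousAt (F x) ⟨θ₀, h₁.mem⟩ := by
    filter_upwards [hae, hdiff] with x hx hdx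
    have hd := (hdx θ₀ (Metric.mem_ball_self hρ)).hasFDerivAt
    rw [ContinuousAt, hF0, Metric.tendsto_nhds]
    intro η hη
    have h3 := (hasFDerivAt_iff_isLittleO.1 hd).def (half_pos hη)
    obtain ⟨r, hr, h4⟩ := Metric.eventually_nhds_iff.1 h3
    refine Metric.eventually_nhds_iff.2 ⟨min r ρ, lt_min hr hρ, fun θ hθ => ?_⟩
    have hθr : dist (θ : Fin d → ℝ) θ₀ < r := lt_of_lt_of_le hθ (min_le_left _ _)
    have hθρ : dist (θ : Fin d → ℝ) θ₀ < ρ := lt_of_lt_of_le hθ (min_le_right _ _)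
    rw [hFeq x hx θ hθρ, dist_zero_right, norm_div, norm_norm]
    refine lt_of_le_of_lt (div_le_of_le_mul₀ (norm_nonneg _) (half_pos hη).le ?_) (half_lt_self hη)
    exact (norm_le_pi_norm _ j).trans (h4 hθr)
  have hFdom : ∫⁻ x, ⨆ θ, ‖F x θ‖ₑ ∂P₀ < ∞ := by
    have hfin2 : ∫⁻ x, 2 * ⨆ θ ∈ Metric.ball θ₀ ρ, ‖fderiv ℝ (g x) θ‖ₑ ∂P₀ < ∞ := by
      rw [lintegral_const_mul' _ _ (by simp)]
      exact ENNReal.mul_lt_top (by simp) hdom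
    refine lt_of_le_of_lt (lintegral_mono_ae ?_) hfin2
    filter_upwards [hae, hdiff] with x hx hdx
    refine iSup_le fun θ => ?_
    by_cases hd : dist (θ : Fin d → ℝ) θ₀ < ρ
    · by_cases htop : ⨆ θ ∈ Metric.ball θ₀ ρ, ‖fderiv ℝ (g x) θ‖ₑ = ∞
      · rw [htop, ENNReal.mul_top (by simp)]
        exact le_top
      have hle := fun θ' hθ' => norm_fderiv_le_toReal_iSup (θ := θ') htop hθ'
      set c := (⨆ θ ∈ Metric.ball θ₀ ρ, ‖fderiv ℝ (g x) θ‖ₑ).toReal with hc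
      have hmvt : ‖g x θ - g x θ₀‖ ≤ c * ‖θ.1 - θ₀‖ :=
        (convex_ball θ₀ ρ).norm_image_sub_le_of_norm_fderiv_le hdx hle (Metric.mem_ball_self hρ) hd
      have hlin : ‖fderiv ℝ (g x) θ₀ (θ - θ₀)‖ ≤ c * ‖θ.1 - θ₀‖ :=
        (ContinuousLinearMap.le_opNorm _ _).trans (by
          gcongr
          exact hle θ₀ (Metric.mem_ball_self hρ))
      have hnorm : ‖F x θ‖ ≤ 2 * c := by
        rw [hFeq x hx θ hd, norm_div, norm_norm]
        refine div_le_of_le_mul₀ (norm_nonneg _) (by positivity) ?_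
        refine (norm_le_pi_norm _ j).trans ((norm_sub_le _ _).trans ?_)
        linarith
      rw [← ENNReal.ofReal_toReal htop, ← hc, ← ofReal_norm, ← ENNReal.ofReal_ofNat 2,
        ← ENNReal.ofReal_mul (by norm_num)]
      exact ENNReal.ofReal_le_ofReal hnorm
    · simp [F, if_neg hd]
  have key : ∃ δ > 0, ∀ᶠ p in whp μ, ∀ θ : Θ, dist θ ⟨θ₀, h₁.mem⟩ < δ →
      |avg (fun i : Fin p.1 => F (X i p.2) θ) - ∫ x, F x ⟨θ₀, h₁.mem⟩ ∂P₀| < ε / 2 :=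
    eventually_whp_avg_nhds hindep hlaw hF hcont hFdom (half_pos hε)
  obtain ⟨δ, hδ, hev⟩ := key
  simp only [hF0, integral_zero, sub_zero] at hev
  have hlln : ∀ i, ∀ᶠ p in whp μ, |avg (fun k : Fin p.1 => a i (X k p.2)) -
      gradMatrix g P₀ θ₀ i j| < ε / (2 * (d + 1)) := fun i => by
    have hint : Integrable (a i) P₀ :=
      (integrable_fderiv_single h₁ h₂ i j).congr (ham i).ae_eq_mk
    have h := eventually_whp_avg hindep hlaw hint (ε := ε / (2 * (d + 1))) (by positivity)
    have h3 : ∫ x, a i x ∂P₀ = gradMatrix g P₀ θ₀ i j :=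
      integral_congr_ae (ham i).ae_eq_mk.symm
    rwa [h3] at h
  refine ⟨min δ ρ, lt_min hδ hρ, ?_⟩
  filter_upwards [hev, eventually_all.2 hlln] with p hp1 hp2 θ hθ hd
  have hdδ : dist θ θ₀ < δ := lt_of_lt_of_le hd (min_le_left _ _)
  have hdρ : dist θ θ₀ < ρ := lt_of_lt_of_le hd (min_le_right _ _)
  have h3 := hp1 ⟨θ, hθ⟩ hdδ
  rcases eq_or_ne θ θ₀ with rfl | hne
  · simp
  have hpos : 0 < ‖θ - θ₀‖ := norm_pos_iff.2 (sub_ne_zero.2 hne)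
  have h4 : avg (fun k : Fin p.1 => F (X k p.2) ⟨θ, hθ⟩) * ‖θ - θ₀‖ =
      sampleMoment g (fun i : Fin p.1 => X i p.2) θ j -
        sampleMoment g (fun i : Fin p.1 => X i p.2) θ₀ j -
        ∑ i, avg (fun k : Fin p.1 => a i (X k p.2)) * (θ i - θ₀ i) := by
    rw [mul_comm, ← avg_const_mul]
    have h5 : ∀ x, ‖θ - θ₀‖ * F x ⟨θ, hθ⟩ =
        g x θ j - g x θ₀ j - ∑ i, (θ i - θ₀ i) * a i x := fun x => by
      simp only [F, if_pos hdρ]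
      rw [mul_div_cancel₀ _ hpos.ne']
      simp only [mul_comm]
    simp only [h5, avg_sub, avg_sum, avg_const_mul, sampleMoment]
    simp only [mul_comm]
  have h6 : ((gradMatrix g P₀ θ₀)ᵀ *ᵥ (θ - θ₀)) j =
      ∑ i, gradMatrix g P₀ θ₀ i j * (θ i - θ₀ i) := by
    simp [Matrix.mulVec, dotProduct]
  have h7 : |∑ i, (avg (fun k : Fin p.1 => a i (X k p.2)) - gradMatrix g P₀ θ₀ i j) *
      (θ i - θ₀ i)| ≤ ε / 2 * ‖θ - θ₀‖ := by
    calc _ ≤ ∑ _i : Fin d, ε / (2 * (d + 1)) * ‖θ - θ₀‖ := by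
          refine (Finset.abs_sum_le_sum_abs _ _).trans (Finset.sum_le_sum fun i _ => ?_)
          rw [abs_mul]
          exact mul_le_mul (hp2 i).le (norm_le_pi_norm (θ - θ₀) i) (abs_nonneg _) (by positivity)
      _ = d / (d + 1) * (ε / 2 * ‖θ - θ₀‖) := by
          simp only [Finset.sum_const, Finset.card_univ, Fintype.card_fin, nsmul_eq_mul]
          field_simp
      _ ≤ 1 * (ε / 2 * ‖θ - θ₀‖) := by
          gcongr
          rw [div_le_one (by positivity)]
          linarith
      _ = _ := one_mul _
  have h8 : |avg (fun k : Fin p.1 => F (X k p.2) ⟨θ, hθ⟩) * ‖θ - θ₀‖| ≤ ε / 2 * ‖θ - θ₀‖ := by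
    rw [abs_mul, abs_norm]
    gcongr
  rw [h4] at h8
  simp only [sub_mul, Finset.sum_sub_distrib] at h7
  rw [h6]
  rw [abs_le] at h7 h8 ⊢
  constructor <;> linarith [h7.1, h7.2, h8.1, h8.2]

/-- Near the true parameter the sample moments are uniformly approximated by an affine function
with gradient `Gᵀ`. -/
theorem exists_eventually_sampleMoment_sub (h₁ : IsIdentified g Θ P₀ θ₀)
    (h₂ : IsSmooth g Θ P₀ θ₀) (hindep : iIndepFun X μ) (hlaw : ∀ i, HasLaw (X i) P₀ μ)
    {ε : ℝ} (hε : 0 < ε) :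
    ∃ δ > 0, ∀ᶠ p in whp μ, ∀ θ ∈ Θ, dist θ θ₀ < δ →
      ‖sampleMoment g (fun i : Fin p.1 => X i p.2) θ -
        sampleMoment g (fun i : Fin p.1 => X i p.2) θ₀ -
        (gradMatrix g P₀ θ₀)ᵀ *ᵥ (θ - θ₀)‖ ≤ ε * ‖θ - θ₀‖ := by
  choose δ hδ hev using fun j => exists_eventually_sampleMoment_sub_apply h₁ h₂ hindep hlaw j hε
  obtain ⟨r, hr, hrδ⟩ : ∃ r > 0, ∀ j, r ≤ δ j := by
    rcases isEmpty_or_nonempty (Fin l) with hemp | hne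
    · exact ⟨1, one_pos, fun j => (hemp.false j).elim⟩
    · obtain ⟨j₀, h⟩ := Finite.exists_min δ
      exact ⟨δ j₀, hδ j₀, h⟩
  refine ⟨r, hr, ?_⟩
  filter_upwards [eventually_all.2 hev] with p hp θ hθ hd
  refine (pi_norm_le_iff_of_nonneg (by positivity)).2 fun j => ?_
  exact hp j θ hθ (lt_of_lt_of_le hd (hrδ j))

end Derivative

/-! ### The limiting quadratic problem -/

section Projection

variable {d l : ℕ}

/-- The information matrix `G Ω⁻¹ Gᵀ`. -/
noncomputable def infoMatrix (G : Matrix (Fin d) (Fin l) ℝ) (Ω : Matrix (Fin l) (Fin l) ℝ) :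
    Matrix (Fin d) (Fin d) ℝ := G * Ω⁻¹ * Gᵀ

/-- The linear map `z ↦ -(G Ω⁻¹ Gᵀ)⁻¹ G Ω⁻¹ z`, as a matrix: it gives the minimizer `u` of the
quadratic form `Ω⁻¹` at `z + Gᵀ u`. -/
noncomputable def minimizer (G : Matrix (Fin d) (Fin l) ℝ) (Ω : Matrix (Fin l) (Fin l) ℝ) :
    Matrix (Fin d) (Fin l) ℝ := -((infoMatrix G Ω)⁻¹ * G * Ω⁻¹)

/-- The quadratic form `Ω⁻¹`. -/
noncomputable def quad (Ω : Matrix (Fin l) (Fin l) ℝ) (w : Fin l → ℝ) : ℝ := w ⬝ᵥ Ω⁻¹ *ᵥ w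

/-- The residual `z + Gᵀ u` at the minimizer. -/
noncomputable def residual (G : Matrix (Fin d) (Fin l) ℝ) (Ω : Matrix (Fin l) (Fin l) ℝ)
    (z : Fin l → ℝ) : Fin l → ℝ := z + Gᵀ *ᵥ (minimizer G Ω *ᵥ z)

variable {G : Matrix (Fin d) (Fin l) ℝ} {Ω : Matrix (Fin l) (Fin l) ℝ}

lemma posDef_infoMatrix (hΩ : Ω.PosDef) (hG : G.rank = d) : (infoMatrix G Ω).PosDef := by
  have hinj : Function.Injective G.vecMul := by
    rw [Matrix.vecMul_injective_iff, linearIndependent_iff_card_eq_finrank_span, Fintype.card_fin,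
      Set.finrank, ← Matrix.rank_eq_finrank_span_row, hG]
  have := hΩ.inv.mul_mul_conjTranspose_same (B := G) hinj
  rwa [Matrix.conjTranspose_eq_transpose_of_trivial] at this

lemma isUnit_det_infoMatrix (hΩ : Ω.PosDef) (hG : G.rank = d) : IsUnit (infoMatrix G Ω).det :=
  (Matrix.isUnit_iff_isUnit_det _).1 (posDef_infoMatrix hΩ hG).isUnit

lemma minimizer_mulVec_transpose (hΩ : Ω.PosDef) (hG : G.rank = d) (u : Fin d → ℝ) :
    minimizer G Ω *ᵥ (Gᵀ *ᵥ u) = -u := by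
  rw [Matrix.mulVec_mulVec, minimizer, Matrix.neg_mul, Matrix.mul_assoc, Matrix.mul_assoc,
    ← Matrix.mul_assoc G, ← infoMatrix, Matrix.nonsing_inv_mul _ (isUnit_det_infoMatrix hΩ hG),
    Matrix.neg_mulVec, Matrix.one_mulVec]

/-- The normal equations. -/
lemma mulVec_residual (hΩ : Ω.PosDef) (hG : G.rank = d) (z : Fin l → ℝ) :
    G *ᵥ (Ω⁻¹ *ᵥ residual G Ω z) = 0 := by
  have h : G * Ω⁻¹ * Gᵀ * ((infoMatrix G Ω)⁻¹ * G * Ω⁻¹) = G * Ω⁻¹ := by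
    rw [← infoMatrix, ← Matrix.mul_assoc, ← Matrix.mul_assoc,
      Matrix.mul_nonsing_inv _ (isUnit_det_infoMatrix hΩ hG), Matrix.one_mul]
  rw [residual, Matrix.mulVec_add, Matrix.mulVec_add, Matrix.mulVec_mulVec, Matrix.mulVec_mulVec,
    Matrix.mulVec_mulVec, Matrix.mulVec_mulVec, minimizer, Matrix.mul_neg, Matrix.neg_mulVec]
  simp only [Matrix.mul_assoc] at h ⊢
  rw [h, add_neg_cancel]

lemma transpose_inv_eq (hΩ : Ω.PosDef) : (Ω⁻¹)ᵀ = Ω⁻¹ := by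
  simpa using hΩ.inv.isHermitian.eq

lemma quad_add (hΩ : Ω.PosDef) (a b : Fin l → ℝ) :
    quad Ω (a + b) = quad Ω a + 2 * (b ⬝ᵥ Ω⁻¹ *ᵥ a) + quad Ω b := by
  have h : a ⬝ᵥ Ω⁻¹ *ᵥ b = b ⬝ᵥ Ω⁻¹ *ᵥ a := by
    rw [Matrix.dotProduct_mulVec, ← Matrix.mulVec_transpose, transpose_inv_eq hΩ, dotProduct_comm]
  simp only [quad, Matrix.mulVec_add, dotProduct_add, add_dotProduct, h]
  ring

lemma quad_transpose (u : Fin d → ℝ) : quad Ω (Gᵀ *ᵥ u) = u ⬝ᵥ infoMatrix G Ω *ᵥ u := by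
  rw [quad, infoMatrix, Matrix.mulVec_mulVec, Matrix.mulVec_transpose, ← Matrix.dotProduct_mulVec,
    Matrix.mulVec_mulVec, Matrix.mul_assoc]

/-- Pythagoras' theorem for the quadratic form `Ω⁻¹`. -/
lemma quad_add_transpose (hΩ : Ω.PosDef) (hG : G.rank = d) (z : Fin l → ℝ) (u : Fin d → ℝ) :
    quad Ω (z + Gᵀ *ᵥ u) = quad Ω (residual G Ω z) +
      (u - minimizer G Ω *ᵥ z) ⬝ᵥ infoMatrix G Ω *ᵥ (u - minimizer G Ω *ᵥ z) := by
  have h : z + Gᵀ *ᵥ u = residual G Ω z + Gᵀ *ᵥ (u - minimizer G Ω *ᵥ z) := by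
    rw [residual, Matrix.mulVec_sub]; abel
  rw [h, quad_add hΩ, quad_transpose, Matrix.mulVec_transpose, ← Matrix.dotProduct_mulVec,
    mulVec_residual hΩ hG, dotProduct_zero, mul_zero, add_zero]

lemma quad_residual_le (hΩ : Ω.PosDef) (hG : G.rank = d) (z : Fin l → ℝ) :
    quad Ω (residual G Ω z) ≤ quad Ω z := by
  have h := quad_add_transpose hΩ hG z 0
  have h1 := (posDef_infoMatrix hΩ hG).posSemidef.dotProduct_mulVec_nonneg
    (0 - minimizer G Ω *ᵥ z)
  rw [Matrix.mulVec_zero, add_zero] at h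
  rw [star_trivial] at h1
  linarith

/-- The quadratic form is uniformly continuous on bounded sets. -/
lemma exists_abs_quad_sub_le (hΩ : Ω.PosDef) {K ε : ℝ} (hK : 0 ≤ K) (hε : 0 < ε) :
    ∃ r > 0, ∀ a b, ‖a‖ ≤ K → ‖b‖ ≤ r → |quad Ω (a + b) - quad Ω a| ≤ ε := by
  obtain ⟨C, hC, hCle⟩ := exists_norm_mulVec_le Ω⁻¹
  refine ⟨min 1 (ε / (l * C * (2 * K + 1) + 1)), lt_min one_pos (by positivity),
    fun a b ha hb => ?_⟩
  have hb1 : ‖b‖ ≤ 1 := hb.trans (min_le_left _ _)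
  have hb2 := hb.trans (min_le_right _ _)
  rw [le_div_iff₀ (by positivity)] at hb2
  have hdot : ∀ v, |b ⬝ᵥ Ω⁻¹ *ᵥ v| ≤ l * ‖b‖ * (C * ‖v‖) := fun v =>
    (abs_dotProduct_le _ _).trans (by gcongr; exact hCle v)
  have h1 : |b ⬝ᵥ Ω⁻¹ *ᵥ a| ≤ l * ‖b‖ * (C * K) := (hdot a).trans (by gcongr)
  have h2 : |quad Ω b| ≤ l * ‖b‖ * (C * 1) := (hdot b).trans (by gcongr)
  rw [quad_add hΩ]
  rw [abs_le] at h1 h2 ⊢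
  constructor <;> linarith [h1.1, h1.2, h2.1, h2.2, norm_nonneg b]

end Projection

/-! ### The expansion of the estimated divergence -/

section Expansion

lemma coe_mul_le_coe_mul_iff {c a : ℝ} (hc : 0 < c) {D : EReal} :
    ((c * a : ℝ) : EReal) ≤ (c : EReal) * D ↔ (a : EReal) ≤ D := by
  constructor
  · intro h
    have h1 := mul_le_mul_of_nonneg_left h (EReal.coe_nonneg.2 (inv_nonneg.2 hc.le))
    rwa [← EReal.coe_mul, ← mul_assoc, inv_mul_cancel₀ hc.ne', one_mul, ← mul_assoc,
      ← EReal.coe_mul, inv_mul_cancel₀ hc.ne', EReal.coe_one, one_mul] at h1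
  · intro h
    rw [EReal.coe_mul]
    exact mul_le_mul_of_nonneg_left h (EReal.coe_nonneg.2 hc.le)

variable {m d l : ℕ} {φ : ℝ → ℝ≥0∞} {g : (Fin m → ℝ) → (Fin d → ℝ) → Fin l → ℝ}
  {Θ : Set (Fin d → ℝ)} {P₀ : Measure (Fin m → ℝ)} [IsProbabilityMeasure P₀] {θ₀ : Fin d → ℝ}
  {S : Type*} [MeasurableSpace S] {μ : Measure S} [IsProbabilityMeasure μ] {X : ℕ → S → Fin m → ℝ}

/-- The normalized sample moment `√n ĝ(θ₀)` at the true parameter. -/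
noncomputable def score (g : (Fin m → ℝ) → (Fin d → ℝ) → Fin l → ℝ) (θ₀ : Fin d → ℝ)
    (X : ℕ → S → Fin m → ℝ) (p : ℕ × S) : Fin l → ℝ :=
  √(p.1 : ℝ) • sampleMoment g (fun i : Fin p.1 => X i p.2) θ₀

/-- On bounded sets, `2 n` times the estimated divergence at `θ₀ + u / √n` is approximately the
quadratic form `Ω⁻¹` at `z + Gᵀ u`. -/
theorem eventually_divAt_expansion (hφ : IsDivergenceFunction φ) (h₁ : IsIdentified g Θ P₀ θ₀)
    (h₂ : IsSmooth g Θ P₀ θ₀) (hindep : iIndepFun X μ) (hlaw : ∀ i, HasLaw (X i) P₀ μ)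
    {K M ε : ℝ} (hK : 0 ≤ K) (hM : 0 ≤ M) (hε : 0 < ε) :
    ∀ᶠ p in whp μ, ‖score g θ₀ X p‖ ≤ K → ∀ θ ∈ Θ, ‖√(p.1 : ℝ) • (θ - θ₀)‖ ≤ M →
      ((quad (momentMatrix g P₀ θ₀) (score g θ₀ X p + (gradMatrix g P₀ θ₀)ᵀ *ᵥ
        (√(p.1 : ℝ) • (θ - θ₀))) - ε : ℝ) : EReal) ≤
        ((2 * p.1 : ℝ) : EReal) * divAt φ g (fun i : Fin p.1 => X i p.2) θ ∧
      ((2 * p.1 : ℝ) : EReal) * divAt φ g (fun i : Fin p.1 => X i p.2) θ ≤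
        ((quad (momentMatrix g P₀ θ₀) (score g θ₀ X p + (gradMatrix g P₀ θ₀)ᵀ *ᵥ
          (√(p.1 : ℝ) • (θ - θ₀))) + ε : ℝ) : EReal) := by
  have hΩ := h₁.posDef
  set Ω := momentMatrix g P₀ θ₀
  set G := gradMatrix g P₀ θ₀
  obtain ⟨C, hC, hCle⟩ := exists_norm_mulVec_le Gᵀ
  obtain ⟨r, hr, hquad⟩ := exists_abs_quad_sub_le hΩ (K := K + C * M) (by positivity) (half_pos hε)
  obtain ⟨e, he, hsand⟩ := divAt_sandwich (m := m) (d := d) hφ hΩ (K := K + C * M + r)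
    (by positivity) (half_pos hε)
  obtain ⟨δ₁, hδ₁, hev₁⟩ := exists_eventually_sampleMoment_sub h₁ h₂ hindep hlaw
    (ε := r / (M + 1)) (by positivity)
  obtain ⟨δ₂, hδ₂, hev₂⟩ := h₁.exists_eventually_sampleSq hindep hlaw he
  have hsqrt : Tendsto (fun n : ℕ => √(n : ℝ)) atTop atTop :=
    Real.tendsto_sqrt_atTop.comp tendsto_natCast_atTop_atTop
  filter_upwards [hev₁, hev₂, h₁.eventually_norm_le hlaw he,
    eventually_whp_of_eventually (eventually_ne_atTop 0),
    eventually_whp_of_eventually (hsqrt.eventually_gt_atTop (M / δ₁)),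
    eventually_whp_of_eventually (hsqrt.eventually_gt_atTop (M / δ₂)),
    eventually_whp_of_eventually (hsqrt.eventually_ge_atTop e⁻¹)]
    with p hder hsq hbd hn hn₁ hn₂ hne hz θ hθ hu
  have hs0 : 0 < √(p.1 : ℝ) := Real.sqrt_pos.2 (by positivity)
  have hdist : √(p.1 : ℝ) * dist θ θ₀ ≤ M := by
    rwa [norm_smul, Real.norm_of_nonneg hs0.le, ← dist_eq_norm] at hu
  have hd₁ : dist θ θ₀ < δ₁ := by
    rw [div_lt_iff₀ hδ₁] at hn₁
    exact lt_of_mul_lt_mul_left (hdist.trans_lt hn₁) hs0.le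
  have hd₂ : dist θ θ₀ < δ₂ := by
    rw [div_lt_iff₀ hδ₂] at hn₂
    exact lt_of_mul_lt_mul_left (hdist.trans_lt hn₂) hs0.le
  set x := fun i : Fin p.1 => X i p.2
  set u := √(p.1 : ℝ) • (θ - θ₀) with hudef
  set z := score g θ₀ X p with hzdef
  set w := √(p.1 : ℝ) • sampleMoment g x θ with hw
  set R := w - (z + Gᵀ *ᵥ u) with hR
  have hRle : ‖R‖ ≤ r := by
    have h3 : R = √(p.1 : ℝ) • (sampleMoment g x θ - sampleMoment g x θ₀ - Gᵀ *ᵥ (θ - θ₀)) := by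
      rw [hR, hw, hzdef, hudef, score, Matrix.mulVec_smul, smul_sub, smul_sub, sub_add_eq_sub_sub]
    have h4 : ‖R‖ ≤ r / (M + 1) * ‖u‖ := by
      rw [h3, hudef, norm_smul, norm_smul, Real.norm_of_nonneg hs0.le]
      calc _ ≤ √(p.1 : ℝ) * (r / (M + 1) * ‖θ - θ₀‖) := by gcongr; exact hder θ hθ hd₁
        _ = _ := by ring
    calc ‖R‖ ≤ r / (M + 1) * ‖u‖ := h4
      _ ≤ r / (M + 1) * (M + 1) := by gcongr; linarith
      _ = r := div_mul_cancel₀ _ (by positivity)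
  have ha : ‖z + Gᵀ *ᵥ u‖ ≤ K + C * M :=
    (norm_add_le _ _).trans (add_le_add hz ((hCle u).trans (by gcongr)))
  have hwR : w = z + Gᵀ *ᵥ u + R := by rw [hR]; abel
  have hwK : ‖w‖ ≤ K + C * M + r := by
    rw [hwR]; exact (norm_add_le _ _).trans (add_le_add ha hRle)
  have hq := abs_le.1 (hquad _ _ ha hRle)
  rw [← hwR] at hq
  have hinv : (√(p.1 : ℝ))⁻¹ ≤ e := inv_le_of_inv_le₀ he hne
  obtain ⟨hlo, hup⟩ := hsand g p.1 x θ w hn hinv (hbd θ hθ) rfl hwK (hsq θ hθ hd₂)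
  refine ⟨le_trans (EReal.coe_le_coe_iff.2 ?_) hlo, hup.trans (EReal.coe_le_coe_iff.2 ?_)⟩
  · change quad Ω (z + Gᵀ *ᵥ u) - ε ≤ quad Ω w - ε / 2
    linarith
  · change quad Ω w + ε / 2 ≤ quad Ω (z + Gᵀ *ᵥ u) + ε
    linarith

/-- Parameters at which the estimated divergence is of order `1 / n` are within a distance of order
`1 / √n` from the true parameter. -/
theorem exists_eventually_norm_le (hφ : IsDivergenceFunction φ) (h₁ : IsIdentified g Θ P₀ θ₀)
    (h₂ : IsSmooth g Θ P₀ θ₀) (hindep : iIndepFun X μ) (hlaw : ∀ i, HasLaw (X i) P₀ μ)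
    {K L : ℝ} (hK : 0 ≤ K) (hL : 0 ≤ L) :
    ∃ M : ℝ, 0 ≤ M ∧ ∀ᶠ p in whp μ, ‖score g θ₀ X p‖ ≤ K → ∀ θ ∈ Θ,
      ((2 * p.1 : ℝ) : EReal) * divAt φ g (fun i : Fin p.1 => X i p.2) θ ≤ (L : EReal) →
      ‖√(p.1 : ℝ) • (θ - θ₀)‖ ≤ M := by
  have hΩ := h₁.posDef
  have hG := h₂.rank_eq
  set Ω := momentMatrix g P₀ θ₀
  set G := gradMatrix g P₀ θ₀
  obtain ⟨C, hC, hCle⟩ := exists_norm_mulVec_le (minimizer G Ω)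
  obtain ⟨e, he, hrate⟩ := sqrt_mul_abs_sampleMoment_sub_le (m := m) (d := d) (l := l) hφ
  obtain ⟨B, hB, hevB⟩ := h₁.exists_eventually_avg_sq_le hindep hlaw
  obtain ⟨δ, hδ, hev₁⟩ := exists_eventually_sampleMoment_sub h₁ h₂ hindep hlaw
    (ε := 1 / (2 * (C + 1))) (by positivity)
  obtain ⟨η, hη, hev₂⟩ := h₁.exists_eventually_le_norm_sampleMoment hindep hlaw hδ
  have hsqrt : Tendsto (fun n : ℕ => √(n : ℝ)) atTop atTop :=
    Real.tendsto_sqrt_atTop.comp tendsto_natCast_atTop_atTop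
  refine ⟨2 * C * (L / 2 + B + K), by positivity, ?_⟩
  filter_upwards [hevB, hev₁, hev₂, h₁.eventually_norm_le hlaw he,
    eventually_whp_of_eventually (eventually_ne_atTop 0),
    eventually_whp_of_eventually (hsqrt.eventually_gt_atTop ((L / 2 + B) / η))]
    with p hsq hder hcons hbd hn hnη hz θ hθ hD
  have hs0 : 0 < √(p.1 : ℝ) := Real.sqrt_pos.2 (by positivity)
  set x := fun i : Fin p.1 => X i p.2
  have hw : ‖√(p.1 : ℝ) • sampleMoment g x θ‖ ≤ L / 2 + B := by
    refine (pi_norm_le_iff_of_nonneg (by positivity)).2 fun j => ?_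
    have h3 := EReal.coe_le_coe_iff.1 ((hrate g p.1 x θ B hn (hbd θ hθ) j (hsq θ hθ j)).trans hD)
    rw [Pi.smul_apply, norm_smul, Real.norm_of_nonneg hs0.le, Real.norm_eq_abs]
    linarith
  -- consistency: a sample moment of order `1 / √n` excludes parameters away from `θ₀`
  have hd : dist θ θ₀ < δ := by
    by_contra! hcon
    have h3 := hcons θ hθ hcon
    rw [norm_smul, Real.norm_of_nonneg hs0.le] at hw
    rw [div_lt_iff₀ hη] at hnη
    have h4 : √(p.1 : ℝ) * η ≤ √(p.1 : ℝ) * ‖sampleMoment g x θ‖ := by gcongr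
    linarith
  set u := √(p.1 : ℝ) • (θ - θ₀) with hudef
  have hGu : ‖Gᵀ *ᵥ u‖ ≤ L / 2 + B + K + 1 / (2 * (C + 1)) * ‖u‖ := by
    have h3 : Gᵀ *ᵥ u = √(p.1 : ℝ) • sampleMoment g x θ - score g θ₀ X p -
        √(p.1 : ℝ) • (sampleMoment g x θ - sampleMoment g x θ₀ - Gᵀ *ᵥ (θ - θ₀)) := by
      rw [hudef, score, Matrix.mulVec_smul, smul_sub, smul_sub, sub_sub_cancel]
    have h4 : ‖√(p.1 : ℝ) • (sampleMoment g x θ - sampleMoment g x θ₀ - Gᵀ *ᵥ (θ - θ₀))‖ ≤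
        1 / (2 * (C + 1)) * ‖u‖ := by
      rw [hudef, norm_smul, norm_smul, Real.norm_of_nonneg hs0.le]
      calc _ ≤ √(p.1 : ℝ) * (1 / (2 * (C + 1)) * ‖θ - θ₀‖) := by gcongr; exact hder θ hθ hd
        _ = _ := by ring
    rw [h3]
    exact (norm_sub_le _ _).trans (add_le_add ((norm_sub_le _ _).trans (add_le_add hw hz)) h4)
  have hu : ‖u‖ ≤ C * ‖Gᵀ *ᵥ u‖ := by
    have := hCle (Gᵀ *ᵥ u)
    rwa [minimizer_mulVec_transpose hΩ hG, norm_neg] at this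
  have h5 : C * (1 / (2 * (C + 1)) * ‖u‖) ≤ 1 / 2 * ‖u‖ := by
    rw [← mul_assoc]
    gcongr
    rw [mul_one_div, div_le_div_iff₀ (by positivity) (by norm_num)]
    linarith
  have h6 : C * ‖Gᵀ *ᵥ u‖ ≤ C * (L / 2 + B + K + 1 / (2 * (C + 1)) * ‖u‖) := by gcongr
  linarith

/-- On events on which the score is bounded, `2 n` times the estimated divergence of the model is
approximately the minimum of the limiting quadratic problem, and the estimate is approximately the
minimizer. -/
theorem eventually_expansion (hφ : IsDivergenceFunction φ) (h₁ : IsIdentified g Θ P₀ θ₀)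
    (h₂ : IsSmooth g Θ P₀ θ₀) (hindep : iIndepFun X μ) (hlaw : ∀ i, HasLaw (X i) P₀ μ)
    (K : ℝ) {ε : ℝ} (hε : 0 < ε) :
    ∀ᶠ p in whp μ, ‖score g θ₀ X p‖ ≤ K →
      (((quad (momentMatrix g P₀ θ₀) (residual (gradMatrix g P₀ θ₀) (momentMatrix g P₀ θ₀)
        (score g θ₀ X p)) - ε : ℝ) : EReal) ≤
        ((2 * p.1 : ℝ) : EReal) * divModel φ g Θ (fun i : Fin p.1 => X i p.2) ∧
      ((2 * p.1 : ℝ) : EReal) * divModel φ g Θ (fun i : Fin p.1 => X i p.2) ≤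
        ((quad (momentMatrix g P₀ θ₀) (residual (gradMatrix g P₀ θ₀) (momentMatrix g P₀ θ₀)
          (score g θ₀ X p)) + ε : ℝ) : EReal)) ∧
      ∀ θ, IsMinDivEstimate φ g Θ (fun i : Fin p.1 => X i p.2) θ →
        ‖√(p.1 : ℝ) • (θ - θ₀) -
          minimizer (gradMatrix g P₀ θ₀) (momentMatrix g P₀ θ₀) *ᵥ score g θ₀ X p‖ ≤ ε := by
  wlog hK : 0 ≤ K
  · refine Eventually.of_forall fun p hp => ?_
    exact absurd ((norm_nonneg _).trans hp) hK
  have hΩ := h₁.posDef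
  have hG := h₂.rank_eq
  set Ω := momentMatrix g P₀ θ₀
  set G := gradMatrix g P₀ θ₀
  obtain ⟨c, hc, hlow⟩ := exists_le_dotProduct_mulVec (posDef_infoMatrix hΩ hG)
  obtain ⟨C₁, hC₁, hquad⟩ := exists_dotProduct_mulVec_le Ω⁻¹
  obtain ⟨C, hC, hCle⟩ := exists_norm_mulVec_le (minimizer G Ω)
  obtain ⟨ρ, hρ, hball, -⟩ := h₂.exists_ball
  -- an excess of `2 e` over the minimum forces a distance at most `ε` from the minimizer
  set e := min ε (c * ε ^ 2 / 2) with he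
  have he0 : 0 < e := by positivity
  obtain ⟨M, hM, hev₁⟩ := exists_eventually_norm_le hφ h₁ h₂ hindep hlaw hK
    (L := C₁ * K ^ 2 + e) (by positivity)
  have hsqrt : Tendsto (fun n : ℕ => √(n : ℝ)) atTop atTop :=
    Real.tendsto_sqrt_atTop.comp tendsto_natCast_atTop_atTop
  filter_upwards [hev₁, eventually_divAt_expansion hφ h₁ h₂ hindep hlaw hK hM he0,
    eventually_divAt_expansion hφ h₁ h₂ hindep hlaw hK (M := C * K) (by positivity) he0,
    eventually_whp_of_eventually (eventually_ne_atTop 0),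
    eventually_whp_of_eventually (hsqrt.eventually_gt_atTop (C * K / ρ))]
    with p hrate hexp hexp' hn hnρ hz
  have hnpos : (0 : ℝ) < 2 * p.1 := by positivity
  have hs0 : 0 < √(p.1 : ℝ) := Real.sqrt_pos.2 (by positivity)
  replace hrate := hrate hz
  replace hexp := hexp hz
  replace hexp' := hexp' hz
  set x := fun i : Fin p.1 => X i p.2
  set z := score g θ₀ X p with hzdef
  set Q := quad Ω (residual G Ω z) with hQ
  have hQL : Q ≤ C₁ * K ^ 2 :=
    (quad_residual_le hΩ hG z).trans ((hquad z).trans (by gcongr))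
  -- the parameter which corresponds to the minimizer of the quadratic problem
  set us := minimizer G Ω *ᵥ z with hus
  have husle : ‖us‖ ≤ C * K := (hCle z).trans (by gcongr)
  set θs := θ₀ + (√(p.1 : ℝ))⁻¹ • us with hθs
  have hsub : √(p.1 : ℝ) • (θs - θ₀) = us := by
    rw [hθs, add_sub_cancel_left, smul_smul, mul_inv_cancel₀ hs0.ne', one_smul]
  have hθsΘ : θs ∈ Θ := by
    refine hball ?_
    rw [Metric.mem_ball, dist_eq_norm, hθs, add_sub_cancel_left, norm_smul, norm_inv,
      Real.norm_of_nonneg hs0.le, inv_mul_lt_iff₀ hs0]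
    rw [div_lt_iff₀ hρ] at hnρ
    exact husle.trans_lt hnρ
  have hup : ((2 * p.1 : ℝ) : EReal) * divModel φ g Θ x ≤ ((Q + e : ℝ) : EReal) := by
    have h3 := (hexp' θs hθsΘ (by rw [hsub]; exact husle)).2
    rw [hsub] at h3
    refine le_trans ?_ h3
    exact mul_le_mul_of_nonneg_left (iInf₂_le θs hθsΘ) (EReal.coe_nonneg.2 hnpos.le)
  have hlocal : ∀ θ ∈ Θ, ((2 * p.1 : ℝ) : EReal) * divAt φ g x θ ≤ ((Q + e : ℝ) : EReal) →
      ((Q + c * ‖√(p.1 : ℝ) • (θ - θ₀) - us‖ ^ 2 - e : ℝ) : EReal) ≤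
        ((2 * p.1 : ℝ) : EReal) * divAt φ g x θ := by
    intro θ hθ hD
    have h3 := hrate θ hθ (hD.trans (EReal.coe_le_coe_iff.2 (by linarith)))
    refine le_trans (EReal.coe_le_coe_iff.2 ?_) (hexp θ hθ h3).1
    rw [quad_add_transpose hΩ hG]
    have h4 := hlow (√(p.1 : ℝ) • (θ - θ₀) - us)
    linarith
  refine ⟨⟨?_, hup.trans (EReal.coe_le_coe_iff.2 (by linarith [min_le_left ε (c * ε ^ 2 / 2)]))⟩,
    fun θ hθ => ?_⟩
  · have h3 : ∀ θ ∈ Θ, (((Q - e) / (2 * p.1) : ℝ) : EReal) ≤ divAt φ g x θ := fun θ hθ => by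
      rw [← coe_mul_le_coe_mul_iff hnpos, mul_div_cancel₀ _ hnpos.ne']
      rcases le_total (((2 * p.1 : ℝ) : EReal) * divAt φ g x θ) ((Q + e : ℝ) : EReal) with h4 | h4
      · refine le_trans (EReal.coe_le_coe_iff.2 ?_) (hlocal θ hθ h4)
        have : 0 ≤ c * ‖√(p.1 : ℝ) • (θ - θ₀) - us‖ ^ 2 := by positivity
        linarith
      · exact le_trans (EReal.coe_le_coe_iff.2 (by linarith)) h4
    have h4 : (((Q - e) / (2 * p.1) : ℝ) : EReal) ≤ divModel φ g Θ x := le_iInf₂ h3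
    rw [← coe_mul_le_coe_mul_iff hnpos, mul_div_cancel₀ _ hnpos.ne'] at h4
    exact le_trans (EReal.coe_le_coe_iff.2 (by linarith [min_le_left ε (c * ε ^ 2 / 2)])) h4
  · have h3 : ((2 * p.1 : ℝ) : EReal) * divAt φ g x θ ≤ ((Q + e : ℝ) : EReal) := by
      rw [hθ.2]; exact hup
    have h4 := EReal.coe_le_coe_iff.1 ((hlocal θ hθ.1 h3).trans h3)
    have h5 : c * ‖√(p.1 : ℝ) • (θ - θ₀) - us‖ ^ 2 ≤ c * ε ^ 2 := by
      linarith [min_le_right ε (c * ε ^ 2 / 2)]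
    exact le_of_sq_le_sq (le_of_mul_le_mul_left h5 hc) hε.le

end Expansion

/-! ### The residual form as a sum of squares -/

section SumOfSquares

open scoped MatrixOrder Matrix.Norms.L2Operator in
/-- A square root of a covariance matrix. -/
lemma exists_eq_transpose_mul_self {l : ℕ} {Ω : Matrix (Fin l) (Fin l) ℝ} (hΩ : Ω.PosSemidef) :
    ∃ B : Matrix (Fin l) (Fin l) ℝ, Ω = Bᵀ * B := by
  obtain ⟨B, hB⟩ := CStarAlgebra.nonneg_iff_eq_star_mul_self.mp hΩ.nonneg
  refine ⟨B, ?_⟩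
  rw [hB, Matrix.star_eq_conjTranspose, Matrix.conjTranspose_eq_transpose_of_trivial]

variable {d l : ℕ} {G : Matrix (Fin d) (Fin l) ℝ} {Ω : Matrix (Fin l) (Fin l) ℝ}

/-- The minimum of the quadratic problem is a sum of `l - d` squares of linear forms, which are
uncorrelated with unit variance under a law with covariance matrix `Ω`: their coefficients form an
`Ω`-orthonormal basis of the kernel of `G`. -/
theorem exists_quad_residual_eq_sum_sq (hΩ : Ω.PosDef) (hG : G.rank = d) :
    ∃ b : Fin (l - d) → Fin l → ℝ, (∀ i k, b i ⬝ᵥ Ω *ᵥ b k = if i = k then 1 else 0) ∧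
      ∀ z, quad Ω (residual G Ω z) = ∑ i, (b i ⬝ᵥ z) ^ 2 := by
  obtain ⟨B, hB⟩ := exists_eq_transpose_mul_self hΩ.posSemidef
  have hΩu : IsUnit Ω.det := (Matrix.isUnit_iff_isUnit_det _).1 hΩ.isUnit
  have hBu : IsUnit B.det := by
    rw [hB, Matrix.det_mul, Matrix.det_transpose] at hΩu
    exact isUnit_of_mul_isUnit_left hΩu
  have hΩv : ∀ u v : Fin l → ℝ, u ⬝ᵥ Ω *ᵥ v = (B *ᵥ u) ⬝ᵥ (B *ᵥ v) := fun u v => by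
    rw [hB, ← Matrix.mulVec_mulVec, Matrix.dotProduct_mulVec, Matrix.vecMul_transpose]
  have hBinv : ∀ v : Fin l → ℝ, B *ᵥ (B⁻¹ *ᵥ v) = v := fun v => by
    rw [Matrix.mulVec_mulVec, Matrix.mul_nonsing_inv _ hBu, Matrix.one_mulVec]
  let f : EuclideanSpace ℝ (Fin l) →ₗ[ℝ] Fin d → ℝ :=
    (G * B⁻¹).mulVecLin ∘ₗ (WithLp.linearEquiv 2 ℝ (Fin l → ℝ)).toLinearMap
  have hf : ∀ y, f y = (G * B⁻¹) *ᵥ WithLp.ofLp y := fun y => rfl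
  have hrank : Module.finrank ℝ (LinearMap.ker f) = l - d := by
    have h1 := LinearMap.finrank_range_add_finrank_ker f
    have h2 : Module.finrank ℝ (LinearMap.range f) = d := by
      rw [LinearMap.range_comp_of_range_eq_top _ (LinearEquiv.range _)]
      have : (G * B⁻¹).rank = d := by
        rw [Matrix.rank_mul_eq_left_of_isUnit_det _ _ (Matrix.isUnit_nonsing_inv_det _ hBu), hG]
      exact this
    rw [h2, finrank_euclideanSpace, Fintype.card_fin] at h1
    omega
  let o : OrthonormalBasis (Fin (l - d)) ℝ (LinearMap.ker f) :=
    (stdOrthonormalBasis ℝ (LinearMap.ker f)).reindex (finCongr hrank)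
  have hinner : ∀ u v : EuclideanSpace ℝ (Fin l), inner ℝ u v =
      WithLp.ofLp u ⬝ᵥ WithLp.ofLp v := fun u v => by
    rw [EuclideanSpace.inner_eq_star_dotProduct, star_trivial, dotProduct_comm]
  let b : Fin (l - d) → Fin l → ℝ := fun i => B⁻¹ *ᵥ WithLp.ofLp (o i : EuclideanSpace ℝ (Fin l))
  have hGb : ∀ i, G *ᵥ b i = 0 := fun i => by
    have := (o i).2
    rw [LinearMap.mem_ker, hf, ← Matrix.mulVec_mulVec] at this
    exact this
  refine ⟨b, fun i k => ?_, fun z => ?_⟩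
  · rw [hΩv, hBinv, hBinv, ← hinner, ← Submodule.coe_inner]
    exact orthonormal_iff_ite.1 o.orthonormal i k
  · set e := residual G Ω z with he
    set v := Ω⁻¹ *ᵥ e with hv
    have hΩve : Ω *ᵥ v = e := by
      rw [hv, Matrix.mulVec_mulVec, Matrix.mul_nonsing_inv _ hΩu, Matrix.one_mulVec]
    have hmem : WithLp.toLp 2 (B *ᵥ v) ∈ LinearMap.ker f := by
      rw [LinearMap.mem_ker, hf]
      change (G * B⁻¹) *ᵥ (B *ᵥ v) = 0
      rw [Matrix.mulVec_mulVec, Matrix.mul_assoc, Matrix.nonsing_inv_mul _ hBu, Matrix.mul_one, hv,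
        he, mulVec_residual hΩ hG]
    have h1 := o.sum_sq_inner_right ⟨_, hmem⟩
    have h2 : ‖(⟨_, hmem⟩ : LinearMap.ker f)‖ ^ 2 = quad Ω e := by
      rw [← real_inner_self_eq_norm_sq, Submodule.coe_inner, hinner]
      change (B *ᵥ v) ⬝ᵥ (B *ᵥ v) = quad Ω e
      rw [← hΩv, hΩve, quad, ← hv, dotProduct_comm]
    rw [← h2, ← h1]
    refine Finset.sum_congr rfl fun i _ => ?_
    congr 1
    rw [Submodule.coe_inner, hinner]
    have h3 : WithLp.ofLp (o i : EuclideanSpace ℝ (Fin l)) = B *ᵥ b i := (hBinv _).symm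
    rw [h3, ← hΩv, hΩve, he, residual, dotProduct_add, Matrix.dotProduct_mulVec,
      Matrix.vecMul_transpose, hGb, zero_dotProduct, add_zero]

end SumOfSquares

/-! ### Gaussian limit laws -/

section Gaussian

variable {d l : ℕ} {Ω : Matrix (Fin l) (Fin l) ℝ}

/-- The characteristic function of a linear image of a centered Gaussian vector. -/
lemma charFun_map_mulVec (hΩ : Ω.PosSemidef) (A : Matrix (Fin d) (Fin l) ℝ)
    (t : EuclideanSpace ℝ (Fin d)) :
    charFun ((multivariateGaussian 0 Ω).map fun z : EuclideanSpace ℝ (Fin l) =>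
        WithLp.toLp 2 (A *ᵥ WithLp.ofLp z)) t =
      Complex.exp (-(WithLp.ofLp t ⬝ᵥ (A * Ω * Aᵀ) *ᵥ WithLp.ofLp t : ℝ) / 2) := by
  have hcont : Continuous fun z : EuclideanSpace ℝ (Fin l) =>
      (WithLp.toLp 2 (A *ᵥ WithLp.ofLp z) : EuclideanSpace ℝ (Fin d)) := by fun_prop
  have h1 : charFun ((multivariateGaussian 0 Ω).map fun z : EuclideanSpace ℝ (Fin l) =>
      (WithLp.toLp 2 (A *ᵥ WithLp.ofLp z) : EuclideanSpace ℝ (Fin d))) t =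
      charFun (multivariateGaussian 0 Ω) (WithLp.toLp 2 (Aᵀ *ᵥ WithLp.ofLp t)) := by
    rw [charFun_apply, charFun_apply, integral_map hcont.aemeasurable (by fun_prop)]
    congr 1
    ext z
    congr 3
    rw [EuclideanSpace.inner_eq_star_dotProduct, EuclideanSpace.inner_eq_star_dotProduct,
      star_trivial, star_trivial, Matrix.dotProduct_mulVec, Matrix.mulVec_transpose]
  rw [h1, charFun_multivariateGaussian hΩ]
  congr 1
  have h2 : (Aᵀ *ᵥ WithLp.ofLp t) ⬝ᵥ Ω *ᵥ (Aᵀ *ᵥ WithLp.ofLp t) =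
      WithLp.ofLp t ⬝ᵥ (A * Ω * Aᵀ) *ᵥ WithLp.ofLp t := by
    rw [← Matrix.mulVec_mulVec, ← Matrix.mulVec_mulVec, Matrix.mulVec_transpose,
      ← Matrix.dotProduct_mulVec, ← Matrix.mulVec_transpose]
  simp only [inner_zero_right, Complex.ofReal_zero, zero_mul, zero_sub, h2]
  ring

lemma map_mulVec_multivariateGaussian (hΩ : Ω.PosSemidef) (A : Matrix (Fin d) (Fin l) ℝ) :
    ((multivariateGaussian 0 Ω).map fun z : EuclideanSpace ℝ (Fin l) =>
      (WithLp.toLp 2 (A *ᵥ WithLp.ofLp z) : EuclideanSpace ℝ (Fin d))) =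
      multivariateGaussian 0 (A * Ω * Aᵀ) := by
  have hcont : Continuous fun z : EuclideanSpace ℝ (Fin l) =>
      (WithLp.toLp 2 (A *ᵥ WithLp.ofLp z) : EuclideanSpace ℝ (Fin d)) := by fun_prop
  have := Measure.isProbabilityMeasure_map (μ := multivariateGaussian 0 Ω) hcont.aemeasurable
  have hpsd : (A * Ω * Aᵀ).PosSemidef := by
    simpa using hΩ.mul_mul_conjTranspose_same A
  refine Measure.ext_of_charFun (funext fun t => ?_)
  rw [charFun_map_mulVec hΩ, charFun_multivariateGaussian hpsd]
  congr 1
  simp only [inner_zero_right, Complex.ofReal_zero, zero_mul, zero_sub]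
  ring

variable {G : Matrix (Fin d) (Fin l) ℝ}

/-- The covariance matrix of `minimizer G Ω *ᵥ z` is `(G Ω⁻¹ Gᵀ)⁻¹` if the one of `z` is `Ω`. -/
lemma minimizer_mul_mul_transpose (hΩ : Ω.PosDef) (hG : G.rank = d) :
    minimizer G Ω * Ω * (minimizer G Ω)ᵀ = (infoMatrix G Ω)⁻¹ := by
  have hΩu : IsUnit Ω.det := (Matrix.isUnit_iff_isUnit_det _).1 hΩ.isUnit
  have hu := isUnit_det_infoMatrix hΩ hG
  have hsymm : ((infoMatrix G Ω)⁻¹)ᵀ = (infoMatrix G Ω)⁻¹ :=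
    transpose_inv_eq (posDef_infoMatrix hΩ hG)
  rw [minimizer, Matrix.transpose_neg, Matrix.mul_neg, Matrix.neg_mul, Matrix.neg_mul, neg_neg,
    Matrix.transpose_mul, Matrix.transpose_mul, transpose_inv_eq hΩ, hsymm,
    Matrix.nonsing_inv_mul_cancel_right _ _ hΩu, ← Matrix.mul_assoc, ← Matrix.mul_assoc,
    Matrix.mul_assoc _ G, Matrix.mul_assoc _ _ Gᵀ, ← infoMatrix, Matrix.nonsing_inv_mul _ hu,
    Matrix.one_mul]

/-- The minimum of the limiting quadratic problem has a chi-square law. -/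
theorem map_quad_residual (hΩ : Ω.PosDef) (hG : G.rank = d) :
    ((multivariateGaussian 0 Ω).map fun z : EuclideanSpace ℝ (Fin l) =>
      quad Ω (residual G Ω (WithLp.ofLp z))) = chiSquare (l - d) := by
  obtain ⟨b, hb, hquad⟩ := exists_quad_residual_eq_sum_sq hΩ hG
  let A : Matrix (Fin (l - d)) (Fin l) ℝ := Matrix.of b
  have hA : A * Ω * Aᵀ = 1 := by
    ext i k
    rw [Matrix.one_apply, ← hb i k, Matrix.mul_assoc]
    rfl
  have h1 : (fun z : EuclideanSpace ℝ (Fin l) => quad Ω (residual G Ω (WithLp.ofLp z))) =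
      (fun y : EuclideanSpace ℝ (Fin (l - d)) => ∑ i, y i ^ 2) ∘
        fun z => WithLp.toLp 2 (A *ᵥ WithLp.ofLp z) := by
    ext z
    rw [hquad]
    rfl
  rw [h1, ← Measure.map_map (by fun_prop) (by fun_prop),
    map_mulVec_multivariateGaussian hΩ.posSemidef, hA, multivariateGaussian_zero_one,
    ← map_pi_eq_stdGaussian, Measure.map_map (by fun_prop) (by fun_prop)]
  rfl

end Gaussian

/-! ### Convergence in distribution and small perturbations -/

section Convergence

variable {S : Type*} [MeasurableSpace S] {μ : Measure S} [IsProbabilityMeasure μ]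

/-- Convergence in distribution depends only on the law of the limit variable. -/
lemma tendstoInDistribution_congr_law {E T T' : Type*} [TopologicalSpace E] [MeasurableSpace E]
    [OpensMeasurableSpace E] [MeasurableSpace T] [MeasurableSpace T'] {ν : Measure T}
    [IsProbabilityMeasure ν] {ν' : Measure T'} [IsProbabilityMeasure ν'] {Z : ℕ → S → E}
    {W : T → E} {W' : T' → E} (h : TendstoInDistribution Z atTop W (fun _ => μ) ν)
    (hW' : AEMeasurable W' ν') (heq : ν.map W = ν'.map W') :
    TendstoInDistribution Z atTop W' (fun _ => μ) ν' where
  forall_aemeasurable := h.forall_aemeasurable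
  aemeasurable_limit := hW'
  tendsto := by
    have h' := h.tendsto
    simp only [heq] at h'
    exact h'

/-- A sequence which converges in distribution is bounded in probability. -/
lemma exists_eventually_measure_norm_le {k : ℕ} {Z : ℕ → S → EuclideanSpace ℝ (Fin k)}
    {ν : Measure (EuclideanSpace ℝ (Fin k))} [IsProbabilityMeasure ν]
    (h : TendstoInDistribution Z atTop id (fun _ => μ) ν) {ε : ℝ≥0∞} (hε : 0 < ε) :
    ∃ K : ℝ, ∀ᶠ n in atTop, μ {ω | K < ‖Z n ω‖} ≤ ε := by
  have htight := isTightMeasureSet_iff_tendsto_measure_norm_gt.1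
    (isTightMeasureSet_singleton (μ := ν))
  simp only [mem_singleton_iff, iSup_iSup_eq_left] at htight
  obtain ⟨K, hK⟩ := (htight.eventually_lt_const hε).exists
  refine ⟨K + 1, ?_⟩
  have hclosed : IsClosed {z : EuclideanSpace ℝ (Fin k) | K + 1 ≤ ‖z‖} :=
    isClosed_le continuous_const continuous_norm
  have hlim := ProbabilityMeasure.limsup_measure_closed_le_of_tendsto h.tendsto hclosed
  simp only [ProbabilityMeasure.coe_mk, Measure.map_id] at hlim
  have hlt : ν {z : EuclideanSpace ℝ (Fin k) | K + 1 ≤ ‖z‖} < ε :=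
    (measure_mono fun z (hz : K + 1 ≤ ‖z‖) => (by simp; linarith : z ∈ {x | K < ‖x‖})).trans_lt hK
  filter_upwards [eventually_lt_of_limsup_lt (hlim.trans_lt hlt)] with n hn
  rw [Measure.map_apply_of_aemeasurable (h.forall_aemeasurable n) hclosed.measurableSet] at hn
  exact (measure_mono fun ω (hω : K + 1 < ‖Z n ω‖) => hω.le).trans hn.le

/-- A statistic which is within every `ε > 0` of a sequence converging in distribution, with
probability tending to one, converges to the same limit. -/
theorem tendstoInLaw_of_forall_eventually {Q : ℕ → S → ℝ} {T : ℕ → S → EReal} {ν : Measure ℝ}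
    [IsProbabilityMeasure ν] (hQ : TendstoInDistribution Q atTop id (fun _ => μ) ν)
    (h : ∀ ε : ℝ, 0 < ε → ∀ᶠ p in whp μ, ((Q p.1 p.2 - ε : ℝ) : EReal) ≤ T p.1 p.2 ∧
      T p.1 p.2 ≤ ((Q p.1 p.2 + ε : ℝ) : EReal)) : TendstoInLaw μ T ν := by
  intro c hc
  have hbad := fun ε hε => eventually_whp.1 (h ε hε)
  refine tendsto_order.2 ⟨fun a ha => ?_, fun b hb => ?_⟩
  -- lower bound: compare with the open half-lines which end before `c`
  · have hIio : ν (Iic c) = ν (Iio c) := by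
      rw [← Iio_union_right]
      exact le_antisymm ((measure_union_le _ _).trans_eq (by rw [hc, add_zero]))
        (measure_mono subset_union_left)
    have hUnion : Iio c = ⋃ k : ℕ, Iio (c - 1 / ((k : ℝ) + 1)) := by
      ext x
      simp only [mem_Iio, mem_iUnion]
      refine ⟨fun hx => ?_, fun ⟨k, hk⟩ => hk.trans (sub_lt_self _ (by positivity))⟩
      obtain ⟨k, hk⟩ := exists_nat_one_div_lt (sub_pos.2 hx)
      exact ⟨k, by linarith⟩
    have hmono : Monotone fun k : ℕ => Iio (c - 1 / ((k : ℝ) + 1)) := fun i j hij =>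
      Iio_subset_Iio (sub_le_sub_left (Nat.one_div_le_one_div hij) c)
    rw [hIio, hUnion, hmono.measure_iUnion] at ha
    obtain ⟨k, hk⟩ := lt_iSup_iff.1 ha
    obtain ⟨a', haa', ha'⟩ := exists_between hk
    have hlim := ProbabilityMeasure.le_liminf_measure_open_of_tendsto hQ.tendsto
      (isOpen_Iio (a := c - 1 / ((k : ℝ) + 1)))
    simp only [ProbabilityMeasure.coe_mk, Measure.map_id] at hlim
    filter_upwards [eventually_lt_of_lt_liminf (ha'.trans_le hlim),
      (hbad _ (Nat.one_div_pos_of_nat (n := k) (α := ℝ))).eventually_le_const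
        (tsub_pos_of_lt haa')] with n hn hn'
    rw [Measure.map_apply_of_aemeasurable (hQ.forall_aemeasurable n) measurableSet_Iio] at hn
    by_contra! hle
    refine absurd (hn.trans_le ((measure_mono ?_).trans
      ((measure_union_le _ _).trans (add_le_add hle hn')))) ?_
    · intro ω hω
      by_cases hω' : ω ∈ {ω | T n ω ≤ (c : EReal)}
      · exact Or.inl hω'
      · refine Or.inr fun hQT => hω' (hQT.2.trans (EReal.coe_le_coe_iff.2 ?_))
        have : Q n ω < c - 1 / ((k : ℝ) + 1) := hω
        linarith
    · rw [add_tsub_cancel_of_le haa'.le]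
      exact lt_irrefl _
  -- upper bound: compare with the closed half-lines which end after `c`
  · have hInter : Iic c = ⋂ k : ℕ, Iic (c + 1 / ((k : ℝ) + 1)) := by
      ext x
      simp only [mem_Iic, mem_iInter]
      refine ⟨fun hx k => hx.trans (le_add_of_nonneg_right (by positivity)), fun hx => ?_⟩
      by_contra! hlt
      obtain ⟨k, hk⟩ := exists_nat_one_div_lt (sub_pos.2 hlt)
      linarith [hx k]
    have hanti : Antitone fun k : ℕ => Iic (c + 1 / ((k : ℝ) + 1)) := fun i j hij =>
      Iic_subset_Iic.2 (add_le_add_right (Nat.one_div_le_one_div hij) c)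
    rw [hInter, hanti.measure_iInter (fun k => measurableSet_Iic.nullMeasurableSet)
      ⟨0, measure_ne_top _ _⟩] at hb
    obtain ⟨k, hk⟩ := iInf_lt_iff.1 hb
    obtain ⟨b', hb', hbb'⟩ := exists_between hk
    have hlim := ProbabilityMeasure.limsup_measure_closed_le_of_tendsto hQ.tendsto
      (isClosed_Iic (a := c + 1 / ((k : ℝ) + 1)))
    simp only [ProbabilityMeasure.coe_mk, Measure.map_id] at hlim
    filter_upwards [eventually_lt_of_limsup_lt (hlim.trans_lt hb'),
      (hbad _ (Nat.one_div_pos_of_nat (n := k) (α := ℝ))).eventually_le_const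
        (tsub_pos_of_lt hbb')] with n hn hn'
    rw [Measure.map_apply_of_aemeasurable (hQ.forall_aemeasurable n) measurableSet_Iic] at hn
    refine (measure_mono (t := Q n ⁻¹' Iic (c + 1 / ((k : ℝ) + 1)) ∪ _) ?_).trans_lt
      ((measure_union_le _ _).trans_lt
        ((ENNReal.add_lt_add_of_lt_of_le (ne_top_of_le_ne_top (measure_ne_top μ univ)
          (measure_mono (subset_univ _))) hn hn').trans_eq (add_tsub_cancel_of_le hbb'.le)))
    intro ω hω
    by_cases hω' : ω ∈ Q n ⁻¹' Iic (c + 1 / ((k : ℝ) + 1))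
    · exact Or.inl hω'
    · refine Or.inr fun hQT => hω' ?_
      have := EReal.coe_le_coe_iff.1 (hQT.1.trans hω)
      simp only [mem_preimage, mem_Iic]
      linarith

end Convergence

/-! ### The central limit theorem for the score -/

section CentralLimit

variable {m d l : ℕ} {g : (Fin m → ℝ) → (Fin d → ℝ) → Fin l → ℝ}
  {Θ : Set (Fin d → ℝ)} {P₀ : Measure (Fin m → ℝ)} {θ₀ : Fin d → ℝ}
  {S : Type*} {X : ℕ → S → Fin m → ℝ}

lemma dotProduct_score (t : Fin l → ℝ) (n : ℕ) (ω : S) :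
    t ⬝ᵥ score g θ₀ X (n, ω) = (√(n : ℝ))⁻¹ * ∑ k ∈ Finset.range n, t ⬝ᵥ g (X k ω) θ₀ := by
  have h : √(n : ℝ) * (n : ℝ)⁻¹ = (√(n : ℝ))⁻¹ := by
    rw [← div_eq_mul_inv, Real.sqrt_div_self', one_div]
  simp only [score, sampleMoment, avg, dotProduct, Pi.smul_apply, smul_eq_mul]
  rw [Finset.sum_comm, Finset.mul_sum]
  refine Finset.sum_congr rfl fun j _ => ?_
  rw [← Finset.mul_sum, Finset.sum_range (fun k => g (X k ω) θ₀ j), ← h]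
  ring

variable [MeasurableSpace S] {μ : Measure S}

lemma aemeasurable_score (h₁ : IsIdentified g Θ P₀ θ₀) (hlaw : ∀ i, HasLaw (X i) P₀ μ) (n : ℕ) :
    AEMeasurable (fun ω => score g θ₀ X (n, ω)) μ := by
  refine aemeasurable_pi_lambda _ fun j => ?_
  simp only [score, sampleMoment, avg, Pi.smul_apply, smul_eq_mul]
  refine (AEMeasurable.const_mul (Finset.aemeasurable_fun_sum _ fun i _ => ?_) _).const_mul _
  exact (h₁.measurable_section h₁.mem j).comp_aemeasurable (hlaw i).aemeasurable

variable [IsProbabilityMeasure P₀]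

lemma IsIdentified.integral_dotProduct (h₁ : IsIdentified g Θ P₀ θ₀) (t : Fin l → ℝ) :
    ∫ x, t ⬝ᵥ g x θ₀ ∂P₀ = 0 := by
  simp only [dotProduct]
  rw [integral_finsetSum _ fun j _ => (h₁.integrable h₁.mem j).const_mul _]
  exact Finset.sum_eq_zero fun j _ => by
    rw [integral_const_mul, h₁.integral_apply_eq_zero, mul_zero]

variable [IsProbabilityMeasure μ]

/-- The one-dimensional central limit theorem for a linear combination of the components of the
score. -/
lemma tendstoInDistribution_dotProduct_score (h₁ : IsIdentified g Θ P₀ θ₀)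
    (hindep : iIndepFun X μ) (hlaw : ∀ i, HasLaw (X i) P₀ μ) (t : Fin l → ℝ) :
    TendstoInDistribution (fun (n : ℕ) ω => t ⬝ᵥ score g θ₀ X (n, ω)) atTop id
      (fun _ => μ) (gaussianReal 0 (t ⬝ᵥ momentMatrix g P₀ θ₀ *ᵥ t).toNNReal) := by
  have hX : ∀ i, AEMeasurable (X i) μ := fun i => (hlaw i).aemeasurable
  have hf : Measurable fun x => t ⬝ᵥ g x θ₀ :=
    Finset.measurable_fun_sum _ fun j _ => (h₁.measurable_section h₁.mem j).const_mul _
  have hLp : MemLp (fun x => t ⬝ᵥ g x θ₀) 2 P₀ :=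
    memLp_finsetSum _ fun j _ => (h₁.memLp_two h₁.mem j).const_mul _
  have hident : ∀ i, IdentDistrib (fun ω => t ⬝ᵥ g (X i ω) θ₀) (fun ω => t ⬝ᵥ g (X 0 ω) θ₀) μ μ :=
    fun i => (IdentDistrib.mk (hX i) (hX 0)
      ((hlaw i).map_eq.trans (hlaw 0).map_eq.symm)).comp hf
  have hmean : ∫ ω, t ⬝ᵥ g (X 0 ω) θ₀ ∂μ = 0 := by
    rw [← h₁.integral_dotProduct t, ← (hlaw 0).map_eq,
      integral_map (hX 0) hf.aestronglyMeasurable]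
  have hLp0 : MemLp (fun ω => t ⬝ᵥ g (X 0 ω) θ₀) 2 μ := by
    rw [← (hlaw 0).map_eq] at hLp
    exact (memLp_map_measure_iff hf.aestronglyMeasurable (hX 0)).1 hLp
  have hvar : Var[fun ω => t ⬝ᵥ g (X 0 ω) θ₀; μ] = t ⬝ᵥ momentMatrix g P₀ θ₀ *ᵥ t := by
    rw [variance_of_integral_eq_zero hLp0.aemeasurable hmean, h₁.dotProduct_momentMatrix,
      ← (hlaw 0).map_eq, integral_map (hX 0) (hf.pow_const 2).aestronglyMeasurable]
  have hclt := tendstoInDistribution_inv_sqrt_mul_sum_sub (Y := id)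
    (X := fun k ω => t ⬝ᵥ g (X k ω) θ₀) (P := μ)
    (P' := gaussianReal 0 Var[fun ω => t ⬝ᵥ g (X 0 ω) θ₀; μ].toNNReal)
    HasLaw.id hLp0 (hindep.comp (fun _ x => t ⬝ᵥ g x θ₀) fun _ => hf) hident
  simp only [hmean, mul_zero, sub_zero, hvar, ← dotProduct_score] at hclt
  exact hclt

/-- The score is asymptotically normal, with covariance matrix `Ω`. -/
theorem tendstoInDistribution_score (h₁ : IsIdentified g Θ P₀ θ₀) (hindep : iIndepFun X μ)
    (hlaw : ∀ i, HasLaw (X i) P₀ μ) :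
    TendstoInDistribution (fun (n : ℕ) ω => WithLp.toLp 2 (score g θ₀ X (n, ω))) atTop id
      (fun _ => μ) (multivariateGaussian 0 (momentMatrix g P₀ θ₀)) := by
  have hmeas : ∀ n : ℕ, AEMeasurable (fun ω =>
      (WithLp.toLp 2 (score g θ₀ X (n, ω)) : EuclideanSpace ℝ (Fin l))) μ := fun n =>
    (PiLp.continuous_toLp 2 _).measurable.comp_aemeasurable (aemeasurable_score h₁ hlaw n)
  refine ⟨hmeas, aemeasurable_id, ?_⟩
  refine ProbabilityMeasure.tendsto_iff_tendsto_charFun.2 fun t => ?_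
  -- The characteristic function of the score at `t` is the one of `t ⬝ᵥ score` at `1`.
  have hclt := tendstoInDistribution_dotProduct_score h₁ hindep hlaw (WithLp.ofLp t)
  have hlim := ProbabilityMeasure.tendsto_iff_tendsto_charFun.1 hclt.tendsto 1
  simp only [ProbabilityMeasure.coe_mk, Measure.map_id] at hlim ⊢
  have hleft : ∀ n : ℕ, charFun (μ.map fun ω =>
      (WithLp.toLp 2 (score g θ₀ X (n, ω)) : EuclideanSpace ℝ (Fin l))) t =
      charFun (μ.map fun ω => WithLp.ofLp t ⬝ᵥ score g θ₀ X (n, ω)) 1 := fun n => by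
    rw [charFun_apply, charFun_apply, integral_map (hmeas n) (by fun_prop),
      integral_map (hclt.forall_aemeasurable n) (by fun_prop)]
    simp [EuclideanSpace.inner_eq_star_dotProduct]
  have hnonneg : 0 ≤ WithLp.ofLp t ⬝ᵥ momentMatrix g P₀ θ₀ *ᵥ WithLp.ofLp t := by
    simpa using h₁.posDef.posSemidef.dotProduct_mulVec_nonneg (WithLp.ofLp t)
  have hright : charFun (multivariateGaussian 0 (momentMatrix g P₀ θ₀)) t = charFun
      (gaussianReal 0 (WithLp.ofLp t ⬝ᵥ momentMatrix g P₀ θ₀ *ᵥ WithLp.ofLp t).toNNReal) 1 := by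
    rw [charFun_multivariateGaussian h₁.posDef.posSemidef, charFun_gaussianReal,
      Real.coe_toNNReal _ hnonneg]
    simp
  rw [hright]
  exact hlim.congr fun n => (hleft n).symm

end CentralLimit

/-! ### The limit laws of the estimate and of the divergence -/

section LimitLaws

variable {m d l : ℕ} {φ : ℝ → ℝ≥0∞} {g : (Fin m → ℝ) → (Fin d → ℝ) → Fin l → ℝ}
  {Θ : Set (Fin d → ℝ)} {P₀ : Measure (Fin m → ℝ)} [IsProbabilityMeasure P₀] {θ₀ : Fin d → ℝ}
  {S : Type*} [MeasurableSpace S] {μ : Measure S} [IsProbabilityMeasure μ] {X : ℕ → S → Fin m → ℝ}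

/-- A property which holds with probability tending to one wherever the score is bounded by a
constant holds with probability tending to one, because the score is bounded in probability. -/
lemma eventually_whp_of_norm_score_le (h₁ : IsIdentified g Θ P₀ θ₀) (hindep : iIndepFun X μ)
    (hlaw : ∀ i, HasLaw (X i) P₀ μ) {P : ℕ × S → Prop}
    (h : ∀ K : ℝ, ∀ᶠ p in whp μ, ‖score g θ₀ X p‖ ≤ K → P p) : ∀ᶠ p in whp μ, P p := by
  refine eventually_whp_of_tight (z := fun p => ‖score g θ₀ X p‖) (fun ε hε => ?_) h
  obtain ⟨K, hK⟩ :=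
    exists_eventually_measure_norm_le (tendstoInDistribution_score h₁ hindep hlaw) hε
  refine ⟨max K 0, hK.mono fun n hn => (measure_mono fun ω hω => ?_).trans hn⟩
  contrapose! hω
  simp only [mem_ofPred_eq, not_lt] at hω ⊢
  refine (pi_norm_le_iff_of_nonneg (le_max_right _ _)).2 fun j => ?_
  exact (PiLp.norm_apply_le (WithLp.toLp 2 (score g θ₀ X (n, ω))) j).trans
    (hω.trans (le_max_left _ _))

/-- The statistic `2 n D` is asymptotically equivalent to the minimum `quad Ω (residual G Ω z)` of
the limiting quadratic problem, and therefore has the same limit law. -/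
theorem tendstoInLaw_divModel (hφ : IsDivergenceFunction φ) (h₁ : IsIdentified g Θ P₀ θ₀)
    (h₂ : IsSmooth g Θ P₀ θ₀) (hindep : iIndepFun X μ) (hlaw : ∀ i, HasLaw (X i) P₀ μ) :
    TendstoInLaw μ
      (fun n ω => ((2 * n : ℝ) : EReal) * divModel φ g Θ (fun i : Fin n => X i ω))
      (chiSquare (l - d)) := by
  have hlim := map_quad_residual h₁.posDef h₂.rank_eq
  have hcont : Continuous fun z : EuclideanSpace ℝ (Fin l) =>
      quad (momentMatrix g P₀ θ₀)
        (residual (gradMatrix g P₀ θ₀) (momentMatrix g P₀ θ₀) (WithLp.ofLp z)) := by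
    simp only [quad, residual]
    fun_prop
  have : IsProbabilityMeasure (chiSquare (l - d)) := by
    rw [← hlim]
    exact Measure.isProbabilityMeasure_map hcont.aemeasurable
  have hQ := (tendstoInDistribution_score h₁ hindep hlaw).continuous_comp hcont
  have hQ' := tendstoInDistribution_congr_law (W' := id) (ν' := chiSquare (l - d)) hQ
    aemeasurable_id (by rw [Measure.map_id, ← hlim]; rfl)
  refine tendstoInLaw_of_forall_eventually hQ' fun ε hε => ?_
  refine eventually_whp_of_norm_score_le h₁ hindep hlaw fun K => ?_
  exact (eventually_expansion hφ h₁ h₂ hindep hlaw K hε).mono fun p hp hK => (hp hK).1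

/-- The normalized error of the estimate is asymptotically equivalent to the linear image
`minimizer G Ω *ᵥ z` of the score `z`, which is asymptotically normal. -/
theorem tendstoInDistribution_estimate (hφ : IsDivergenceFunction φ)
    (h₁ : IsIdentified g Θ P₀ θ₀) (h₂ : IsSmooth g Θ P₀ θ₀) (hindep : iIndepFun X μ)
    (hlaw : ∀ i, HasLaw (X i) P₀ μ) {θhat : ℕ → S → Fin d → ℝ}
    (hmeas : ∀ n, AEMeasurable (θhat n) μ)
    (hest : Tendsto (fun n => μ {ω | ¬ IsMinDivEstimate φ g Θ (fun i : Fin n => X i ω)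
      (θhat n ω)}) atTop (𝓝 0)) :
    TendstoInDistribution (fun (n : ℕ) ω => WithLp.toLp 2 (√(n : ℝ) • (θhat n ω - θ₀))) atTop id
      (fun _ => μ) (multivariateGaussian 0
        (infoMatrix (gradMatrix g P₀ θ₀) (momentMatrix g P₀ θ₀))⁻¹) := by
  set Ω := momentMatrix g P₀ θ₀ with hΩ
  set G := gradMatrix g P₀ θ₀ with hG
  have hcont : Continuous fun z : EuclideanSpace ℝ (Fin l) =>
      (WithLp.toLp 2 (minimizer G Ω *ᵥ WithLp.ofLp z) : EuclideanSpace ℝ (Fin d)) := by fun_prop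
  have hlim := map_mulVec_multivariateGaussian h₁.posDef.posSemidef (minimizer G Ω)
  rw [minimizer_mul_mul_transpose h₁.posDef h₂.rank_eq] at hlim
  have hU := (tendstoInDistribution_score h₁ hindep hlaw).continuous_comp hcont
  have hU' := tendstoInDistribution_congr_law (W' := id)
    (ν' := multivariateGaussian 0 (infoMatrix G Ω)⁻¹) hU
    aemeasurable_id (by rw [Measure.map_id, ← hlim]; rfl)
  refine tendstoInDistribution_of_tendstoInMeasure_sub _ _ hU' ?_ fun n => ?_
  · rw [tendstoInMeasure_iff_norm]
    intro ε hε
    -- the expansion is in the supremum norm, which costs a factor `√d`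
    have hδ : 0 < ε / (√d + 1) := by positivity
    have hexp := eventually_whp_of_norm_score_le h₁ hindep hlaw fun K =>
      (eventually_expansion hφ h₁ h₂ hindep hlaw K hδ).mono fun p hp hK => (hp hK).2
    have hgood := hexp.and (eventually_whp.2 hest :
      ∀ᶠ p in whp μ, IsMinDivEstimate φ g Θ (fun i : Fin p.1 => X i p.2) (θhat p.1 p.2))
    refine tendsto_of_tendsto_of_tendsto_of_le_of_le tendsto_const_nhds (eventually_whp.1 hgood)
      (fun _ => zero_le) fun n => measure_mono fun ω hω hgood => ?_
    have h := hgood.1 _ hgood.2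
    simp only [mem_ofPred_eq, Pi.sub_apply, Function.comp_apply, Pi.zero_apply, sub_zero,
      ← WithLp.toLp_sub] at hω
    have hle : ‖(WithLp.toLp 2 (√(n : ℝ) • (θhat n ω - θ₀) - minimizer G Ω *ᵥ score g θ₀ X (n, ω)) :
        EuclideanSpace ℝ (Fin d))‖ ≤ √d * (ε / (√d + 1)) := by
      rw [EuclideanSpace.norm_eq]
      refine (Real.sqrt_le_sqrt (Finset.sum_le_card_nsmul _ _ ((ε / (√d + 1)) ^ 2)
        fun i _ => pow_le_pow_left₀ (norm_nonneg _) ((norm_le_pi_norm _ i).trans h) 2)).trans_eq ?_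
      rw [Finset.card_univ, Fintype.card_fin, nsmul_eq_mul, Real.sqrt_mul (Nat.cast_nonneg d),
        Real.sqrt_sq hδ.le]
    refine absurd (hω.trans hle) (not_le.2 ?_)
    rw [← mul_div_assoc, div_lt_iff₀ (by positivity)]
    linarith
  · exact (PiLp.continuous_toLp 2 _).measurable.comp_aemeasurable
      (((hmeas n).sub_const θ₀).const_smul (√(n : ℝ)))

end LimitLaws

end MinDiv

theorem theorem2 {m d l : ℕ}
    (φ : ℝ → ℝ≥0∞) (hφ : MinDiv.IsDivergenceFunction φ)
    (g : (Fin m → ℝ) → (Fin d → ℝ) → Fin l → ℝ)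
    (Θ : Set (Fin d → ℝ)) (θ₀ : Fin d → ℝ)
    (P₀ : Measure (Fin m → ℝ)) [IsProbabilityMeasure P₀]
    (h₁ : MinDiv.IsIdentified g Θ P₀ θ₀) (h₂ : MinDiv.IsSmooth g Θ P₀ θ₀)
    {S : Type*} [MeasurableSpace S] (μ : Measure S) [IsProbabilityMeasure μ]
    (X : ℕ → S → Fin m → ℝ) (hindep : iIndepFun X μ) (hlaw : ∀ i, HasLaw (X i) P₀ μ) :
    (∀ θhat : ℕ → S → Fin d → ℝ, (∀ n, AEMeasurable (θhat n) μ) →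
      Tendsto (fun n => μ {ω | ¬ MinDiv.IsMinDivEstimate φ g Θ
        (fun i : Fin n => X i ω) (θhat n ω)}) atTop (𝓝 0) →
      TendstoInDistribution
        (fun (n : ℕ) ω => WithLp.toLp 2 (√(n : ℝ) • (θhat n ω - θ₀))) atTop id (fun _ => μ)
        (multivariateGaussian 0 ((MinDiv.gradMatrix g P₀ θ₀ *
          (MinDiv.momentMatrix g P₀ θ₀)⁻¹ * (MinDiv.gradMatrix g P₀ θ₀)ᵀ)⁻¹))) ∧
    (d < l →
      MinDiv.TendstoInLaw μ
        (fun n ω => ((2 * n : ℝ) : EReal) * MinDiv.divModel φ g Θ (fun i : Fin n => X i ω))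
        (MinDiv.chiSquare (l - d))) :=
  ⟨fun _ hmeas hest => MinDiv.tendstoInDistribution_estimate hφ h₁ h₂ hindep hlaw hmeas hest,
    fun _ => MinDiv.tendstoInLaw_divModel hφ h₁ h₂ hindep hlaw⟩
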